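/- **Setting.** Let $n,m,b,T\ge 1$ be integers with $b\le m$. Client $i\in[n]$ holds $D_i=(d_{i,1},\dots,d_{i,m})$; put $f_{i,j}(x)=f(x;d_{i,j})$ for $x\in\mathbb R^d$, $f_i=\frac1m\sum_j f_{i,j}$, $f=\frac1n\sum_i f_i$. Assume that $f^*:=\inf f>-\infty$ and that every $f_{i,j}$ is $L$-smooth (differentiable with $L$-Lipschitz gradient), $L>0$. *SoteriaFL.* Start from $x^0$, $s_i^0=0$, $s^0=0$. In round $t=0,\dots,T-1$ each client computes a local gradient estimator $\tilde g_i^t$, draws $\xi_i^t\sim\mathcal N(0,\sigma_p^2 I)$, sets $g_i^t=\tilde g_i^t+\xi_i^t$, sends $v_i^t=\mathcal C_i^t(g_i^t-s_i^t)$ and sets $s_i^{t+1}=s_i^t+\gamma v_i^t$; the server sets $v^t=s^t+\frac1n\sum_i v_i^t$, $x^{t+1}=x^t-\eta v^t$, $s^{t+1}=s^t+\gamma\frac1n\sum_i v_i^t$. The $\mathcal C_i^t$ are drawn independently, and are random maps with $\mathbb E[\mathcal C_i^t(x)]=x$ and $\mathbb E\|\mathcal C_i^t(x)-x\|^2\le\omega\|x\|^2$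 for all $x$, where $\omega\ge0$. *Estimator assumption.* $\tilde g_i^t=\frac1b\sum_{j\in I_{b,i}^t}\varphi_{i,j}^t+\frac1m\sum_{j=1}^m\psi_{i,j}^t$, where the minibatch $I_{b,i}^t\subseteq[m]$ contains each $j$ independently with probability $b/m$ (independently over clients and rounds), and $\varphi_{i,j}^t,\psi_{i,j}^t$ are functions of the sample $d_{i,j}$, of a memory cell attached to this sample, of the public state $(x^t,(s_k^t)_k,s^t)$ and of data-independent local coins, with $\|\varphi_{i,j}^t\|\le G_A$, $\|\psi_{i,j}^t\|\le G_B$ for all possible data. The memory cell is updated after each round from the sample, the cell, the public state and messages, the event $j\in I_{b,i}^t$, and data-independent coins. With $\mathbb E_t$ the expectation conditioned on the history before round $t$, $\mathbb E_t[\tilde g_i^t]=\nabla f_i(x^t)$, and there are constants $C_1,C_2,C_3,C_4\ge0$, $\theta>0$ and nonnegative integrable random variables $\Delta^t$, each determined by the history before round $t$, such that for $0\le t<T$ $$\mathbb E_t\Big[\frac1n\sum_{i=1}^n\|\tilde g_i^t-\nabla f_i(x^t)\|^2\Big]\le C_1\Delta^t+C_2,\qquad \mathbb E_t[\Delta^{t+1}]\le(1-\theta)\Delta^t+C_3\|\nabla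 f(x^t)\|^2+C_4\,\mathbb E_t\|x^{t+1}-x^t\|^2 .$$ *Local differential privacy.* $T$ rounds of the algorithm are $(\epsilon,\delta)$-LDP if for every client $i$, all data of the other clients, all $D_i,D_i'$ that differ in at most one entry and every event $E$, the law of all messages $(v_k^t)_{k\in[n],t<T}$ satisfies $\Pr_{D_i}(E)\le e^\epsilon\Pr_{D_i'}(E)+\delta$. **Theorem.** For every $\kappa>0$ there are constants $c,c',K>0$, depending only on $\kappa$, such that the following holds in the above setting. Let $\beta>0$, $\alpha=\frac{3\beta C_1}{2(1+\omega)\theta L^2}$, $\gamma=\sqrt{\frac{1+2\omega}{2(1+\omega)^3}}$, $$0<\eta\le\min\Big\{\frac1{(1+2\alpha C_4+4\beta(1+\omega)+2\alpha C_3/\eta^2)L},\ \frac{\sqrt{\beta n}}{\sqrt{1+2\alpha C_4+4\beta(1+\omega)}\,(1+\omega)L}\Big\},$$ and let $\epsilon>0$, $\delta\in(0,1)$ and $\sigma_p^2=c\,\frac{(G_A^2/4+G_B^2)T\log(1/\delta)}{m^2\epsilon^2}$. Put $\Phi_0=f(x^0)-f^*+\alpha L\Delta^0+\frac{\beta}{Ln}\sum_{i=1}^n\|\nabla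 f_i(x^0)-s_i^0\|^2$. 1. If $\epsilon<c'b^2T/m^2$ and $\epsilon\le\kappa\log(1/\delta)$, then $T$ rounds of SoteriaFL are $(\epsilon,\delta)$-LDP. 2. The expectations below are finite and $$\frac1T\sum_{t=0}^{T-1}\mathbb E\|\nabla f(x^t)\|^2\le\frac{2\Phi_0}{\eta T}+\frac{3\beta}{(1+\omega)L\eta}\Big(C_2+\frac{c(G_A^2/4+G_B^2)dT\log(1/\delta)}{m^2\epsilon^2}\Big).$$ 3. If $M\le T\le 2M$ for $$M=\max\Big\{\frac{m\epsilon\sqrt{2(1+\omega)L\Phi_0}}{\sqrt{3\beta cd(G_A^2/4+G_B^2)\log(1/\delta)}},\ \frac{C_2m^2\epsilon^2}{cd(G_A^2/4+G_B^2)\log(1/\delta)}\Big\}$$ (where a fraction with denominator $0$ counts as $0$), in particular if $T=M$, then $$\frac1T\sum_{t=0}^{T-1}\mathbb E\|\nabla f(x^t)\|^2\le K\max\Big\{\sqrt{\Phi_0}\,\frac{\sqrt{\beta d(G_A^2/4+G_B^2)\log(1/\delta)}}{\eta m\epsilon\sqrt{(1+\omega)L}},\ \frac{\beta C_2}{(1+\omega)L\eta}\Big\}.$$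 -/

import Mathlib

open MeasureTheory ProbabilityTheory

universe u₁ u₂ u₃ u₄ u₅

noncomputable section

/-- The model space `ℝ^d` with the Euclidean norm. -/
abbrev Vec (d : ℕ) : Type := EuclideanSpace ℝ (Fin d)

/-! ### The optimization problem -/

section Problem

variable {𝒟 : Type u₁} {n m d : ℕ}

/-- `f_i(x) = (1/m) ∑_j f(x; d_{i,j})`, the loss of one client with local data `Di`. -/
def localLoss (ℓ : 𝒟 → Vec d → ℝ) (Di : Fin m → 𝒟) (x : Vec d) : ℝ :=
  (1 / (m : ℝ)) * ∑ j, ℓ (Di j) x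

/-- `f(x) = (1/n) ∑_i f_i(x)`. -/
def globalLoss (ℓ : 𝒟 → Vec d → ℝ) (D : Fin n → Fin m → 𝒟) (x : Vec d) : ℝ :=
  (1 / (n : ℝ)) * ∑ i, localLoss ℓ (D i) x

/-- A function is `L`-smooth: differentiable, with `L`-Lipschitz gradient. -/
def IsSmooth (L : ℝ) (g : Vec d → ℝ) : Prop :=
  Differentiable ℝ g ∧ ∀ x y, ‖gradient g x - gradient g y‖ ≤ L * ‖x - y‖

end Problem

/-! ### Compression operators and local differential privacy -/

/-- `C`, with internal randomness of law `ρ`, is an `ω`-compression operator. -/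
structure IsCompression {d : ℕ} {S : Type u₅} [MeasurableSpace S] (ω : ℝ)
    (ρ : Measure S) (C : S → Vec d → Vec d) : Prop where
  measurable : Measurable (Function.uncurry C)
  memLp : ∀ x, MemLp (fun s => C s x) 2 ρ
  mean : ∀ x, ∫ s, C s x ∂ρ = x
  variance : ∀ x, ∫ s, ‖C s x - x‖ ^ 2 ∂ρ ≤ ω * ‖x‖ ^ 2

/-- Two local datasets of the same size are neighbors if they differ in at most one entry. -/
def IsNeighbor {𝒟 : Type u₁} {m : ℕ} (Di Di' : Fin m → 𝒟) : Prop :=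
  ∃ j, ∀ k, k ≠ j → Di k = Di' k

/-- A randomized mechanism on local datasets, given by its output laws, is `(ε, δ)`-LDP. -/
def IsLDP {𝒟 : Type u₁} {m : ℕ} {R : Type*} [MeasurableSpace R] (ε δ : ℝ)
    (M : (Fin m → 𝒟) → Measure R) : Prop :=
  ∀ Di Di', IsNeighbor Di Di' → ∀ E, MeasurableSet E →
    M Di E ≤ ENNReal.ofReal (Real.exp ε) * M Di' E + ENNReal.ofReal δ

/-! ### The algorithm -/

/-- The public state `(x, (s_i)_i, s)`: model, client references and server reference. -/
abbrev Pub (n d : ℕ) : Type := Vec d × (Fin n → Vec d) × Vec d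

/-- Randomness of one client in one round: a local coin for the estimator, the indicators of the
minibatch, the Gaussian perturbation, and the randomness of the compression operator. -/
abbrev ClientSeed (m d : ℕ) (W : Type u₄) (S : Type u₅) : Type (max u₄ u₅) :=
  W × (Fin m → Bool) × Vec d × S

/-- Randomness of one round: a coin common to all clients, and the seeds of the clients. -/
abbrev RoundSeed (n m d : ℕ) (V : Type u₃) (W : Type u₄) (S : Type u₅) : Type (max u₃ u₄ u₅) :=
  V × (Fin n → ClientSeed m d W S)

/-- The state of the algorithm: public state and one memory cell for each data sample. -/
abbrev State (n m d : ℕ) (U : Type u₂) : Type u₂ := Pub n d × (Fin n → Fin m → U)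

/-- A local gradient estimator of the form
`(1/b) ∑_{j ∈ I_b} φ_{i,j}^t + (1/m) ∑_j ψ_{i,j}^t`.
The vectors `φ_{i,j}^t`, `ψ_{i,j}^t` are functions of the sample `d_{i,j}`, of a memory cell
attached to this sample, of the public state, and of a local coin of the client. The memory cell
(e.g. the reference point of SVRG or SAGA) is updated at the end of a round from the sample, the
cell, the public state and messages of the round, whether the sample was in the minibatch, and
the common and the local coin. The laws of the coins do not depend on the data. -/
structure Estimator (n m d : ℕ) (𝒟 : Type u₁) (U : Type u₂) (V : Type u₃) (W : Type u₄)
    [MeasurableSpace U] [MeasurableSpace V] [MeasurableSpace W] where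
  φ : ℕ → Fin n → Fin m → 𝒟 → U → Pub n d → W → Vec d
  ψ : ℕ → Fin n → Fin m → 𝒟 → U → Pub n d → W → Vec d
  init : Fin n → Fin m → 𝒟 → U
  update : ℕ → Fin n → Fin m → 𝒟 → U → Pub n d → (Fin n → Vec d) → Bool → V → W → U
  commonLaw : ℕ → ProbabilityMeasure V
  localLaw : ℕ → Fin n → ProbabilityMeasure W
  measurable_φ : ∀ t i j z, Measurable fun p : U × Pub n d × W => φ t i j z p.1 p.2.1 p.2.2
  measurable_ψ : ∀ t i j z, Measurable fun p : U × Pub n d × W => ψ t i j z p.1 p.2.1 p.2.2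
  measurable_update : ∀ t i j z, Measurable
    fun p : U × Pub n d × (Fin n → Vec d) × Bool × V × W =>
      update t i j z p.1 p.2.1 p.2.2.1 p.2.2.2.1 p.2.2.2.2.1 p.2.2.2.2.2

/-- An instance of SoteriaFL: a local gradient estimator, minibatch size `b`, compression operators
`C_i^t` with the laws of their randomness, initial point `x⁰`, constant stepsize `η`, constant
shift stepsize `γ`, and variance `σ_p²` of the perturbation. -/
structure SoteriaFL (n m d : ℕ) (𝒟 : Type u₁) (U : Type u₂) (V : Type u₃) (W : Type u₄)
    (S : Type u₅) [MeasurableSpace U] [MeasurableSpace V] [MeasurableSpace W]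
    [MeasurableSpace S] where
  est : Estimator n m d 𝒟 U V W
  b : ℕ
  comp : ℕ → Fin n → S → Vec d → Vec d
  compLaw : ℕ → Fin n → ProbabilityMeasure S
  x₀ : Vec d
  η : ℝ
  γ : ℝ
  varP : ℝ

namespace SoteriaFL

variable {n m d : ℕ} {𝒟 : Type u₁} {U : Type u₂} {V : Type u₃} {W : Type u₄} {S : Type u₅}
  [MeasurableSpace U] [MeasurableSpace V] [MeasurableSpace W] [MeasurableSpace S]
  (A : SoteriaFL n m d 𝒟 U V W S)

/-- The law `N(0, σ_p² I)` of the perturbation. -/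
def noiseLaw : Measure (Vec d) :=
  (stdGaussian (Vec d)).map fun z => Real.sqrt A.varP • z

/-- The law of the minibatch indicators: each sample is chosen independently with
probability `b/m`. -/
def batchLaw : Measure (Fin m → Bool) :=
  Measure.pi fun _ =>
    bernoulliMeasure true false (Set.projIcc (0 : ℝ) 1 zero_le_one ((A.b : ℝ) / m))

/-- The law of the randomness of round `t`; all its components are independent. -/
def roundLaw (t : ℕ) : Measure (RoundSeed n m d V W S) :=
  (A.est.commonLaw t : Measure V).prod (Measure.pi fun i =>
    (A.est.localLaw t i : Measure W).prod
      (A.batchLaw.prod (A.noiseLaw.prod (A.compLaw t i : Measure S))))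

/-- The law of the whole randomness; the rounds are independent. -/
def law : Measure (ℕ → RoundSeed n m d V W S) := Measure.infinitePi A.roundLaw

/-- The local gradient estimator of client `i` at round `t`. -/
def estimate (t : ℕ) (i : Fin n) (Di : Fin m → 𝒟) (st : State n m d U)
    (c : ClientSeed m d W S) : Vec d :=
  (1 / (A.b : ℝ)) • (∑ j with c.2.1 j = true, A.est.φ t i j (Di j) (st.2 i j) st.1 c.1) +
    (1 / (m : ℝ)) • ∑ j, A.est.ψ t i j (Di j) (st.2 i j) st.1 c.1

/-- The message `v_i^t = C_i^t(g_i^t - s_i^t)`, where `g_i^t` is the perturbed estimate. -/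
def message (t : ℕ) (i : Fin n) (Di : Fin m → 𝒟) (st : State n m d U)
    (c : ClientSeed m d W S) : Vec d :=
  A.comp t i c.2.2.2 (A.estimate t i Di st c + c.2.2.1 - st.1.2.1 i)

/-- Initial state: `x⁰`, all references zero, initial memory. -/
def initState (D : Fin n → Fin m → 𝒟) : State n m d U :=
  ((A.x₀, fun _ => 0, 0), fun i j => A.est.init i j (D i j))

/-- One round of the algorithm. -/
def step (D : Fin n → Fin m → 𝒟) (t : ℕ) (st : State n m d U) (r : RoundSeed n m d V W S) :
    State n m d U :=
  let v : Fin n → Vec d := fun i => A.message t i (D i) st (r.2 i)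
  let vbar : Vec d := (1 / (n : ℝ)) • ∑ i, v i
  ((st.1.1 - A.η • (st.1.2.2 + vbar),
    fun i => st.1.2.1 i + A.γ • v i,
    st.1.2.2 + A.γ • vbar),
   fun i j => A.est.update t i j (D i j) (st.2 i j) st.1 v ((r.2 i).2.1 j) r.1 (r.2 i).1)

/-- The state before round `t`. -/
def state (D : Fin n → Fin m → 𝒟) : ℕ → (ℕ → RoundSeed n m d V W S) → State n m d U
  | 0, _ => A.initState D
  | t + 1, r => A.step D t (state D t r) (r t)

/-- The iterate `x^t`. -/
def iterate (D : Fin n → Fin m → 𝒟) (t : ℕ) (r : ℕ → RoundSeed n m d V W S) : Vec d :=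
  (A.state D t r).1.1

/-- The gradient estimator of client `i` in round `t`, as a random vector. -/
def gradEst (D : Fin n → Fin m → 𝒟) (t : ℕ) (i : Fin n) (r : ℕ → RoundSeed n m d V W S) : Vec d :=
  A.estimate t i (D i) (A.state D t r) ((r t).2 i)

/-- All messages sent by the clients in the first `T` rounds. -/
def transcript (D : Fin n → Fin m → 𝒟) (T : ℕ) (r : ℕ → RoundSeed n m d V W S) :
    Fin T → Fin n → Vec d :=
  fun t i => A.message t i (D i) (A.state D t r) ((r t).2 i)

/-- The mechanism for client `i`: from the local dataset of client `i`, with the data `D` of the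
other clients fixed, to the law of the transcript of `T` rounds. -/
def mechanism (D : Fin n → Fin m → 𝒟) (T : ℕ) (i : Fin n) (Di : Fin m → 𝒟) :
    Measure (Fin T → Fin n → Vec d) :=
  A.law.map (A.transcript (Function.update D i Di) T)

/-- `T` rounds of the algorithm are `(ε, δ)`-locally differentially private for every client. -/
def SatisfiesLDP (T : ℕ) (ε δ : ℝ) : Prop :=
  ∀ (D : Fin n → Fin m → 𝒟) (i : Fin n), IsLDP ε δ (A.mechanism D T i)

/-- The history before round `t`: the σ-algebra of the randomness of the rounds `s < t`. -/
abbrev history (n m d : ℕ) (V : Type u₃) (W : Type u₄) (S : Type u₅)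
    [MeasurableSpace V] [MeasurableSpace W] [MeasurableSpace S] (t : ℕ) :
    MeasurableSpace (ℕ → RoundSeed n m d V W S) :=
  cylinderEvents (X := fun _ => RoundSeed n m d V W S) (Set.Iio t)

/-- The generic assumption on the local gradient estimator, over `T` rounds on the dataset `D`;
`A.law[X | history t]` is the conditional expectation `𝔼_t[X]`. The bounds on `φ`, `ψ` are for
all data samples. -/
structure GenericAssumption (ℓ : 𝒟 → Vec d → ℝ) (D : Fin n → Fin m → 𝒟) (T : ℕ)
    (G_A G_B C₁ C₂ C₃ C₄ θ : ℝ) (Δ : ℕ → (ℕ → RoundSeed n m d V W S) → ℝ) : Prop where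
  G_A_nonneg : 0 ≤ G_A
  G_B_nonneg : 0 ≤ G_B
  C₁_nonneg : 0 ≤ C₁
  C₂_nonneg : 0 ≤ C₂
  C₃_nonneg : 0 ≤ C₃
  C₄_nonneg : 0 ≤ C₄
  θ_pos : 0 < θ
  bound_φ : ∀ t i j z u p w, ‖A.est.φ t i j z u p w‖ ≤ G_A
  bound_ψ : ∀ t i j z u p w, ‖A.est.ψ t i j z u p w‖ ≤ G_B
  Δ_nonneg : ∀ t ≤ T, ∀ r, 0 ≤ Δ t r
  Δ_measurable : ∀ t ≤ T, Measurable[history n m d V W S t] (Δ t)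
  Δ_integrable : ∀ t ≤ T, Integrable (Δ t) A.law
  unbiased : ∀ t < T, ∀ i,
    A.law[A.gradEst D t i | history n m d V W S t]
      =ᵐ[A.law] fun r => gradient (localLoss ℓ (D i)) (A.iterate D t r)
  variance : ∀ t < T,
    A.law[fun r => (1 / (n : ℝ)) *
        ∑ i, ‖A.gradEst D t i r - gradient (localLoss ℓ (D i)) (A.iterate D t r)‖ ^ 2
      | history n m d V W S t]
      ≤ᵐ[A.law] fun r => C₁ * Δ t r + C₂
  contraction : ∀ t < T,
    A.law[Δ (t + 1) | history n m d V W S t]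
      ≤ᵐ[A.law] fun r => (1 - θ) * Δ t r
        + C₃ * ‖gradient (globalLoss ℓ D) (A.iterate D t r)‖ ^ 2
        + C₄ * (A.law[fun r' => ‖A.iterate D (t + 1) r' - A.iterate D t r'‖ ^ 2
            | history n m d V W S t]) r

/-- `Φ₀ = f(x⁰) - f* + α L Δ⁰ + (β/(L n)) ∑_i ‖∇f_i(x⁰) - s_i⁰‖²`. As `Δ⁰` is measurable with
respect to the trivial history, it is a constant, equal to its expectation. -/
def potential (ℓ : 𝒟 → Vec d → ℝ) (D : Fin n → Fin m → 𝒟) (L α β : ℝ)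
    (Δ : ℕ → (ℕ → RoundSeed n m d V W S) → ℝ) : ℝ :=
  globalLoss ℓ D A.x₀ - (⨅ x, globalLoss ℓ D x) + α * L * (∫ r, Δ 0 r ∂A.law)
    + β / (L * n) * ∑ i, ‖gradient (localLoss ℓ (D i)) A.x₀ - (A.initState D).1.2.1 i‖ ^ 2

/-- `(1/T) ∑_{t<T} 𝔼‖∇f(x^t)‖²`. -/
def avgSqGrad (ℓ : 𝒟 → Vec d → ℝ) (D : Fin n → Fin m → 𝒟) (T : ℕ) : ℝ :=
  (1 / (T : ℝ)) * ∑ t ∈ Finset.range T,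
    ∫ r, ‖gradient (globalLoss ℓ D) (A.iterate D t r)‖ ^ 2 ∂A.law

end SoteriaFL

end

/-!
The result has two independent halves: privacy of the transcript and convergence of the iterates.

**Privacy.** Neighboring datasets differ in one sample `j` of one client. Given all the randomness of
a round except the indicator of `j` and the Gaussian perturbation of that client, the message depends
on sample `j` and its memory cell only through the sum of the perturbation and the contribution of
the sample, so the round is a Gaussian mechanism subsampled at rate `q = b/m`. Its density with
respect to the noise is a mixture `mixDensity` of two shifted Gaussians, with a shift of order
`1/m` from `ψ` and one of order `1/b` from `φ` that is present with probability `q` only. The moments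
of this density (`lintegral_mixDensity_rpow_le`) are at most `exp (C k² s²)` with `s` of order
`1/(mσ)`: the linear term of the expansion has mean zero, and the quadratic one profits from
subsampling. Composition over the rounds is adaptive, and the memory cells are hidden and differ in
the two worlds. Instead of densities of the transcripts, the proof propagates the dual form
`𝔼 F ≤ M^(1/p) (𝔼' F^{p'})^(1/p')` of a Rényi bound backwards through the rounds
(`value_le_of_agree`), uniformly over the two cells; Hölder's inequality gives one round
(`subsampledGaussian_dual_renyi`). For indicator functions, Young's inequality turns the dual bound
into `(ε, δ)`-privacy (`ENNReal.le_exp_mul_add_of_le_rpow`).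

**Convergence.** From a fixed state, each message is an unbiased estimate of `∇f_i(x) - s_i` whose
variance is controlled by the shift error, the estimator error and the noise (`message_moments`), and
the messages of different clients are independent. This gives a bound on the squared step length
(`step_sub_moments`), descent of `f` (`integral_globalLoss_step_le`), and, by the choice of `γ`, a
contraction by `1 - 1/(2(1+ω))` of the shift error (`integral_shiftError_step_le`). As the randomness
of a round is independent of the history, Fubini's theorem carries these bounds over to
expectations; unbiasedness given the history is transferred by `condExp_gradEst`. In the potential
`𝔼 f(x^t) + αL 𝔼 Δ^t + (β/L) 𝔼 (shift error)` all error terms cancel except for those of `C₂` and of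
the noise (`potential_step_le`), and the sum telescopes. The last claim is real arithmetic: the
number of rounds balances the two terms of the bound (`balanced_rounds_le`).
-/

open scoped RealInnerProductSpace ENNReal

/-! ### Shifts of the standard Gaussian law -/

section GaussianShift

lemma gaussianReal_map_add_eq_withDensity (w : ℝ) :
    (gaussianReal 0 1).map (· + w) =
      (gaussianReal 0 1).withDensity fun x => ENNReal.ofReal (Real.exp (w * x - w ^ 2 / 2)) := by
  rw [gaussianReal_map_add_const, zero_add, gaussianReal_of_var_ne_zero _ one_ne_zero,
    gaussianReal_of_var_ne_zero _ one_ne_zero,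
    ← withDensity_mul _ (measurable_gaussianPDF _ _) (by fun_prop)]
  congr 1
  ext x
  simp only [gaussianPDF, Pi.mul_apply]
  rw [← ENNReal.ofReal_mul (gaussianPDFReal_nonneg _ _ _)]
  congr 1
  simp only [gaussianPDFReal]
  rw [mul_assoc (_)⁻¹ (Real.exp _), ← Real.exp_add]
  congr 2
  push_cast
  ring

lemma pi_withDensity_prod {ι : Type*} [Fintype ι] {X : ι → Type*} [∀ i, MeasurableSpace (X i)]
    (μ : ∀ i, Measure (X i)) [∀ i, IsProbabilityMeasure (μ i)] (f : ∀ i, X i → ℝ≥0∞)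
    (hf : ∀ i, Measurable (f i)) [∀ i, SigmaFinite ((μ i).withDensity (f i))] :
    Measure.pi (fun i => (μ i).withDensity (f i)) =
      (Measure.pi μ).withDensity fun x => ∏ i, f i (x i) := by
  refine Measure.pi_eq fun s hs => ?_
  rw [withDensity_apply _ (MeasurableSet.univ_pi hs),
    ← lintegral_indicator (MeasurableSet.univ_pi hs)]
  have h1 : ∀ x : ∀ i, X i, (Set.univ.pi s).indicator (fun x => ∏ i, f i (x i)) x =
      ∏ i, (s i).indicator (f i) (x i) := by
    intro x
    by_cases hx : x ∈ Set.univ.pi s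
    · rw [Set.indicator_of_mem hx]
      exact Finset.prod_congr rfl fun i _ => (Set.indicator_of_mem (hx i trivial) _).symm
    · rw [Set.indicator_of_notMem hx]
      simp only [Set.mem_univ_pi, not_forall] at hx
      obtain ⟨i, hi⟩ := hx
      exact (Finset.prod_eq_zero (Finset.mem_univ i) (Set.indicator_of_notMem hi _)).symm
  simp_rw [h1]
  have hm : ∀ i, Measurable ((s i).indicator (f i)) := fun i => (hf i).indicator (hs i)
  rw [lintegral_prod_eq_prod_lintegral_of_indepFun Finset.univ
    (fun i (x : ∀ i, X i) => (s i).indicator (f i) (x i))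
    (iIndepFun_pi fun i => (hm i).aemeasurable)
    fun i => (hm i).comp (measurable_pi_apply i)]
  refine Finset.prod_congr rfl fun i _ => ?_
  rw [withDensity_apply _ (hs i), ← lintegral_indicator (hs i)]
  exact (measurePreserving_eval μ i).lintegral_comp (hm i)

/-- The density of the standard Gaussian law shifted by `w` with respect to the standard Gaussian
law. -/
noncomputable def shiftDensity {d : ℕ} (w z : Vec d) : ℝ := Real.exp (⟪w, z⟫ - ‖w‖ ^ 2 / 2)

lemma shiftDensity_pos {d : ℕ} (w z : Vec d) : 0 < shiftDensity w z := Real.exp_pos _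

@[fun_prop]
lemma measurable_shiftDensity {d : ℕ} (w : Vec d) : Measurable (shiftDensity w) := by
  unfold shiftDensity; fun_prop

/-- The Cameron–Martin formula. -/
lemma lintegral_stdGaussian_add {d : ℕ} (w : Vec d) {F : Vec d → ℝ≥0∞} (hF : Measurable F) :
    ∫⁻ z, F (z + w) ∂stdGaussian (Vec d) =
      ∫⁻ z, ENNReal.ofReal (shiftDensity w z) * F z ∂stdGaussian (Vec d) := by
  have hp : ∀ i, SigmaFinite ((gaussianReal 0 1).withDensity
      fun x => ENNReal.ofReal (Real.exp (w i * x - w i ^ 2 / 2))) := fun i => by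
    rw [← gaussianReal_map_add_eq_withDensity]; infer_instance
  have key : (Measure.pi fun _ : Fin d => gaussianReal 0 1).map (fun x i => x i + w i) =
      (Measure.pi fun _ : Fin d => gaussianReal 0 1).withDensity
        fun x => ∏ i, ENNReal.ofReal (Real.exp (w i * x i - w i ^ 2 / 2)) := by
    rw [← pi_withDensity_prod _ (fun i x => ENNReal.ofReal (Real.exp (w i * x - w i ^ 2 / 2)))
      (fun i => by fun_prop),
      Measure.pi_map_pi (f := fun i x => x + w i) (fun i => by fun_prop)]
    simp_rw [gaussianReal_map_add_eq_withDensity]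
  rw [← map_pi_eq_stdGaussian, lintegral_map (by fun_prop) (by fun_prop),
    lintegral_map (by fun_prop) (by fun_prop)]
  have h2 := lintegral_map (μ := Measure.pi fun _ : Fin d => gaussianReal 0 1)
    (f := fun x => F (WithLp.toLp 2 x)) (g := fun x i => x i + w i) (by fun_prop) (by fun_prop)
  rw [key, lintegral_withDensity_eq_lintegral_mul _ (by fun_prop) (by fun_prop)] at h2
  convert! h2.symm using 3 with x x
  simp only [Pi.mul_apply]
  rw [← ENNReal.ofReal_prod_of_nonneg (fun i _ => (Real.exp_pos _).le), ← Real.exp_sum]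
  rw [shiftDensity, EuclideanSpace.norm_sq_eq, Finset.sum_sub_distrib, Finset.sum_div]
  congr 2
  simp [PiLp.inner_apply, mul_comm]

lemma lintegral_shiftDensity {d : ℕ} (w : Vec d) :
    ∫⁻ z, ENNReal.ofReal (shiftDensity w z) ∂stdGaussian (Vec d) = 1 := by
  simpa using (lintegral_stdGaussian_add w (F := fun _ => 1) measurable_const).symm

lemma integrable_shiftDensity {d : ℕ} (w : Vec d) :
    Integrable (shiftDensity w) (stdGaussian (Vec d)) := by
  refine ⟨(measurable_shiftDensity w).aestronglyMeasurable, ?_⟩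
  rw [hasFiniteIntegral_iff_ofReal (ae_of_all _ fun z => (shiftDensity_pos w z).le),
    lintegral_shiftDensity]
  exact ENNReal.one_lt_top

lemma integral_shiftDensity {d : ℕ} (w : Vec d) :
    ∫ z, shiftDensity w z ∂stdGaussian (Vec d) = 1 := by
  rw [integral_eq_lintegral_of_nonneg_ae (ae_of_all _ fun z => (shiftDensity_pos w z).le)
    (measurable_shiftDensity w).aestronglyMeasurable, lintegral_shiftDensity, ENNReal.toReal_one]

lemma stdGaussian_map_inner {d : ℕ} (e : Vec d) :
    (stdGaussian (Vec d)).map (fun z => ⟪e, z⟫) = gaussianReal 0 (‖e‖ ^ 2).toNNReal := by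
  have h := IsGaussian.map_eq_gaussianReal (μ := stdGaussian (Vec d)) (innerSL ℝ e)
  rw [integral_strongDual_stdGaussian, variance_dual_stdGaussian, innerSL_apply_norm] at h
  exact h

lemma lintegral_exp_sq_gaussianReal :
    ∫⁻ x, ENNReal.ofReal (Real.exp (3 / 8 * x ^ 2)) ∂gaussianReal 0 1 = 2 := by
  rw [gaussianReal_of_var_ne_zero _ one_ne_zero,
    lintegral_withDensity_eq_lintegral_mul _ (measurable_gaussianPDF _ _) (by fun_prop)]
  have h : ∀ x : ℝ, (gaussianPDF 0 1 * fun x => ENNReal.ofReal (Real.exp (3 / 8 * x ^ 2))) x =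
      ENNReal.ofReal ((Real.sqrt (2 * Real.pi))⁻¹ * Real.exp (-(1 / 8) * x ^ 2)) := by
    intro x
    simp only [gaussianPDF, Pi.mul_apply]
    rw [← ENNReal.ofReal_mul (gaussianPDFReal_nonneg _ _ _)]
    simp only [gaussianPDFReal]
    rw [mul_assoc, ← Real.exp_add]
    simp only [NNReal.coe_one, mul_one, sub_zero]
    congr 3
    ring
  simp_rw [h]
  rw [← ofReal_integral_eq_lintegral_ofReal
    ((integrable_exp_neg_mul_sq (by norm_num)).const_mul _) (ae_of_all _ fun x => by positivity),
    integral_const_mul, integral_gaussian]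
  have : Real.sqrt (Real.pi / (1 / 8)) = 2 * Real.sqrt (2 * Real.pi) := by
    rw [show Real.pi / (1 / 8) = 2 ^ 2 * (2 * Real.pi) by ring, Real.sqrt_mul (by positivity),
      Real.sqrt_sq (by norm_num)]
  rw [this, ← mul_assoc, mul_comm _ (2 : ℝ), mul_assoc, inv_mul_cancel₀ (by positivity), mul_one]
  simp

/-- Squares of linear functionals of norm at most one have a uniformly bounded exponential
moment. -/
lemma lintegral_exp_sq_inner_le {d : ℕ} {e : Vec d} (he : ‖e‖ ≤ 1) :
    ∫⁻ z, ENNReal.ofReal (Real.exp (3 / 8 * ⟪e, z⟫ ^ 2)) ∂stdGaussian (Vec d) ≤ 2 := by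
  have h1 : ∫⁻ z, ENNReal.ofReal (Real.exp (3 / 8 * ⟪e, z⟫ ^ 2)) ∂stdGaussian (Vec d) =
      ∫⁻ x, ENNReal.ofReal (Real.exp (3 / 8 * x ^ 2)) ∂gaussianReal 0 (‖e‖ ^ 2).toNNReal := by
    rw [← stdGaussian_map_inner, lintegral_map (by fun_prop) (by fun_prop)]
  have h2 : gaussianReal 0 (‖e‖ ^ 2).toNNReal = (gaussianReal 0 1).map (‖e‖ * ·) := by
    rw [gaussianReal_map_const_mul]
    congr 1
    · simp
    · ext; simp
  rw [h1, h2, lintegral_map (by fun_prop) (by fun_prop)]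
  refine le_trans (lintegral_mono fun x => ENNReal.ofReal_le_ofReal (Real.exp_le_exp.2 ?_))
    lintegral_exp_sq_gaussianReal.le
  have : ‖e‖ ^ 2 ≤ 1 := by nlinarith [norm_nonneg e]
  nlinarith [mul_le_mul_of_nonneg_right this (sq_nonneg x)]

end GaussianShift

/-! ### Moments of a subsampled Gaussian density -/

section MixtureMoment

lemma abs_exp_sub_one_sub_le (x : ℝ) : |Real.exp x - 1 - x| ≤ x ^ 2 * Real.exp |x| := by
  have h := Complex.norm_exp_sub_sum_le_norm_mul_exp (x : ℂ) 2
  simp only [Finset.sum_range_succ, Finset.sum_range_zero, pow_zero, Nat.factorial_zero,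
    Nat.cast_one, div_one, zero_add, pow_one, Nat.factorial_one, Complex.norm_real,
    Real.norm_eq_abs, sq_abs] at h
  have h2 : Complex.exp (x : ℂ) - (1 + (x : ℂ)) = ((Real.exp x - 1 - x : ℝ) : ℂ) := by
    push_cast; ring
  rwa [h2, Complex.norm_real, Real.norm_eq_abs] at h

/-- A second-order expansion of `exp (μ ℓ)` whose linear term is `μ (exp ℓ - 1)`. It has mean zero
when `exp ℓ` is a density. -/
lemma exp_mul_le_of_abs_le {μ k : ℝ} (hk : 1 ≤ k) (hμ : |μ| ≤ k) (l : ℝ) :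
    Real.exp (μ * l) ≤ 1 + μ * (Real.exp l - 1) + 2 * k ^ 2 * (l ^ 2 * Real.exp (k * |l|)) := by
  have h1 := (le_abs_self _).trans (abs_exp_sub_one_sub_le (μ * l))
  have h2 : -(μ * (Real.exp l - 1 - l)) ≤ k * (l ^ 2 * Real.exp |l|) := by
    refine (neg_le_abs _).trans ?_
    rw [abs_mul]
    exact mul_le_mul hμ (abs_exp_sub_one_sub_le l) (abs_nonneg _) (by linarith)
  have h3 : (μ * l) ^ 2 * Real.exp |μ * l| ≤ k ^ 2 * (l ^ 2 * Real.exp (k * |l|)) := by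
    rw [mul_pow, ← sq_abs μ, abs_mul, mul_assoc]
    gcongr
  have h4 : k * (l ^ 2 * Real.exp |l|) ≤ k ^ 2 * (l ^ 2 * Real.exp (k * |l|)) := by
    gcongr
    · nlinarith
    · nlinarith [abs_nonneg l]
  linarith

lemma mix_pos {q : ℝ} (h0 : 0 ≤ q) (h1 : q ≤ 1) (w : ℝ) : 0 < 1 - q + q * Real.exp w := by
  rcases h1.lt_or_eq with h | h
  · have := Real.exp_pos w
    have : 0 < 1 - q := by linarith
    positivity
  · subst h; simpa using Real.exp_pos w

lemma mul_le_log_mix {q : ℝ} (h0 : 0 ≤ q) (h1 : q ≤ 1) (w : ℝ) :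
    q * w ≤ Real.log (1 - q + q * Real.exp w) := by
  rw [Real.le_log_iff_exp_le (mix_pos h0 h1 w)]
  have h := convexOn_exp.2 (Set.mem_univ (0 : ℝ)) (Set.mem_univ w) (sub_nonneg.2 h1) h0
    (by ring)
  simpa using h

lemma log_mix_le {q : ℝ} (h0 : 0 ≤ q) (h1 : q ≤ 1) (w : ℝ) :
    Real.log (1 - q + q * Real.exp w) ≤ q * (Real.exp w - 1) := by
  have := Real.log_le_sub_one_of_pos (mix_pos h0 h1 w)
  linarith

lemma exp_sub_one_le_mul_exp_abs (w : ℝ) : Real.exp w - 1 ≤ |w| * Real.exp |w| := by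
  have h1 : Real.exp w ≤ Real.exp |w| := Real.exp_le_exp.2 (le_abs_self w)
  have h2 : -|w| + 1 ≤ Real.exp (-|w|) := Real.add_one_le_exp _
  have h3 : Real.exp (-|w|) * Real.exp |w| = 1 := by rw [← Real.exp_add]; simp
  nlinarith [Real.exp_pos |w|]

lemma abs_log_mix_le_mul_exp {q : ℝ} (h0 : 0 ≤ q) (h1 : q ≤ 1) (w : ℝ) :
    |Real.log (1 - q + q * Real.exp w)| ≤ q * (|w| * Real.exp |w|) := by
  rw [abs_le]
  constructor
  · have h2 : |w| ≤ |w| * Real.exp |w| :=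
      le_mul_of_one_le_right (abs_nonneg w) (Real.one_le_exp (abs_nonneg w))
    have h3 : -(|w| * Real.exp |w|) ≤ w := by linarith [neg_abs_le w]
    linarith [mul_le_mul_of_nonneg_left h3 h0, mul_le_log_mix h0 h1 w]
  · exact (log_mix_le h0 h1 w).trans
      (mul_le_mul_of_nonneg_left (exp_sub_one_le_mul_exp_abs w) h0)

/-- The mixing weight `q` scales the linear term: this is privacy amplification by subsampling. The
quadratic term covers large `w`, where the logarithm grows like `w` itself. -/
lemma abs_log_mix_le_add_sq {q : ℝ} (h0 : 0 ≤ q) (h1 : q ≤ 1) (w : ℝ) :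
    |Real.log (1 - q + q * Real.exp w)| ≤ 2 * (q * |w|) + w ^ 2 := by
  have hqw : 0 ≤ q * |w| := mul_nonneg h0 (abs_nonneg w)
  rw [abs_le]
  constructor
  · have h3 := mul_le_mul_of_nonneg_left (neg_abs_le w) h0
    nlinarith [mul_le_log_mix h0 h1 w, sq_nonneg w]
  · rcases le_total w 0 with hw | hw
    · have : Real.log (1 - q + q * Real.exp w) ≤ 0 := by
        refine (log_mix_le h0 h1 w).trans ?_
        have : Real.exp w ≤ 1 := Real.exp_le_one_iff.2 hw
        nlinarith
      nlinarith [sq_nonneg w]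
    rw [abs_of_nonneg hw] at hqw ⊢
    rcases le_total w 1 with hw1 | hw1
    · have h4 : Real.exp w - 1 ≤ 2 * w := by
        have := Real.abs_exp_sub_one_le (x := w) (by rwa [abs_of_nonneg hw])
        rw [abs_of_nonneg hw] at this
        exact (le_abs_self _).trans this
      have := log_mix_le h0 h1 w
      nlinarith [sq_nonneg w, mul_le_mul_of_nonneg_left h4 h0]
    · have h5 : Real.log (1 - q + q * Real.exp w) ≤ w := by
        rw [Real.log_le_iff_le_exp (mix_pos h0 h1 w)]
        nlinarith [Real.one_le_exp hw]
      nlinarith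

lemma sq_add_one_le_exp (x : ℝ) : (|x| + 1) ^ 2 ≤ 32 * Real.exp (x ^ 2 / 16) := by
  have h := Real.add_one_le_exp (x ^ 2 / 16)
  nlinarith [sq_nonneg (|x| - 1), sq_abs x]

lemma mul_le_eight_sq_add (x y : ℝ) : x * y ≤ 8 * x ^ 2 + y ^ 2 / 32 := by
  nlinarith [sq_nonneg (16 * x - y)]

lemma abs_add_one_sq_le (x : ℝ) : (|x| + 1) ^ 2 ≤ 2 * x ^ 2 + 2 := by
  nlinarith [sq_nonneg (|x| - 1), sq_abs x]

/-- The remainder of the expansion in `exp_mul_le_of_abs_le` for the logarithm of a subsampled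
Gaussian density. Here `a` and `b` are the coordinates of the Gaussian variable along the two shifts,
and `s` and `τ` bound the shifts; the remainder is of order `s²` although `w` is of order `τ`, which
may be much larger. The exponent `3/8` keeps the right-hand side integrable. -/
lemma sq_mul_exp_abs_logRatio_le {q s τ k a b w₀ w : ℝ} (h0 : 0 ≤ q) (h1 : q ≤ 1) (hs : 0 ≤ s)
    (hqτ : q * τ ≤ 2 * s) (hk : 1 ≤ k) (hτ0 : 0 ≤ τ) (hτ : k * τ ^ 2 ≤ 1 / 1024)
    (hw₀ : |w₀| ≤ s * (|a| + 1)) (hw : |w| ≤ τ * (|b| + 1)) :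
    (w₀ + Real.log (1 - q + q * Real.exp w)) ^ 2 *
        Real.exp (k * |w₀ + Real.log (1 - q + q * Real.exp w)|) ≤
      s ^ 2 * (480 * Real.exp (136 * (k ^ 2 * s ^ 2))) *
        (Real.exp (3 / 8 * a ^ 2) + Real.exp (3 / 8 * b ^ 2)) := by
  set l := w₀ + Real.log (1 - q + q * Real.exp w) with hl
  have hA := abs_nonneg a
  have hB := abs_nonneg b
  have hτ32 : τ ≤ 1 / 32 := by
    by_contra! hcon
    nlinarith
  have hqw : q * |w| ≤ 2 * s * (|b| + 1) := by
    calc q * |w| ≤ q * (τ * (|b| + 1)) := by gcongr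
      _ = q * τ * (|b| + 1) := by ring
      _ ≤ _ := by gcongr
  have hwexp : Real.exp |w| ≤ Real.exp ((|b| + 1) / 32) := by
    refine Real.exp_le_exp.2 (hw.trans ?_)
    nlinarith
  have hE : 0 < Real.exp ((|b| + 1) / 32) := Real.exp_pos _
  -- The size of `l` is of order `s`.
  have hl1 : |l| ≤ s * ((|a| + 1) + 2 * (|b| + 1) * Real.exp ((|b| + 1) / 32)) := by
    have h2 : q * (|w| * Real.exp |w|) ≤ 2 * s * (|b| + 1) * Real.exp ((|b| + 1) / 32) := by
      rw [← mul_assoc]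
      exact mul_le_mul hqw hwexp (Real.exp_pos _).le (by positivity)
    have := (abs_add_le w₀ _).trans (add_le_add hw₀ (abs_log_mix_le_mul_exp h0 h1 w))
    linarith
  have hb2 : Real.exp ((|b| + 1) / 32) ^ 2 ≤ Real.exp (b ^ 2 / 32 + 3 / 32) := by
    rw [← Real.exp_nat_mul]
    refine Real.exp_le_exp.2 ?_
    push_cast
    nlinarith [sq_nonneg (|b| - 1), sq_abs b]
  have hl2 : l ^ 2 ≤ s ^ 2 * (320 * Real.exp (a ^ 2 / 16 + (3 / 32) * b ^ 2 + 3 / 32)) := by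
    calc l ^ 2 = |l| ^ 2 := (sq_abs l).symm
      _ ≤ (s * ((|a| + 1) + 2 * (|b| + 1) * Real.exp ((|b| + 1) / 32))) ^ 2 := by gcongr
      _ = s ^ 2 * ((|a| + 1) + 2 * (|b| + 1) * Real.exp ((|b| + 1) / 32)) ^ 2 := by ring
      _ ≤ s ^ 2 * (2 * (|a| + 1) ^ 2 +
            8 * ((|b| + 1) ^ 2 * Real.exp ((|b| + 1) / 32) ^ 2)) := by
          gcongr
          nlinarith [sq_nonneg ((|a| + 1) - 2 * (|b| + 1) * Real.exp ((|b| + 1) / 32))]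
      _ ≤ s ^ 2 * (2 * (32 * Real.exp (a ^ 2 / 16)) +
            8 * ((32 * Real.exp (b ^ 2 / 16)) * Real.exp (b ^ 2 / 32 + 3 / 32))) := by
          gcongr <;> exact sq_add_one_le_exp _
      _ ≤ s ^ 2 * (320 * Real.exp (a ^ 2 / 16 + (3 / 32) * b ^ 2 + 3 / 32)) := by
          gcongr
          have e1 : Real.exp (a ^ 2 / 16) ≤
              Real.exp (a ^ 2 / 16 + (3 / 32) * b ^ 2 + 3 / 32) :=
            Real.exp_le_exp.2 (by nlinarith [sq_nonneg b])
          have e2 : Real.exp (b ^ 2 / 16) * Real.exp (b ^ 2 / 32 + 3 / 32) ≤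
              Real.exp (a ^ 2 / 16 + (3 / 32) * b ^ 2 + 3 / 32) := by
            rw [← Real.exp_add]
            exact Real.exp_le_exp.2 (by nlinarith [sq_nonneg a])
          linarith
  -- The weight `k |l|` grows at most like a small multiple of `a² + b²`.
  have hl3 : k * |l| ≤ 136 * (k ^ 2 * s ^ 2) + a ^ 2 / 16 + (1 / 16 + 1 / 512) * b ^ 2
      + 33 / 256 := by
    have h2 : |l| ≤ s * (|a| + 1) + (2 * (q * |w|) + w ^ 2) :=
      (abs_add_le w₀ _).trans (add_le_add hw₀ (abs_log_mix_le_add_sq h0 h1 w))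
    have h3 : w ^ 2 ≤ τ ^ 2 * (|b| + 1) ^ 2 := by
      rw [← mul_pow, ← sq_abs w]
      gcongr
    have h4 : k * |l| ≤ k * s * (|a| + 1) + 4 * (k * s * (|b| + 1)) +
        k * τ ^ 2 * (|b| + 1) ^ 2 := by
      calc k * |l| ≤ k * (s * (|a| + 1) + (2 * (2 * s * (|b| + 1)) +
            τ ^ 2 * (|b| + 1) ^ 2)) := by
            gcongr
            linarith
        _ = _ := by ring
    have h5 : k * τ ^ 2 * (|b| + 1) ^ 2 ≤ 1 / 1024 * (|b| + 1) ^ 2 := by gcongr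
    have h6 := mul_le_eight_sq_add (k * s) (|a| + 1)
    have h7 := mul_le_eight_sq_add (4 * (k * s)) (|b| + 1)
    have h8 := abs_add_one_sq_le a
    have h9 := abs_add_one_sq_le b
    have h10 : 4 * (k * s * (|b| + 1)) = 4 * (k * s) * (|b| + 1) := by ring
    have h11 : (k * s) ^ 2 = k ^ 2 * s ^ 2 := by ring
    have h12 : (4 * (k * s)) ^ 2 = 16 * (k ^ 2 * s ^ 2) := by ring
    rw [h10] at h4
    rw [h11] at h6
    rw [h12] at h7
    linarith
  calc l ^ 2 * Real.exp (k * |l|)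
      ≤ s ^ 2 * (320 * Real.exp (a ^ 2 / 16 + (3 / 32) * b ^ 2 + 3 / 32)) *
          Real.exp (136 * (k ^ 2 * s ^ 2) + a ^ 2 / 16 + (1 / 16 + 1 / 512) * b ^ 2 + 33 / 256) :=
        mul_le_mul hl2 (Real.exp_le_exp.2 hl3) (Real.exp_pos _).le (by positivity)
    _ = s ^ 2 * 320 * Real.exp (136 * (k ^ 2 * s ^ 2)) *
          Real.exp ((a ^ 2 / 16 + (3 / 32) * b ^ 2 + 3 / 32) +
            (a ^ 2 / 16 + (1 / 16 + 1 / 512) * b ^ 2 + 33 / 256)) := by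
        rw [show 136 * (k ^ 2 * s ^ 2) + a ^ 2 / 16 + (1 / 16 + 1 / 512) * b ^ 2 + 33 / 256 =
          136 * (k ^ 2 * s ^ 2) + (a ^ 2 / 16 + (1 / 16 + 1 / 512) * b ^ 2 + 33 / 256) by ring]
        simp only [Real.exp_add]
        ring
    _ ≤ s ^ 2 * 320 * Real.exp (136 * (k ^ 2 * s ^ 2)) *
          (3 * ((Real.exp (3 / 8 * a ^ 2) + Real.exp (3 / 8 * b ^ 2)) / 2)) := by
        gcongr
        have e1 : Real.exp ((a ^ 2 / 16 + (3 / 32) * b ^ 2 + 3 / 32) +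
            (a ^ 2 / 16 + (1 / 16 + 1 / 512) * b ^ 2 + 33 / 256)) ≤
            Real.exp 1 * (Real.exp (3 / 16 * a ^ 2) * Real.exp (3 / 16 * b ^ 2)) := by
          rw [← Real.exp_add, ← Real.exp_add]
          exact Real.exp_le_exp.2 (by nlinarith [sq_nonneg a, sq_nonneg b])
        have e2 : ∀ x : ℝ, Real.exp (3 / 8 * x ^ 2) = Real.exp (3 / 16 * x ^ 2) ^ 2 := by
          intro x
          rw [← Real.exp_nat_mul]
          congr 1
          push_cast
          ring
        rw [e2, e2]
        refine e1.trans ?_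
        have e3 : Real.exp 1 ≤ 3 := by linarith [Real.exp_one_lt_d9]
        have e4 := two_mul_le_add_sq (Real.exp (3 / 16 * a ^ 2)) (Real.exp (3 / 16 * b ^ 2))
        have e5 : 0 < Real.exp (3 / 16 * a ^ 2) * Real.exp (3 / 16 * b ^ 2) := by positivity
        nlinarith
    _ = _ := by ring

/-- The density, with respect to the standard Gaussian law, of the mixture with weights `1 - q` and
`q` of the standard Gaussian laws shifted by `u` and by `u + v`. -/
noncomputable def mixDensity {d : ℕ} (q : ℝ) (u v z : Vec d) : ℝ :=
  (1 - q) * shiftDensity u z + q * shiftDensity (u + v) z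

lemma mixDensity_eq_exp {d : ℕ} {q : ℝ} (h0 : 0 ≤ q) (h1 : q ≤ 1) (u v z : Vec d) :
    mixDensity q u v z = Real.exp ((⟪u, z⟫ - ‖u‖ ^ 2 / 2) +
      Real.log (1 - q + q * Real.exp (⟪v, z⟫ - ⟪u, v⟫ - ‖v‖ ^ 2 / 2))) := by
  rw [Real.exp_add, Real.exp_log (mix_pos h0 h1 _), mixDensity, shiftDensity, shiftDensity]
  have : ⟪u + v, z⟫ - ‖u + v‖ ^ 2 / 2 = (⟪u, z⟫ - ‖u‖ ^ 2 / 2) +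
      (⟪v, z⟫ - ⟪u, v⟫ - ‖v‖ ^ 2 / 2) := by
    rw [inner_add_left, norm_add_sq_real]
    ring
  rw [this, Real.exp_add]
  ring

lemma mixDensity_pos {d : ℕ} {q : ℝ} (h0 : 0 ≤ q) (h1 : q ≤ 1) (u v z : Vec d) :
    0 < mixDensity q u v z := by
  rw [mixDensity_eq_exp h0 h1]; exact Real.exp_pos _

@[fun_prop]
lemma measurable_mixDensity {d : ℕ} (q : ℝ) (u v : Vec d) : Measurable (mixDensity q u v) := by
  unfold mixDensity; fun_prop

lemma integrable_mixDensity {d : ℕ} (q : ℝ) (u v : Vec d) :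
    Integrable (mixDensity q u v) (stdGaussian (Vec d)) :=
  ((integrable_shiftDensity u).const_mul _).add ((integrable_shiftDensity (u + v)).const_mul _)

lemma integral_mixDensity {d : ℕ} (q : ℝ) (u v : Vec d) :
    ∫ z, mixDensity q u v z ∂stdGaussian (Vec d) = 1 := by
  simp only [mixDensity]
  rw [integral_add ((integrable_shiftDensity u).const_mul _)
    ((integrable_shiftDensity (u + v)).const_mul _), integral_const_mul, integral_const_mul,
    integral_shiftDensity, integral_shiftDensity]
  ring

lemma integrable_exp_sq_inner {d : ℕ} {e : Vec d} (he : ‖e‖ ≤ 1) :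
    Integrable (fun z => Real.exp (3 / 8 * ⟪e, z⟫ ^ 2)) (stdGaussian (Vec d)) := by
  refine ⟨by fun_prop, ?_⟩
  rw [hasFiniteIntegral_iff_ofReal (ae_of_all _ fun z => (Real.exp_pos _).le)]
  exact (lintegral_exp_sq_inner_le he).trans_lt ENNReal.ofNat_lt_top

lemma integral_exp_sq_inner_le {d : ℕ} {e : Vec d} (he : ‖e‖ ≤ 1) :
    ∫ z, Real.exp (3 / 8 * ⟪e, z⟫ ^ 2) ∂stdGaussian (Vec d) ≤ 2 := by
  rw [integral_eq_lintegral_of_nonneg_ae (ae_of_all _ fun z => (Real.exp_pos _).le)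
    (by fun_prop)]
  exact ENNReal.toReal_le_of_le_ofReal (by norm_num)
    (by simpa using lintegral_exp_sq_inner_le he)

/-- The moments of order `μ`, `|μ| ≤ k`, of the subsampled Gaussian density. -/
lemma lintegral_mixDensity_rpow_le {d : ℕ} {q s τ k μ : ℝ} {u v : Vec d} (h0 : 0 ≤ q) (h1 : q ≤ 1)
    (hs : 0 < s) (hsτ : s ≤ τ) (hqτ : q * τ ≤ 2 * s) (hk : 1 ≤ k) (hτ : k * τ ^ 2 ≤ 1 / 1024)
    (hμ : |μ| ≤ k) (hu : ‖u‖ ≤ s) (hv : ‖v‖ ≤ τ) :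
    ∫⁻ z, ENNReal.ofReal (mixDensity q u v z ^ μ) ∂stdGaussian (Vec d) ≤
      ENNReal.ofReal (Real.exp (4000 * (k ^ 2 * s ^ 2))) := by
  have hτ0 : 0 < τ := hs.trans_le hsτ
  have hτ32 : τ ≤ 1 / 32 := by
    by_contra! hcon
    nlinarith
  -- The two relevant coordinates, normalized.
  set e₁ : Vec d := s⁻¹ • u
  set e₂ : Vec d := τ⁻¹ • v
  have he₁ : ‖e₁‖ ≤ 1 := by
    rw [norm_smul, norm_inv, Real.norm_of_nonneg hs.le, inv_mul_le_iff₀ hs]; simpa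
  have he₂ : ‖e₂‖ ≤ 1 := by
    rw [norm_smul, norm_inv, Real.norm_of_nonneg hτ0.le, inv_mul_le_iff₀ hτ0]; simpa
  set K : ℝ := s ^ 2 * (480 * Real.exp (136 * (k ^ 2 * s ^ 2)))
  have hpt : ∀ z : Vec d, mixDensity q u v z ^ μ ≤ 1 + μ * (mixDensity q u v z - 1) +
      2 * k ^ 2 * (K * (Real.exp (3 / 8 * ⟪e₁, z⟫ ^ 2) + Real.exp (3 / 8 * ⟪e₂, z⟫ ^ 2))) := by
    intro z
    have hw₀ : |⟪u, z⟫ - ‖u‖ ^ 2 / 2| ≤ s * (|⟪e₁, z⟫| + 1) := by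
      have h2 : ⟪u, z⟫ = s * ⟪e₁, z⟫ := by
        rw [real_inner_smul_left, ← mul_assoc, mul_inv_cancel₀ hs.ne', one_mul]
      have h3 : ‖u‖ ^ 2 ≤ s ^ 2 := by gcongr
      have h4 := abs_sub (⟪u, z⟫) (‖u‖ ^ 2 / 2)
      rw [abs_of_nonneg (by positivity : 0 ≤ ‖u‖ ^ 2 / 2), h2, abs_mul, abs_of_pos hs] at h4
      rw [h2]
      nlinarith
    have hw : |⟪v, z⟫ - ⟪u, v⟫ - ‖v‖ ^ 2 / 2| ≤ τ * (|⟪e₂, z⟫| + 1) := by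
      have h2 : ⟪v, z⟫ = τ * ⟪e₂, z⟫ := by
        rw [real_inner_smul_left, ← mul_assoc, mul_inv_cancel₀ hτ0.ne', one_mul]
      have h3 : ‖v‖ ^ 2 ≤ τ ^ 2 := by gcongr
      have h5 : |⟪u, v⟫| ≤ τ * τ :=
        (abs_real_inner_le_norm u v).trans
          (mul_le_mul (hu.trans hsτ) hv (norm_nonneg _) hτ0.le)
      have h4 := abs_sub (⟪v, z⟫ - ⟪u, v⟫) (‖v‖ ^ 2 / 2)
      have h6 := abs_sub (⟪v, z⟫) (⟪u, v⟫)
      rw [abs_of_nonneg (by positivity : 0 ≤ ‖v‖ ^ 2 / 2)] at h4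
      have h7 : |⟪v, z⟫| = τ * |⟪e₂, z⟫| := by rw [h2, abs_mul, abs_of_pos hτ0]
      nlinarith
    have hb := sq_mul_exp_abs_logRatio_le h0 h1 hs.le hqτ hk hτ0.le hτ hw₀ hw
    rw [mixDensity_eq_exp h0 h1, ← Real.exp_mul, mul_comm _ μ]
    refine (exp_mul_le_of_abs_le hk hμ _).trans ?_
    gcongr
  have hintm : Integrable (fun z => μ * (mixDensity q u v z - 1)) (stdGaussian (Vec d)) :=
    ((integrable_mixDensity q u v).sub (integrable_const _)).const_mul _
  have hinte : Integrable (fun z => 2 * k ^ 2 * (K * (Real.exp (3 / 8 * ⟪e₁, z⟫ ^ 2) +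
      Real.exp (3 / 8 * ⟪e₂, z⟫ ^ 2)))) (stdGaussian (Vec d)) :=
    (((integrable_exp_sq_inner he₁).add (integrable_exp_sq_inner he₂)).const_mul _).const_mul _
  have hint1 : Integrable (fun z => 1 + μ * (mixDensity q u v z - 1)) (stdGaussian (Vec d)) :=
    (integrable_const _).add hintm
  refine (lintegral_mono fun z => ENNReal.ofReal_le_ofReal (hpt z)).trans ?_
  have hint : Integrable (fun z => 1 + μ * (mixDensity q u v z - 1) + 2 * k ^ 2 *
      (K * (Real.exp (3 / 8 * ⟪e₁, z⟫ ^ 2) + Real.exp (3 / 8 * ⟪e₂, z⟫ ^ 2))))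
      (stdGaussian (Vec d)) := hint1.add hinte
  rw [← ofReal_integral_eq_lintegral_ofReal hint
    (ae_of_all _ fun z => (Real.rpow_pos_of_pos (mixDensity_pos h0 h1 u v z) _).le.trans (hpt z))]
  refine ENNReal.ofReal_le_ofReal ?_
  rw [integral_add hint1 hinte, integral_add (integrable_const _) hintm, integral_const_mul,
    integral_const_mul, integral_const_mul,
    integral_sub (integrable_mixDensity q u v) (integrable_const _),
    integral_add (integrable_exp_sq_inner he₁) (integrable_exp_sq_inner he₂),
    integral_mixDensity]
  simp only [integral_const, probReal_univ, smul_eq_mul, mul_one, sub_self, mul_zero, add_zero]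
  have hI := add_le_add (integral_exp_sq_inner_le he₁) (integral_exp_sq_inner_le he₂)
  set y := k ^ 2 * s ^ 2 with hy
  have hy0 : 0 ≤ y := by positivity
  have hK0 : 0 ≤ K := by positivity
  calc 1 + 2 * k ^ 2 * (K * _) ≤ 1 + 2 * k ^ 2 * (K * (2 + 2)) := by gcongr
    _ = 1 + 3840 * y * Real.exp (136 * y) := by simp only [K, hy]; ring
    _ ≤ Real.exp (136 * y) + 3840 * y * Real.exp (136 * y) := by
        gcongr; exact Real.one_le_exp (by positivity)
    _ = (3840 * y + 1) * Real.exp (136 * y) := by ring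
    _ ≤ Real.exp (3840 * y) * Real.exp (136 * y) := by
        gcongr; exact Real.add_one_le_exp _
    _ = Real.exp (3976 * y) := by rw [← Real.exp_add]; congr 1; ring
    _ ≤ Real.exp (4000 * y) := Real.exp_le_exp.2 (by linarith)

/-- The Rényi moment of order `p` of one subsampled Gaussian density with respect to another. -/
lemma lintegral_mixDensity_rpow_mul_rpow_le {d : ℕ} {q s τ p : ℝ} {u v u' v' : Vec d}
    (h0 : 0 ≤ q) (h1 : q ≤ 1) (hs : 0 < s) (hsτ : s ≤ τ) (hqτ : q * τ ≤ 2 * s) (hp : 1 ≤ p)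
    (hτ : 2 * p * τ ^ 2 ≤ 1 / 1024) (hu : ‖u‖ ≤ s) (hv : ‖v‖ ≤ τ) (hu' : ‖u'‖ ≤ s)
    (hv' : ‖v'‖ ≤ τ) :
    ∫⁻ z, ENNReal.ofReal (mixDensity q u v z ^ p * mixDensity q u' v' z ^ (1 - p))
        ∂stdGaussian (Vec d) ≤ ENNReal.ofReal (Real.exp (4000 * ((2 * p) ^ 2 * s ^ 2))) := by
  have hle : ∀ z : Vec d,
      ENNReal.ofReal (mixDensity q u v z ^ p * mixDensity q u' v' z ^ (1 - p)) ≤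
      ENNReal.ofReal (1 / 2) * (ENNReal.ofReal (mixDensity q u v z ^ (2 * p)) +
        ENNReal.ofReal (mixDensity q u' v' z ^ (2 * (1 - p)))) := by
    intro z
    have hX := mixDensity_pos h0 h1 u v z
    have hX' := mixDensity_pos h0 h1 u' v' z
    rw [← ENNReal.ofReal_add (by positivity) (by positivity),
      ← ENNReal.ofReal_mul (by norm_num)]
    refine ENNReal.ofReal_le_ofReal ?_
    rw [mul_comm 2 p, mul_comm 2 (1 - p), Real.rpow_mul hX.le, Real.rpow_mul hX'.le,
      Real.rpow_two, Real.rpow_two]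
    linarith [two_mul_le_add_sq (mixDensity q u v z ^ p) (mixDensity q u' v' z ^ (1 - p))]
  refine (lintegral_mono hle).trans ?_
  rw [lintegral_const_mul _ (by fun_prop), lintegral_add_left (by fun_prop)]
  have hk : 1 ≤ 2 * p := by linarith
  have a1 := lintegral_mixDensity_rpow_le (μ := 2 * p) h0 h1 hs hsτ hqτ hk hτ
    (abs_of_nonneg (by linarith)).le hu hv
  have a2 := lintegral_mixDensity_rpow_le (μ := 2 * (1 - p)) h0 h1 hs hsτ hqτ hk hτ
    (by rw [abs_le]; constructor <;> linarith) hu' hv'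
  refine (mul_le_mul_right (add_le_add a1 a2) _).trans ?_
  rw [← ENNReal.ofReal_add (Real.exp_pos _).le (Real.exp_pos _).le,
    ← ENNReal.ofReal_mul (by norm_num)]
  refine ENNReal.ofReal_le_ofReal (le_of_eq ?_)
  ring

end MixtureMoment

/-! ### Product measures -/

section ProductMeasures

/-- Resampling one coordinate of a product measure does not change it. -/
lemma measurePreserving_update_pi {ι : Type*} [Fintype ι] [DecidableEq ι] {X : ι → Type*}
    [∀ i, MeasurableSpace (X i)] (μ : ∀ i, Measure (X i)) [∀ i, IsProbabilityMeasure (μ i)]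
    (i : ι) :
    MeasurePreserving (fun p : (∀ j, X j) × X i => Function.update p.1 i p.2)
      ((Measure.pi μ).prod (μ i)) (Measure.pi μ) := by
  have hm : Measurable fun p : (∀ j, X j) × X i => Function.update p.1 i p.2 := by
    refine measurable_pi_lambda _ fun j => ?_
    by_cases h : j = i
    · subst h; simpa using measurable_snd
    · simp only [Function.update_of_ne h]
      exact (measurable_pi_apply j).comp measurable_fst
  refine ⟨hm, (Measure.pi_eq fun s hs => ?_).symm⟩
  rw [Measure.map_apply hm (MeasurableSet.univ_pi hs)]
  have h : (fun p : (∀ j, X j) × X i => Function.update p.1 i p.2) ⁻¹' Set.univ.pi s =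
      (Set.univ.pi (Function.update s i Set.univ)) ×ˢ s i := by
    ext p
    simp only [Set.mem_preimage, Set.mem_univ_pi, Set.mem_prod]
    constructor
    · refine fun h => ⟨fun j => ?_, by simpa using h i⟩
      by_cases hj : j = i
      · subst hj; simp
      · simpa [Function.update_of_ne hj] using h j
    · rintro ⟨h1, h2⟩ j
      by_cases hj : j = i
      · subst hj; simpa using h2
      · simpa [Function.update_of_ne hj] using h1 j
  rw [h, Measure.prod_prod, Measure.pi_pi, ← Finset.mul_prod_erase _ _ (Finset.mem_univ i),
    ← Finset.mul_prod_erase _ _ (Finset.mem_univ i), Function.update_self, measure_univ, one_mul,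
    mul_comm]
  congr 1
  refine Finset.prod_congr rfl fun j hj => ?_
  rw [Function.update_of_ne (Finset.ne_of_mem_erase hj)]

lemma lintegral_pi_eq_lintegral_update {ι : Type*} [Fintype ι] [DecidableEq ι] {X : ι → Type*}
    [∀ i, MeasurableSpace (X i)] (μ : ∀ i, Measure (X i)) [∀ i, IsProbabilityMeasure (μ i)]
    (i : ι) {F : (∀ j, X j) → ℝ≥0∞} (hF : Measurable F) :
    ∫⁻ ω, F ω ∂Measure.pi μ =
      ∫⁻ ω, ∫⁻ x, F (Function.update ω i x) ∂μ i ∂Measure.pi μ := by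
  have h := measurePreserving_update_pi μ i
  rw [← h.lintegral_comp hF]
  exact lintegral_prod _ (hF.comp h.measurable).aemeasurable

lemma lintegral_bernoulliMeasure_bool (p : unitInterval) (f : Bool → ℝ≥0∞) :
    ∫⁻ B, f B ∂bernoulliMeasure true false p =
      ENNReal.ofReal p * f true + ENNReal.ofReal (1 - p) * f false := by
  have h1 : (unitInterval.toNNReal p : ℝ≥0∞) = ENNReal.ofReal p := by
    rw [ENNReal.ofReal, Real.toNNReal_of_nonneg p.2.1]; rfl
  have h2 : (unitInterval.toNNReal (unitInterval.symm p) : ℝ≥0∞) = ENNReal.ofReal (1 - p) := by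
    rw [ENNReal.ofReal, Real.toNNReal_of_nonneg (unitInterval.one_minus_nonneg p)]; rfl
  rw [bernoulliMeasure_def, lintegral_add_measure, ← h1, ← h2]
  simp only [ENNReal.smul_def, lintegral_smul_measure, lintegral_dirac, smul_eq_mul]

end ProductMeasures

namespace SoteriaFL

variable {n m d : ℕ} {𝒟 : Type u₁} {U : Type u₂} {V : Type u₃} {W : Type u₄} {S : Type u₅}
  [MeasurableSpace U] [MeasurableSpace V] [MeasurableSpace W] [MeasurableSpace S]
  (A : SoteriaFL n m d 𝒟 U V W S)

/-! ### Measurability and the Markov property -/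

instance isProbabilityMeasure_noiseLaw : IsProbabilityMeasure A.noiseLaw :=
  Measure.isProbabilityMeasure_map (by fun_prop)

instance isProbabilityMeasure_batchLaw : IsProbabilityMeasure A.batchLaw := by
  unfold batchLaw; infer_instance

/-- The law of the randomness of client `i` in round `t`. -/
noncomputable def clientLaw (t : ℕ) (i : Fin n) : Measure (ClientSeed m d W S) :=
  (A.est.localLaw t i : Measure W).prod
    (A.batchLaw.prod (A.noiseLaw.prod (A.compLaw t i : Measure S)))

instance isProbabilityMeasure_clientLaw (t : ℕ) (i : Fin n) :
    IsProbabilityMeasure (A.clientLaw t i) := by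
  unfold clientLaw; infer_instance

lemma roundLaw_eq (t : ℕ) :
    A.roundLaw t = (A.est.commonLaw t : Measure V).prod (Measure.pi (A.clientLaw t)) := rfl

instance isProbabilityMeasure_roundLaw (t : ℕ) : IsProbabilityMeasure (A.roundLaw t) := by
  rw [roundLaw_eq]; infer_instance

instance isProbabilityMeasure_law : IsProbabilityMeasure A.law := by
  unfold law; infer_instance

lemma estimate_eq_sum_ite (t : ℕ) (i : Fin n) (Di : Fin m → 𝒟) (st : State n m d U)
    (c : ClientSeed m d W S) :
    A.estimate t i Di st c =
      (1 / (A.b : ℝ)) • (∑ j, if c.2.1 j = true then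
          A.est.φ t i j (Di j) (st.2 i j) st.1 c.1 else 0) +
        (1 / (m : ℝ)) • ∑ j, A.est.ψ t i j (Di j) (st.2 i j) st.1 c.1 := by
  rw [estimate, Finset.sum_filter]

lemma measurable_estimate (t : ℕ) (i : Fin n) (Di : Fin m → 𝒟) :
    Measurable fun p : State n m d U × ClientSeed m d W S => A.estimate t i Di p.1 p.2 := by
  simp_rw [estimate_eq_sum_ite]
  have hφ : ∀ j, Measurable fun p : State n m d U × ClientSeed m d W S =>
      A.est.φ t i j (Di j) (p.1.2 i j) p.1.1 p.2.1 := fun j =>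
    (A.est.measurable_φ t i j (Di j)).comp
      (f := fun p : State n m d U × ClientSeed m d W S => (p.1.2 i j, p.1.1, p.2.1)) (by fun_prop)
  have hψ : ∀ j, Measurable fun p : State n m d U × ClientSeed m d W S =>
      A.est.ψ t i j (Di j) (p.1.2 i j) p.1.1 p.2.1 := fun j =>
    (A.est.measurable_ψ t i j (Di j)).comp
      (f := fun p : State n m d U × ClientSeed m d W S => (p.1.2 i j, p.1.1, p.2.1)) (by fun_prop)
  have hB : ∀ j, MeasurableSet {p : State n m d U × ClientSeed m d W S | p.2.2.1 j = true} :=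
    fun j => (measurableSet_singleton true).preimage
      (f := fun p : State n m d U × ClientSeed m d W S => p.2.2.1 j) (by fun_prop)
  have h1 : Measurable fun p : State n m d U × ClientSeed m d W S =>
      ∑ j, if p.2.2.1 j = true then A.est.φ t i j (Di j) (p.1.2 i j) p.1.1 p.2.1 else 0 :=
    Finset.measurable_fun_sum Finset.univ fun j _ => Measurable.ite (hB j) (hφ j) measurable_const
  have h2 := Finset.measurable_fun_sum Finset.univ fun j _ => hψ j
  exact (h1.const_smul (1 / (A.b : ℝ))).add (h2.const_smul (1 / (m : ℝ)))

variable {A}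

lemma measurable_message (hC : ∀ t i, Measurable (Function.uncurry (A.comp t i)))
    (t : ℕ) (i : Fin n) (Di : Fin m → 𝒟) :
    Measurable fun p : State n m d U × ClientSeed m d W S => A.message t i Di p.1 p.2 := by
  have h := A.measurable_estimate t i Di
  exact (hC t i).comp (f := fun p : State n m d U × ClientSeed m d W S =>
    (p.2.2.2.2, A.estimate t i Di p.1 p.2 + p.2.2.2.1 - p.1.1.2.1 i)) (by fun_prop)

lemma measurable_messages (hC : ∀ t i, Measurable (Function.uncurry (A.comp t i)))
    (t : ℕ) (D : Fin n → Fin m → 𝒟) :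
    Measurable fun p : State n m d U × RoundSeed n m d V W S =>
      fun i => A.message t i (D i) p.1 (p.2.2 i) :=
  measurable_pi_lambda _ fun i => (measurable_message hC t i (D i)).comp
    (f := fun p : State n m d U × RoundSeed n m d V W S => (p.1, p.2.2 i)) (by fun_prop)

lemma measurable_step (hC : ∀ t i, Measurable (Function.uncurry (A.comp t i)))
    (t : ℕ) (D : Fin n → Fin m → 𝒟) :
    Measurable fun p : State n m d U × RoundSeed n m d V W S => A.step D t p.1 p.2 := by
  have h := measurable_messages hC t D
  have hi : ∀ i, Measurable fun p : State n m d U × RoundSeed n m d V W S =>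
      A.message t i (D i) p.1 (p.2.2 i) := fun i => (measurable_pi_apply i).comp h
  refine Measurable.prodMk (Measurable.prodMk ?_ (Measurable.prodMk ?_ ?_)) ?_
  · fun_prop
  · exact measurable_pi_lambda _ fun i => by fun_prop
  · fun_prop
  · refine measurable_pi_lambda _ fun i => measurable_pi_lambda _ fun j => ?_
    exact (A.est.measurable_update t i j (D i j)).comp
      (f := fun p : State n m d U × RoundSeed n m d V W S =>
        (p.1.2 i j, p.1.1, (fun i => A.message t i (D i) p.1 (p.2.2 i)), (p.2.2 i).2.1 j,
          p.2.1, (p.2.2 i).1)) (by fun_prop)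

lemma history_le (t : ℕ) : history n m d V W S t ≤ MeasurableSpace.pi := cylinderEvents_le_pi

lemma history_mono {s t : ℕ} (h : s ≤ t) : history n m d V W S s ≤ history n m d V W S t :=
  cylinderEvents_mono (Set.Iio_subset_Iio h)

lemma measurable_state (hC : ∀ t i, Measurable (Function.uncurry (A.comp t i)))
    (D : Fin n → Fin m → 𝒟) (t : ℕ) : Measurable[history n m d V W S t] (A.state D t) := by
  induction t with
  | zero => exact measurable_const
  | succ t ih =>
    have h1 : Measurable[history n m d V W S (t + 1)] (A.state D t) :=
      ih.mono (history_mono t.le_succ) le_rfl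
    have h2 : Measurable[history n m d V W S (t + 1)]
        fun r : ℕ → RoundSeed n m d V W S => r t :=
      measurable_cylinderEvent_apply (X := fun _ => RoundSeed n m d V W S)
        (Set.mem_Iio.2 t.lt_succ_self)
    exact (measurable_step hC t D).comp (h1.prodMk h2)

/-- The randomness of round `t` is independent of the history before round `t`. -/
lemma map_prodMk_eval_law {E : Type*} [MeasurableSpace E] {t : ℕ}
    {X : (ℕ → RoundSeed n m d V W S) → E} (hX : Measurable[history n m d V W S t] X) :
    A.law.map (fun r => (X r, r t)) = (A.law.map X).prod (A.roundLaw t) := by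
  have hXm : Measurable X := hX.mono (history_le t) le_rfl
  have hind : iIndepFun (fun i (ω : ℕ → RoundSeed n m d V W S) => ω i) A.law :=
    iIndepFun_infinitePi (X := fun _ ω => ω) (by fun_prop)
  have h1 : Indep (history n m d V W S t)
      (⨆ i ∈ ({t} : Set ℕ), MeasurableSpace.comap
        (fun r : ℕ → RoundSeed n m d V W S => r i) inferInstance) A.law :=
    indep_iSup_of_disjoint (fun i => (measurable_pi_apply i).comap_le) hind (by simp)
  have h2 : X ⟂ᵢ[A.law] fun r => r t := by
    rw [IndepFun_iff_Indep]
    refine indep_of_indep_of_le_left (indep_of_indep_of_le_right h1 ?_) hX.comap_le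
    simp
  rw [h2.map_prod_eq_prod_map_map hXm.aemeasurable (measurable_pi_apply t).aemeasurable]
  congr 1
  exact Measure.infinitePi_map_eval A.roundLaw t

lemma lintegral_law_eq {E : Type*} [MeasurableSpace E] {t : ℕ}
    {X : (ℕ → RoundSeed n m d V W S) → E} (hX : Measurable[history n m d V W S t] X)
    {F : E × RoundSeed n m d V W S → ℝ≥0∞} (hF : Measurable F) :
    ∫⁻ r, F (X r, r t) ∂A.law = ∫⁻ r, ∫⁻ ρ, F (X r, ρ) ∂A.roundLaw t ∂A.law := by
  have hXm : Measurable X := hX.mono (history_le t) le_rfl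
  rw [← lintegral_map (g := fun r => (X r, r t)) hF (by fun_prop), map_prodMk_eval_law hX,
    lintegral_prod _ hF.aemeasurable, lintegral_map hF.lintegral_prod_right' hXm]

end SoteriaFL

/-! ### One round of a subsampled Gaussian mechanism -/

section RenyiOneRound

lemma lintegral_rpow_le_rpow_lintegral {α : Type*} [MeasurableSpace α] (μ : Measure α)
    [IsProbabilityMeasure μ] {p p' : ℝ} (hp : p.HolderConjugate p') {f : α → ℝ≥0∞}
    (hf : Measurable f) : ∫⁻ x, f x ^ (1 / p') ∂μ ≤ (∫⁻ x, f x ∂μ) ^ (1 / p') := by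
  have h := ENNReal.lintegral_mul_le_Lp_mul_Lq μ hp (f := fun _ => 1) (g := fun x => f x ^ (1 / p'))
    measurable_const.aemeasurable (hf.pow_const _).aemeasurable
  simp only [Pi.mul_apply, one_mul, ENNReal.one_rpow, lintegral_const, measure_univ, mul_one,
    ← ENNReal.rpow_mul, one_div_mul_cancel hp.symm.ne_zero, ENNReal.rpow_one] at h
  exact h

/-- One round of a subsampled Gaussian mechanism in the dual form of a Rényi bound. Here `H B z` is
the expectation of the test function after the round, when the distinguished sample is in the
minibatch (`B = true`) or not, and `z` is the noise plus the contribution of that sample. -/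
lemma subsampledGaussian_dual_renyi {d : ℕ} {q s τ p p' : ℝ} {u v u' v' : Vec d}
    (hp : p.HolderConjugate p') (h0 : 0 ≤ q) (h1 : q ≤ 1) (hs : 0 < s) (hsτ : s ≤ τ)
    (hqτ : q * τ ≤ 2 * s) (hτ : 2 * p * τ ^ 2 ≤ 1 / 1024) (hu : ‖u‖ ≤ s) (hv : ‖v‖ ≤ τ)
    (hu' : ‖u'‖ ≤ s) (hv' : ‖v'‖ ≤ τ) {H H' : Bool → Vec d → ℝ≥0∞} (hH : ∀ B, Measurable (H B))
    (hH' : ∀ B, Measurable (H' B)) {R : ℝ≥0∞} (h : ∀ B B' z, H B z ≤ R * H' B' z ^ (1 / p')) :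
    ENNReal.ofReal q * ∫⁻ z, H true (z + (u + v)) ∂stdGaussian (Vec d) +
        ENNReal.ofReal (1 - q) * ∫⁻ z, H false (z + u) ∂stdGaussian (Vec d) ≤
      ENNReal.ofReal (Real.exp (4000 * ((2 * p) ^ 2 * s ^ 2))) ^ (1 / p) * R *
        (ENNReal.ofReal q * ∫⁻ z, H' true (z + (u' + v')) ∂stdGaussian (Vec d) +
          ENNReal.ofReal (1 - q) * ∫⁻ z, H' false (z + u') ∂stdGaussian (Vec d)) ^ (1 / p') := by
  have hp1 : 1 ≤ p := hp.lt.le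
  have hq1 : 0 ≤ 1 - q := sub_nonneg.2 h1
  have hpp := hp.pos
  have hpp' := hp.symm.pos
  set γ := stdGaussian (Vec d)
  have hmix : ∀ (u v : Vec d) (H : Bool → Vec d → ℝ≥0∞), (∀ B, Measurable (H B)) →
      ENNReal.ofReal q * ∫⁻ z, H true (z + (u + v)) ∂γ +
        ENNReal.ofReal (1 - q) * ∫⁻ z, H false (z + u) ∂γ =
      ∫⁻ z, (ENNReal.ofReal (q * shiftDensity (u + v) z) * H true z +
        ENNReal.ofReal ((1 - q) * shiftDensity u z) * H false z) ∂γ := by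
    intro u v H hH
    have m1 := hH true
    have m2 := hH false
    rw [lintegral_stdGaussian_add _ m1, lintegral_stdGaussian_add _ m2,
      ← lintegral_const_mul _ (by fun_prop), ← lintegral_const_mul _ (by fun_prop),
      ← lintegral_add_left (by fun_prop)]
    refine lintegral_congr fun z => ?_
    rw [ENNReal.ofReal_mul h0, ENNReal.ofReal_mul hq1, mul_assoc, mul_assoc]
  have hsplit : ∀ (u v z : Vec d), ENNReal.ofReal (mixDensity q u v z) =
      ENNReal.ofReal (q * shiftDensity (u + v) z) + ENNReal.ofReal ((1 - q) * shiftDensity u z) := by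
    intro u v z
    rw [← ENNReal.ofReal_add (mul_nonneg h0 (shiftDensity_pos _ _).le)
      (mul_nonneg hq1 (shiftDensity_pos _ _).le), mixDensity, add_comm]
  rw [hmix u v H hH, hmix u' v' H' hH']
  -- The posterior of the indicator plays no role if `H'` is replaced by its minimum over it.
  set G : Vec d → ℝ≥0∞ := fun z => min (H' true z) (H' false z) with hG
  have hGm : Measurable G := (hH' true).min (hH' false)
  have hHG : ∀ B z, H B z ≤ R * G z ^ (1 / p') := by
    intro B z
    rcases min_choice (H' true z) (H' false z) with hc | hc
    · rw [hG]; simp only [hc]; exact h B true z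
    · rw [hG]; simp only [hc]; exact h B false z
  set X := mixDensity q u v
  set X' := mixDensity q u' v'
  have hX : ∀ z, 0 < X z := mixDensity_pos h0 h1 u v
  have hX' : ∀ z, 0 < X' z := mixDensity_pos h0 h1 u' v'
  have hXm : Measurable X := measurable_mixDensity q u v
  have hXm' : Measurable X' := measurable_mixDensity q u' v'
  have hLHS : ∫⁻ z, (ENNReal.ofReal (q * shiftDensity (u + v) z) * H true z +
        ENNReal.ofReal ((1 - q) * shiftDensity u z) * H false z) ∂γ ≤
      R * ∫⁻ z, (fun z => ENNReal.ofReal (X z * X' z ^ (-(1 / p')))) z *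
        (fun z => ENNReal.ofReal (X' z ^ (1 / p')) * G z ^ (1 / p')) z ∂γ := by
    rw [← lintegral_const_mul _ (by fun_prop)]
    refine lintegral_mono fun z => ?_
    have e1 : ENNReal.ofReal (X z * X' z ^ (-(1 / p'))) *
        (ENNReal.ofReal (X' z ^ (1 / p')) * G z ^ (1 / p')) =
        ENNReal.ofReal (X z) * G z ^ (1 / p') := by
      rw [← mul_assoc, ← ENNReal.ofReal_mul (mul_nonneg (hX z).le (Real.rpow_nonneg (hX' z).le _)),
        mul_assoc (X z), ← Real.rpow_add (hX' z), neg_add_cancel, Real.rpow_zero, mul_one]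
    simp only [e1]
    rw [hsplit, add_mul, mul_add, mul_left_comm R, mul_left_comm R]
    gcongr <;> exact hHG _ z
  have hHolder := ENNReal.lintegral_mul_le_Lp_mul_Lq γ hp
    (f := fun z => ENNReal.ofReal (X z * X' z ^ (-(1 / p'))))
    (g := fun z => ENNReal.ofReal (X' z ^ (1 / p')) * G z ^ (1 / p'))
    (by fun_prop) (by fun_prop)
  have hf : ∀ z, ENNReal.ofReal (X z * X' z ^ (-(1 / p'))) ^ p =
      ENNReal.ofReal (X z ^ p * X' z ^ (1 - p)) := by
    intro z
    rw [ENNReal.ofReal_rpow_of_pos (mul_pos (hX z) (Real.rpow_pos_of_pos (hX' z) _)),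
      Real.mul_rpow (hX z).le (Real.rpow_nonneg (hX' z).le _), ← Real.rpow_mul (hX' z).le]
    congr 3
    have := hp.div_conj_eq_sub_one
    rw [neg_mul, one_div_mul_eq_div, this]
    ring
  have hg : ∀ z, (ENNReal.ofReal (X' z ^ (1 / p')) * G z ^ (1 / p')) ^ p' =
      ENNReal.ofReal (X' z) * G z := by
    intro z
    rw [ENNReal.mul_rpow_of_nonneg _ _ hpp'.le, ← ENNReal.rpow_mul,
      ENNReal.ofReal_rpow_of_pos (Real.rpow_pos_of_pos (hX' z) _), ← Real.rpow_mul (hX' z).le,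
      one_div_mul_cancel hpp'.ne', Real.rpow_one, ENNReal.rpow_one]
  have hR : ∫⁻ z, ENNReal.ofReal (X' z) * G z ∂γ ≤
      ∫⁻ z, (ENNReal.ofReal (q * shiftDensity (u' + v') z) * H' true z +
        ENNReal.ofReal ((1 - q) * shiftDensity u' z) * H' false z) ∂γ := by
    refine lintegral_mono fun z => ?_
    rw [hsplit, add_mul]
    gcongr
    · exact min_le_left _ _
    · exact min_le_right _ _
  simp only [Pi.mul_apply, hf, hg] at hHolder
  refine hLHS.trans ?_
  rw [mul_comm _ R, mul_assoc]
  gcongr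
  refine hHolder.trans ?_
  gcongr
  exact lintegral_mixDensity_rpow_mul_rpow_le h0 h1 hs hsτ hqτ hp1 hτ hu hv hu' hv'

end RenyiOneRound

namespace SoteriaFL

variable {n m d : ℕ} {𝒟 : Type u₁} {U : Type u₂} {V : Type u₃} {W : Type u₄} {S : Type u₅}
  [MeasurableSpace U] [MeasurableSpace V] [MeasurableSpace W] [MeasurableSpace S]
  (A : SoteriaFL n m d 𝒟 U V W S)

/-! ### Expectations of functions of the transcript, by backward recursion -/

/-- `A.value D f N t st τ` is the expectation of `f` of the messages, when `N` rounds remain, the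
next round is `t`, its initial state is `st`, and `τ` holds the messages of the earlier rounds
(as a function on all of `ℕ`; entries from round `t` on are not set yet). -/
noncomputable def value (D : Fin n → Fin m → 𝒟) (f : (ℕ → Fin n → Vec d) → ℝ≥0∞) :
    ℕ → ℕ → State n m d U → (ℕ → Fin n → Vec d) → ℝ≥0∞
  | 0, _, _, τ => f τ
  | N + 1, t, st, τ => ∫⁻ ρ, value D f N (t + 1) (A.step D t st ρ)
      (Function.update τ t fun i => A.message t i (D i) st (ρ.2 i)) ∂A.roundLaw t

/-- The messages of the rounds before `t`, extended by zero. -/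
noncomputable def buffer (D : Fin n → Fin m → 𝒟) :
    ℕ → (ℕ → RoundSeed n m d V W S) → ℕ → Fin n → Vec d
  | 0, _ => 0
  | t + 1, r => Function.update (buffer D t r) t
      fun i => A.message t i (D i) (A.state D t r) ((r t).2 i)

lemma buffer_apply_of_lt (D : Fin n → Fin m → 𝒟) (T : ℕ) (r : ℕ → RoundSeed n m d V W S) {t : ℕ}
    (ht : t < T) (i : Fin n) :
    A.buffer D T r t i = A.message t i (D i) (A.state D t r) ((r t).2 i) := by
  induction T with
  | zero => omega
  | succ T ih =>
    rcases Nat.lt_succ_iff_lt_or_eq.1 ht with h | h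
    · rw [buffer, Function.update_of_ne h.ne, ih h]
    · subst h
      rw [buffer, Function.update_self]

variable {A}

lemma measurable_step_prodMk_update (hC : ∀ t i, Measurable (Function.uncurry (A.comp t i)))
    (D : Fin n → Fin m → 𝒟) (t : ℕ) :
    Measurable fun p : (State n m d U × (ℕ → Fin n → Vec d)) × RoundSeed n m d V W S =>
      (A.step D t p.1.1 p.2, Function.update p.1.2 t
        fun i => A.message t i (D i) p.1.1 (p.2.2 i)) := by
  refine Measurable.prodMk ((measurable_step hC t D).comp (f := fun p :
    (State n m d U × (ℕ → Fin n → Vec d)) × RoundSeed n m d V W S => (p.1.1, p.2))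
      (by fun_prop)) (measurable_pi_lambda _ fun s => ?_)
  by_cases hs : s = t
  · subst hs
    simp only [Function.update_self]
    exact (measurable_messages hC s D).comp (f := fun p :
      (State n m d U × (ℕ → Fin n → Vec d)) × RoundSeed n m d V W S => (p.1.1, p.2))
      (by fun_prop)
  · simp only [Function.update_of_ne hs]
    fun_prop

lemma measurable_value (hC : ∀ t i, Measurable (Function.uncurry (A.comp t i)))
    (D : Fin n → Fin m → 𝒟) {f : (ℕ → Fin n → Vec d) → ℝ≥0∞} (hf : Measurable f) (N t : ℕ) :
    Measurable fun p : State n m d U × (ℕ → Fin n → Vec d) => A.value D f N t p.1 p.2 := by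
  induction N generalizing t with
  | zero => exact hf.comp measurable_snd
  | succ N ih =>
    have h1 := measurable_step_prodMk_update hC D t
    exact ((ih (t + 1)).comp h1).lintegral_prod_right'

lemma measurable_buffer (hC : ∀ t i, Measurable (Function.uncurry (A.comp t i)))
    (D : Fin n → Fin m → 𝒟) (t : ℕ) :
    Measurable[history n m d V W S t] (A.buffer D t) := by
  induction t with
  | zero => exact measurable_const
  | succ t ih =>
    have h1 : Measurable[history n m d V W S (t + 1)] (A.buffer D t) :=
      ih.mono (history_mono t.le_succ) le_rfl
    have h2 : Measurable[history n m d V W S (t + 1)] (A.state D t) :=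
      (measurable_state hC D t).mono (history_mono t.le_succ) le_rfl
    have h3 : Measurable[history n m d V W S (t + 1)]
        fun r : ℕ → RoundSeed n m d V W S => r t :=
      measurable_cylinderEvent_apply (X := fun _ => RoundSeed n m d V W S)
        (Set.mem_Iio.2 t.lt_succ_self)
    refine @measurable_pi_lambda _ _ _ (history n m d V W S (t + 1)) _ _ fun s => ?_
    by_cases hs : s = t
    · subst hs
      simp only [buffer, Function.update_self]
      exact (measurable_messages hC s D).comp (h2.prodMk h3)
    · simp only [buffer, Function.update_of_ne hs]
      exact (measurable_pi_apply s).comp h1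

/-- The mean of the values along the run is constant. -/
lemma lintegral_value (hC : ∀ t i, Measurable (Function.uncurry (A.comp t i)))
    (D : Fin n → Fin m → 𝒟) {f : (ℕ → Fin n → Vec d) → ℝ≥0∞} (hf : Measurable f) (N t : ℕ) :
    ∫⁻ r, A.value D f N t (A.state D t r) (A.buffer D t r) ∂A.law =
      ∫⁻ r, f (A.buffer D (t + N) r) ∂A.law := by
  induction N generalizing t with
  | zero => rfl
  | succ N ih =>
    have h1 := measurable_step_prodMk_update hC D t
    have h2 := lintegral_law_eq (A := A)
      (((measurable_state hC D t)).prodMk (measurable_buffer hC D t))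
      ((measurable_value hC D hf N (t + 1)).comp h1)
    rw [show t + (N + 1) = (t + 1) + N by ring, ← ih (t + 1)]
    exact h2.symm

lemma lintegral_buffer (hC : ∀ t i, Measurable (Function.uncurry (A.comp t i)))
    (D : Fin n → Fin m → 𝒟) {f : (ℕ → Fin n → Vec d) → ℝ≥0∞} (hf : Measurable f) (T : ℕ) :
    ∫⁻ r, f (A.buffer D T r) ∂A.law = A.value D f T 0 (A.initState D) 0 := by
  have h := lintegral_value hC D hf T 0
  rw [zero_add] at h
  rw [← h]
  simp [state, buffer]

/-- The probability of an event is the initial value of its indicator. -/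
lemma mechanism_apply (hC : ∀ t i, Measurable (Function.uncurry (A.comp t i)))
    (D : Fin n → Fin m → 𝒟) (T : ℕ) (i : Fin n) (Di : Fin m → 𝒟)
    {E : Set (Fin T → Fin n → Vec d)} (hE : MeasurableSet E) :
    A.mechanism D T i Di E = A.value (Function.update D i Di)
      (fun τ => E.indicator 1 fun t : Fin T => τ t) T 0
        (A.initState (Function.update D i Di)) 0 := by
  set D' := Function.update D i Di
  have hr : Measurable fun (τ : ℕ → Fin n → Vec d) (t : Fin T) => τ t := by fun_prop
  have hb : A.transcript D' T = fun r (t : Fin T) => A.buffer D' T r t := by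
    ext1 r
    funext t j
    exact (A.buffer_apply_of_lt D' T r t.2 j).symm
  have hbm : Measurable (A.buffer D' T) := (measurable_buffer hC D' T).mono (history_le T) le_rfl
  have hT : Measurable (A.transcript D' T) := by
    rw [hb]; exact hr.comp hbm
  rw [← lintegral_buffer hC D' (f := fun τ => E.indicator 1 fun t : Fin T => τ t)
      ((measurable_one.indicator hE).comp hr), mechanism, Measure.map_apply hT hE,
    ← lintegral_indicator_one (hT hE), hb]
  rfl

end SoteriaFL

namespace SoteriaFL

variable {n m d : ℕ} {𝒟 : Type u₁} {U : Type u₂} {V : Type u₃} {W : Type u₄} {S : Type u₅}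
  [MeasurableSpace U] [MeasurableSpace V] [MeasurableSpace W] [MeasurableSpace S]
  (A : SoteriaFL n m d 𝒟 U V W S)

/-! ### Redrawing one indicator and one perturbation -/

/-- The sampling rate `b/m`, truncated to `[0, 1]` as in `batchLaw`. -/
noncomputable def rate : unitInterval :=
  Set.projIcc (0 : ℝ) 1 zero_le_one ((A.b : ℝ) / m)

/-- The seed of a client with the indicator of sample `j` and the perturbation replaced. -/
def redrawClient (j : Fin m) (B : Bool) (ξ : Vec d) (c : ClientSeed m d W S) :
    ClientSeed m d W S :=
  (c.1, Function.update c.2.1 j B, ξ, c.2.2.2)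

/-- The randomness of a round with common coin `θ.1` and client seeds `θ.2.1`, except for client
`i`: its seed is `θ.2.2` with the indicator of sample `j` and the perturbation replaced. -/
def redraw (i : Fin n) (j : Fin m) (B : Bool) (ξ : Vec d)
    (θ : V × (Fin n → ClientSeed m d W S) × ClientSeed m d W S) : RoundSeed n m d V W S :=
  (θ.1, Function.update θ.2.1 i (redrawClient j B ξ θ.2.2))

lemma measurable_redraw (i : Fin n) (j : Fin m) :
    Measurable fun p : (Bool × Vec d) × (V × (Fin n → ClientSeed m d W S) × ClientSeed m d W S) =>
      redraw i j p.1.1 p.1.2 p.2 := by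
  refine Measurable.prodMk (by fun_prop) (measurable_pi_lambda _ fun k => ?_)
  by_cases hk : k = i
  · subst hk
    simp only [Function.update_self]
    refine Measurable.prodMk (by fun_prop) (Measurable.prodMk (measurable_pi_lambda _ fun l => ?_)
      (by fun_prop))
    by_cases hl : l = j
    · subst hl
      simp only [Function.update_self]
      fun_prop
    · simp only [Function.update_of_ne hl]
      fun_prop
  · simp only [Function.update_of_ne hk]
    fun_prop

lemma lintegral_noiseLaw {F : Vec d → ℝ≥0∞} (hF : Measurable F) :
    ∫⁻ ξ, F ξ ∂A.noiseLaw = ∫⁻ z, F (Real.sqrt A.varP • z) ∂stdGaussian (Vec d) :=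
  lintegral_map hF (by fun_prop)

lemma measurable_redrawClient (j : Fin m) :
    Measurable fun p : (Bool × Vec d) × ClientSeed m d W S =>
      redrawClient j p.1.1 p.1.2 p.2 := by
  refine Measurable.prodMk (by fun_prop) (Measurable.prodMk (measurable_pi_lambda _ fun l => ?_)
    (by fun_prop))
  by_cases hl : l = j
  · subst hl
    simp only [Function.update_self]
    fun_prop
  · simp only [Function.update_of_ne hl]
    fun_prop

lemma lintegral_clientLaw_eq_redraw (t : ℕ) (i : Fin n) (j : Fin m)
    {G : ClientSeed m d W S → ℝ≥0∞} (hG : Measurable G) :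
    ∫⁻ c, G c ∂A.clientLaw t i = ∫⁻ c, ∫⁻ B, ∫⁻ ξ, G (redrawClient j B ξ c) ∂A.noiseLaw
      ∂bernoulliMeasure true false A.rate ∂A.clientLaw t i := by
  have hr := measurable_redrawClient (m := m) (d := d) (W := W) (S := S) j
  have hK : Measurable fun c : ClientSeed m d W S => ∫⁻ B, ∫⁻ ξ, G (redrawClient j B ξ c)
      ∂A.noiseLaw ∂bernoulliMeasure true false A.rate := by
    refine Measurable.lintegral_prod_right' (f := fun p : ClientSeed m d W S × Bool =>
      ∫⁻ ξ, G (redrawClient j p.2 ξ p.1) ∂A.noiseLaw) ?_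
    exact Measurable.lintegral_prod_right' (f := fun p : (ClientSeed m d W S × Bool) × Vec d =>
      G (redrawClient j p.1.2 p.2 p.1.1)) (hG.comp (hr.comp (f := fun p :
        (ClientSeed m d W S × Bool) × Vec d => ((p.1.2, p.2), p.1.1)) (by fun_prop)))
  obtain ⟨K, hKd⟩ : ∃ K : ClientSeed m d W S → ℝ≥0∞, K = fun c => ∫⁻ B, ∫⁻ ξ,
    G (redrawClient j B ξ c) ∂A.noiseLaw ∂bernoulliMeasure true false A.rate := ⟨_, rfl⟩
  rw [← hKd] at hK ⊢
  rw [clientLaw, lintegral_prod _ hG.aemeasurable, lintegral_prod _ hK.aemeasurable]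
  refine lintegral_congr fun w => ?_
  rw [lintegral_prod _ (by fun_prop), lintegral_prod _ (by fun_prop)]
  have h1 : ∀ bt : Fin m → Bool, ∫⁻ y : Vec d × S, G (w, bt, y)
      ∂A.noiseLaw.prod (A.compLaw t i : Measure S) =
      ∫⁻ ξ, ∫⁻ s, G (w, bt, ξ, s) ∂(A.compLaw t i : Measure S) ∂A.noiseLaw := fun bt =>
    lintegral_prod _ (by fun_prop)
  have hm : Measurable fun bt : Fin m → Bool => ∫⁻ ξ, ∫⁻ s, G (w, bt, ξ, s)
      ∂(A.compLaw t i : Measure S) ∂A.noiseLaw := by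
    refine Measurable.lintegral_prod_right' (f := fun p : (Fin m → Bool) × Vec d =>
      ∫⁻ s, G (w, p.1, p.2, s) ∂(A.compLaw t i : Measure S)) ?_
    exact Measurable.lintegral_prod_right' (f := fun p : ((Fin m → Bool) × Vec d) × S =>
      G (w, p.1.1, p.1.2, p.2)) (by fun_prop)
  simp_rw [h1]
  rw [batchLaw, lintegral_pi_eq_lintegral_update _ j hm]
  refine lintegral_congr fun bt => ?_
  rw [lintegral_prod_symm _ (by fun_prop)]
  simp only [hKd, redrawClient, lintegral_const, measure_univ, mul_one]
  have hG1 : Measurable fun p : (S × Bool) × Vec d =>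
      G (w, Function.update bt j p.1.2, p.2, p.1.1) :=
    hG.comp (hr.comp (f := fun p : (S × Bool) × Vec d => ((p.1.2, p.2), (w, bt, p.2, p.1.1)))
      (by fun_prop))
  refine Eq.trans ?_ (lintegral_lintegral_swap
    (f := fun s B => ∫⁻ ξ, G (w, Function.update bt j B, ξ, s) ∂A.noiseLaw)
    (hG1.lintegral_prod_right' (ν := A.noiseLaw)).aemeasurable).symm
  refine lintegral_congr fun B => ?_
  exact lintegral_lintegral_swap (f := fun ξ s => G (w, Function.update bt j B, ξ, s))
    (hG1.comp (f := fun p : Vec d × S => ((p.2, B), p.1)) (by fun_prop)).aemeasurable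

/-- Averaging over one indicator and one perturbation first. The remaining randomness has a law
that does not depend on the data. -/
lemma lintegral_roundLaw_eq_redraw (t : ℕ) (i : Fin n) (j : Fin m)
    {F : RoundSeed n m d V W S → ℝ≥0∞} (hF : Measurable F) :
    ∫⁻ ρ, F ρ ∂A.roundLaw t =
      ∫⁻ θ, (ENNReal.ofReal A.rate *
          ∫⁻ z, F (redraw i j true (Real.sqrt A.varP • z) θ) ∂stdGaussian (Vec d) +
        ENNReal.ofReal (1 - A.rate) *
          ∫⁻ z, F (redraw i j false (Real.sqrt A.varP • z) θ) ∂stdGaussian (Vec d))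
        ∂(A.est.commonLaw t : Measure V).prod ((Measure.pi (A.clientLaw t)).prod
          (A.clientLaw t i)) := by
  have hr := measurable_redraw (m := m) (d := d) (V := V) (W := W) (S := S) i j
  have h2 : ∀ (θ : V × (Fin n → ClientSeed m d W S) × ClientSeed m d W S) (B : Bool),
      ∫⁻ ξ, F (redraw i j B ξ θ) ∂A.noiseLaw =
        ∫⁻ z, F (redraw i j B (Real.sqrt A.varP • z) θ) ∂stdGaussian (Vec d) := fun θ B =>
    A.lintegral_noiseLaw (F := fun ξ => F (redraw i j B ξ θ))
      (hF.comp (hr.comp (f := fun ξ => ((B, ξ), θ)) (by fun_prop)))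
  have h3 : ∀ θ : V × (Fin n → ClientSeed m d W S) × ClientSeed m d W S,
      ENNReal.ofReal A.rate *
          ∫⁻ z, F (redraw i j true (Real.sqrt A.varP • z) θ) ∂stdGaussian (Vec d) +
        ENNReal.ofReal (1 - A.rate) *
          ∫⁻ z, F (redraw i j false (Real.sqrt A.varP • z) θ) ∂stdGaussian (Vec d) =
      ∫⁻ B, ∫⁻ ξ, F (redraw i j B ξ θ) ∂A.noiseLaw ∂bernoulliMeasure true false A.rate := by
    intro θ
    rw [lintegral_bernoulliMeasure_bool, h2, h2]
  rw [lintegral_congr h3]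
  have hK : Measurable fun θ : V × (Fin n → ClientSeed m d W S) × ClientSeed m d W S =>
      ∫⁻ B, ∫⁻ ξ, F (redraw i j B ξ θ) ∂A.noiseLaw ∂bernoulliMeasure true false A.rate := by
    refine Measurable.lintegral_prod_right' (f := fun p :
      (V × (Fin n → ClientSeed m d W S) × ClientSeed m d W S) × Bool =>
      ∫⁻ ξ, F (redraw i j p.2 ξ p.1) ∂A.noiseLaw) ?_
    exact Measurable.lintegral_prod_right' (f := fun p :
      ((V × (Fin n → ClientSeed m d W S) × ClientSeed m d W S) × Bool) × Vec d =>
      F (redraw i j p.1.2 p.2 p.1.1)) (hF.comp (hr.comp (f := fun p :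
        ((V × (Fin n → ClientSeed m d W S) × ClientSeed m d W S) × Bool) × Vec d =>
        ((p.1.2, p.2), p.1.1)) (by fun_prop)))
  obtain ⟨K, hKd⟩ : ∃ K : V × (Fin n → ClientSeed m d W S) × ClientSeed m d W S → ℝ≥0∞,
    K = fun θ => ∫⁻ B, ∫⁻ ξ, F (redraw i j B ξ θ) ∂A.noiseLaw
      ∂bernoulliMeasure true false A.rate := ⟨_, rfl⟩
  rw [← hKd] at hK ⊢
  rw [roundLaw_eq, lintegral_prod _ hF.aemeasurable, lintegral_prod _ hK.aemeasurable]
  refine lintegral_congr fun a => ?_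
  rw [lintegral_prod _ (by fun_prop), lintegral_pi_eq_lintegral_update _ i (by fun_prop)]
  refine lintegral_congr fun ω => ?_
  simp only [hKd]
  have hup : Measurable fun c : ClientSeed m d W S => F (a, Function.update ω i c) :=
    hF.comp (measurable_const.prodMk (measurable_update ω))
  exact A.lintegral_clientLaw_eq_redraw t i j hup

/-! ### The contribution of one sample -/

/-- The contribution of sample `j` to the estimate of client `i`, if `B` is the indicator of the
sample. -/
noncomputable def contribution (t : ℕ) (i : Fin n) (Di : Fin m → 𝒟) (st : State n m d U)
    (w : W) (j : Fin m) (B : Bool) : Vec d :=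
  (1 / (A.b : ℝ)) • (if B = true then A.est.φ t i j (Di j) (st.2 i j) st.1 w else 0) +
    (1 / (m : ℝ)) • A.est.ψ t i j (Di j) (st.2 i j) st.1 w

lemma estimate_sub_contribution (t : ℕ) (i : Fin n) (Di : Fin m → 𝒟) (st : State n m d U)
    (c : ClientSeed m d W S) (j : Fin m) :
    A.estimate t i Di st c - A.contribution t i Di st c.1 j (c.2.1 j) =
      (1 / (A.b : ℝ)) • (∑ k ∈ Finset.univ.erase j, if c.2.1 k = true then
          A.est.φ t i k (Di k) (st.2 i k) st.1 c.1 else 0) +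
        (1 / (m : ℝ)) • ∑ k ∈ Finset.univ.erase j, A.est.ψ t i k (Di k) (st.2 i k) st.1 c.1 := by
  rw [estimate_eq_sum_ite, contribution, ← Finset.add_sum_erase _ _ (Finset.mem_univ j),
    ← Finset.add_sum_erase _ (fun k => A.est.ψ t i k (Di k) (st.2 i k) st.1 c.1)
      (Finset.mem_univ j), smul_add, smul_add]
  abel

variable {A}

/-- Two states agree up to the memory cell of sample `j` of client `i`. -/
structure StateAgree (i : Fin n) (j : Fin m) (st st' : State n m d U) : Prop where
  pub : st.1 = st'.1
  cell : ∀ k l, (k, l) ≠ (i, j) → st.2 k l = st'.2 k l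

/-- Two datasets agree up to sample `j` of client `i`. -/
def DataAgree (i : Fin n) (j : Fin m) (D D' : Fin n → Fin m → 𝒟) : Prop :=
  ∀ k l, (k, l) ≠ (i, j) → D k l = D' k l

lemma estimate_eq_of_agree {i : Fin n} {j : Fin m} {D D' : Fin n → Fin m → 𝒟}
    {st st' : State n m d U} (hD : DataAgree i j D D') (hst : StateAgree i j st st') (t : ℕ)
    {k : Fin n} (hk : k ≠ i) (c : ClientSeed m d W S) :
    A.estimate t k (D k) st c = A.estimate t k (D' k) st' c := by
  have h : ∀ l, (k, l) ≠ (i, j) := fun l hl => hk (Prod.ext_iff.1 hl).1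
  rw [estimate_eq_sum_ite, estimate_eq_sum_ite]
  simp_rw [hst.pub, fun l => hst.cell k l (h l), fun l => hD k l (h l)]

lemma estimate_sub_contribution_eq_of_agree {i : Fin n} {j : Fin m} {D D' : Fin n → Fin m → 𝒟}
    {st st' : State n m d U} (hD : DataAgree i j D D') (hst : StateAgree i j st st') (t : ℕ)
    {c c' : ClientSeed m d W S} (hw : c.1 = c'.1) (hB : ∀ l ≠ j, c.2.1 l = c'.2.1 l) :
    A.estimate t i (D i) st c - A.contribution t i (D i) st c.1 j (c.2.1 j) =
      A.estimate t i (D' i) st' c' - A.contribution t i (D' i) st' c'.1 j (c'.2.1 j) := by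
  have h : ∀ l ≠ j, (i, l) ≠ (i, j) := fun l hl h => hl (Prod.ext_iff.1 h).2
  rw [estimate_sub_contribution, estimate_sub_contribution]
  congr 2 <;> refine Finset.sum_congr rfl fun l hl => ?_
  · have hlj := Finset.ne_of_mem_erase hl
    rw [hB l hlj, hst.pub, hst.cell i l (h l hlj), hD i l (h l hlj), hw]
  · have hlj := Finset.ne_of_mem_erase hl
    rw [hst.pub, hst.cell i l (h l hlj), hD i l (h l hlj), hw]

/-- The perturbation and the contribution of the sample enter the message only by their sum. -/
lemma messages_redraw_eq {i : Fin n} {j : Fin m} {D D' : Fin n → Fin m → 𝒟}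
    {st st' : State n m d U} (hD : DataAgree i j D D') (hst : StateAgree i j st st') (t : ℕ)
    (B B' : Bool) (y : Vec d) (θ : V × (Fin n → ClientSeed m d W S) × ClientSeed m d W S) :
    (fun k => A.message t k (D k) st
      ((redraw i j B (y - A.contribution t i (D i) st θ.2.2.1 j B) θ).2 k)) =
    fun k => A.message t k (D' k) st'
      ((redraw i j B' (y - A.contribution t i (D' i) st' θ.2.2.1 j B') θ).2 k) := by
  funext k
  by_cases hk : k = i
  · subst hk
    simp only [redraw, Function.update_self, message]
    have h := estimate_sub_contribution_eq_of_agree (A := A) hD hst t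
      (c := redrawClient j B (y - A.contribution t k (D k) st θ.2.2.1 j B) θ.2.2)
      (c' := redrawClient j B' (y - A.contribution t k (D' k) st' θ.2.2.1 j B') θ.2.2) rfl
      (fun l hl => by simp [redrawClient, Function.update_of_ne hl])
    simp only [redrawClient, Function.update_self] at h ⊢
    rw [hst.pub]
    congr 2
    exact (add_sub_left_comm _ _ _).trans
      ((congrArg (y + ·) h).trans (add_sub_left_comm _ _ _).symm)
  · simp only [redraw, Function.update_of_ne hk, message]
    rw [estimate_eq_of_agree hD hst t hk, hst.pub]

/-- Agreement of the states persists whatever the two indicators of the sample are, since only its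
own memory cell depends on its indicator beyond the messages. -/
lemma StateAgree.step_redraw {i : Fin n} {j : Fin m} {D D' : Fin n → Fin m → 𝒟}
    {st st' : State n m d U} (hD : DataAgree i j D D') (hst : StateAgree i j st st') (t : ℕ)
    (B B' : Bool) (y : Vec d) (θ : V × (Fin n → ClientSeed m d W S) × ClientSeed m d W S) :
    StateAgree i j
      (A.step D t st (redraw i j B (y - A.contribution t i (D i) st θ.2.2.1 j B) θ))
      (A.step D' t st' (redraw i j B' (y - A.contribution t i (D' i) st' θ.2.2.1 j B') θ)) := by
  have hmsg := messages_redraw_eq (A := A) hD hst t B B' y θ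
  have hmsg' := fun k => congrFun hmsg k
  refine ⟨?_, fun k l hkl => ?_⟩
  · simp only [step, hmsg', hst.pub]
  · simp only [step]
    rw [hmsg, hst.pub, hst.cell k l hkl, hD k l hkl]
    have h1 : ∀ (B : Bool) (y : Vec d), ((redraw i j B y θ).2 k).1 =
        ((redraw i j true 0 θ).2 k).1 := by
      intro B y
      by_cases hk : k = i
      · subst hk; simp [redraw, redrawClient]
      · simp [redraw, Function.update_of_ne hk]
    have h2 : ∀ (B : Bool) (y : Vec d), ((redraw i j B y θ).2 k).2.1 l =
        ((redraw i j true 0 θ).2 k).2.1 l := by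
      intro B y
      by_cases hk : k = i
      · subst hk
        have hl : l ≠ j := fun h => hkl (by rw [h])
        simp [redraw, redrawClient, Function.update_of_ne hl]
      · simp [redraw, Function.update_of_ne hk]
    rw [h1, h2, h1 B', h2 B']
    rfl

end SoteriaFL

namespace SoteriaFL

variable {n m d : ℕ} {𝒟 : Type u₁} {U : Type u₂} {V : Type u₃} {W : Type u₄} {S : Type u₅}
  [MeasurableSpace U] [MeasurableSpace V] [MeasurableSpace W] [MeasurableSpace S]
  {A : SoteriaFL n m d 𝒟 U V W S}

/-! ### Composition over the rounds and local differential privacy -/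

lemma norm_psi_contribution_le {G_B : ℝ} (hψ : ∀ t i j z u p w, ‖A.est.ψ t i j z u p w‖ ≤ G_B)
    {σ s : ℝ} (hσ : 0 < σ) (hs : G_B / (m * σ) ≤ s) (t : ℕ) (i : Fin n) (j : Fin m) (z : 𝒟)
    (u : U) (p : Pub n d) (w : W) :
    ‖σ⁻¹ • (1 / (m : ℝ)) • A.est.ψ t i j z u p w‖ ≤ s := by
  have hm : (0 : ℝ) < m := by exact_mod_cast j.pos
  rw [norm_smul, norm_smul, norm_inv, Real.norm_of_nonneg hσ.le,
    Real.norm_of_nonneg (by positivity)]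
  refine le_trans ?_ hs
  calc σ⁻¹ * (1 / m * ‖A.est.ψ t i j z u p w‖) ≤ σ⁻¹ * (1 / m * G_B) := by
        gcongr; exact hψ t i j z u p w
    _ = G_B / (m * σ) := by field_simp

lemma norm_phi_contribution_le {G_A : ℝ} (hφ : ∀ t i j z u p w, ‖A.est.φ t i j z u p w‖ ≤ G_A)
    (hb : 0 < A.b) {σ τ : ℝ} (hσ : 0 < σ) (hτ : G_A / (A.b * σ) ≤ τ) (t : ℕ) (i : Fin n)
    (j : Fin m) (z : 𝒟) (u : U) (p : Pub n d) (w : W) :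
    ‖σ⁻¹ • (1 / (A.b : ℝ)) • A.est.φ t i j z u p w‖ ≤ τ := by
  have hm : (0 : ℝ) < A.b := by exact_mod_cast hb
  rw [norm_smul, norm_smul, norm_inv, Real.norm_of_nonneg hσ.le,
    Real.norm_of_nonneg (by positivity)]
  refine le_trans ?_ hτ
  calc σ⁻¹ * (1 / A.b * ‖A.est.φ t i j z u p w‖) ≤ σ⁻¹ * (1 / A.b * G_A) := by
        gcongr; exact hφ t i j z u p w
    _ = G_A / (A.b * σ) := by field_simp

/-- The dual Rényi bound for the remaining rounds, from two states that differ in one memory cell.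
No disintegration over the hidden cells is needed, since the bound is uniform in the two cells. -/
lemma value_le_of_agree (hC : ∀ t i, Measurable (Function.uncurry (A.comp t i)))
    {G_A G_B σ s τ p p' : ℝ} (hφ : ∀ t i j z u p w, ‖A.est.φ t i j z u p w‖ ≤ G_A)
    (hψ : ∀ t i j z u p w, ‖A.est.ψ t i j z u p w‖ ≤ G_B) (hb : 0 < A.b)
    (hσ : 0 < σ) (hσv : Real.sqrt A.varP = σ) (hp : p.HolderConjugate p') (hs : 0 < s)
    (hsτ : s ≤ τ) (hqτ : A.rate * τ ≤ 2 * s) (hτ : 2 * p * τ ^ 2 ≤ 1 / 1024)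
    (hGB : G_B / (m * σ) ≤ s) (hGA : G_A / (A.b * σ) ≤ τ) {i : Fin n} {j : Fin m}
    {D D' : Fin n → Fin m → 𝒟} (hD : DataAgree i j D D')
    {f : (ℕ → Fin n → Vec d) → ℝ≥0∞} (hf : Measurable f) (N t : ℕ)
    {st st' : State n m d U} (hst : StateAgree i j st st') (buf : ℕ → Fin n → Vec d) :
    A.value D f N t st buf ≤
      (ENNReal.ofReal (Real.exp (4000 * ((2 * p) ^ 2 * s ^ 2))) ^ (1 / p)) ^ N *
        A.value D' (fun x => f x ^ p') N t st' buf ^ (1 / p') := by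
  set Mo := ENNReal.ofReal (Real.exp (4000 * ((2 * p) ^ 2 * s ^ 2)))
  induction N generalizing t st st' buf with
  | zero =>
    simp only [value, pow_zero, one_mul]
    rw [← ENNReal.rpow_mul, mul_one_div_cancel hp.symm.ne_zero, ENNReal.rpow_one]
  | succ N ih =>
    -- The continuation values in the two worlds, as functions of the randomness of the round.
    obtain ⟨F, hF⟩ : ∃ F : RoundSeed n m d V W S → ℝ≥0∞, F = fun ρ => A.value D f N (t + 1)
      (A.step D t st ρ) (Function.update buf t fun i => A.message t i (D i) st (ρ.2 i)) :=
      ⟨_, rfl⟩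
    obtain ⟨F', hF'⟩ : ∃ F' : RoundSeed n m d V W S → ℝ≥0∞, F' = fun ρ =>
      A.value D' (fun x => f x ^ p') N (t + 1) (A.step D' t st' ρ)
        (Function.update buf t fun i => A.message t i (D' i) st' (ρ.2 i)) := ⟨_, rfl⟩
    have hFm : Measurable F := by
      rw [hF]
      exact ((measurable_value hC D hf N (t + 1)).comp
        (measurable_step_prodMk_update hC D t)).comp (measurable_prodMk_left (x := (st, buf)))
    have hFm' : Measurable F' := by
      rw [hF']
      exact ((measurable_value hC D' (hf.pow_const p') N (t + 1)).comp
        (measurable_step_prodMk_update hC D' t)).comp (measurable_prodMk_left (x := (st', buf)))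
    have hv : A.value D f (N + 1) t st buf = ∫⁻ ρ, F ρ ∂A.roundLaw t := by rw [hF]; rfl
    have hv' : A.value D' (fun x => f x ^ p') (N + 1) t st' buf = ∫⁻ ρ, F' ρ ∂A.roundLaw t := by
      rw [hF']; rfl
    have hr := measurable_redraw (m := m) (d := d) (V := V) (W := W) (S := S) i j
    rw [hv, hv', A.lintegral_roundLaw_eq_redraw t i j hFm,
      A.lintegral_roundLaw_eq_redraw t i j hFm', hσv]
    set Θ := (A.est.commonLaw t : Measure V).prod ((Measure.pi (A.clientLaw t)).prod
      (A.clientLaw t i))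
    have hround : ∀ θ : V × (Fin n → ClientSeed m d W S) × ClientSeed m d W S,
        ENNReal.ofReal A.rate *
          ∫⁻ z, F (redraw i j true (σ • z) θ) ∂stdGaussian (Vec d) +
        ENNReal.ofReal (1 - A.rate) *
          ∫⁻ z, F (redraw i j false (σ • z) θ) ∂stdGaussian (Vec d) ≤
        Mo ^ (1 / p) * (Mo ^ (1 / p)) ^ N *
          (ENNReal.ofReal A.rate *
            ∫⁻ z, F' (redraw i j true (σ • z) θ) ∂stdGaussian (Vec d) +
          ENNReal.ofReal (1 - A.rate) *
            ∫⁻ z, F' (redraw i j false (σ • z) θ) ∂stdGaussian (Vec d)) ^ (1 / p') := by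
      intro θ
      have hshift : ∀ (D : Fin n → Fin m → 𝒟) (st : State n m d U) (z : Vec d),
          σ • z = σ • (z + (σ⁻¹ • (1 / (m : ℝ)) • A.est.ψ t i j (D i j) (st.2 i j) st.1 θ.2.2.1 +
            σ⁻¹ • (1 / (A.b : ℝ)) • A.est.φ t i j (D i j) (st.2 i j) st.1 θ.2.2.1)) -
            A.contribution t i (D i) st θ.2.2.1 j true ∧
          σ • z = σ • (z + σ⁻¹ • (1 / (m : ℝ)) • A.est.ψ t i j (D i j) (st.2 i j) st.1 θ.2.2.1) -
            A.contribution t i (D i) st θ.2.2.1 j false := by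
        intro D st z
        simp only [smul_add, smul_inv_smul₀ hσ.ne', contribution, if_true, Bool.false_eq_true,
          if_false, smul_zero, zero_add, add_sub_cancel_right, and_true]
        abel
      have hmF : ∀ (G : RoundSeed n m d V W S → ℝ≥0∞) (B : Bool) (x : Vec d), Measurable G →
          Measurable fun z : Vec d => G (redraw i j B (σ • z - x) θ) := fun G B x hG =>
        hG.comp (hr.comp (f := fun z : Vec d => ((B, σ • z - x), θ)) (by fun_prop))
      have key := subsampledGaussian_dual_renyi (R := (Mo ^ (1 / p)) ^ N) hp A.rate.2.1 A.rate.2.2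
        hs hsτ hqτ hτ
        (norm_psi_contribution_le hψ hσ hGB t i j (D i j) (st.2 i j) st.1 θ.2.2.1)
        (norm_phi_contribution_le hφ hb hσ hGA t i j (D i j) (st.2 i j) st.1 θ.2.2.1)
        (norm_psi_contribution_le hψ hσ hGB t i j (D' i j) (st'.2 i j) st'.1 θ.2.2.1)
        (norm_phi_contribution_le hφ hb hσ hGA t i j (D' i j) (st'.2 i j) st'.1 θ.2.2.1)
        (H := fun B z => F (redraw i j B (σ • z - A.contribution t i (D i) st θ.2.2.1 j B) θ))
        (H' := fun B z => F' (redraw i j B (σ • z - A.contribution t i (D' i) st' θ.2.2.1 j B) θ))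
        (fun B => hmF F B _ hFm) (fun B => hmF F' B _ hFm') (fun B B' z => ?_)
      · simpa only [← (hshift D st _).1, ← (hshift D st _).2, ← (hshift D' st' _).1,
          ← (hshift D' st' _).2] using key
      · simp only [hF, hF']
        rw [messages_redraw_eq hD hst t B B' (σ • z) θ]
        exact ih (t + 1) (hst.step_redraw hD t B B' (σ • z) θ) _
    refine (lintegral_mono hround).trans ?_
    have hKm : Measurable fun θ : V × (Fin n → ClientSeed m d W S) × ClientSeed m d W S =>
        ENNReal.ofReal A.rate *
            ∫⁻ z, F' (redraw i j true (σ • z) θ) ∂stdGaussian (Vec d) +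
          ENNReal.ofReal (1 - A.rate) *
            ∫⁻ z, F' (redraw i j false (σ • z) θ) ∂stdGaussian (Vec d) := by
      have hm : ∀ B : Bool, Measurable
          fun θ : V × (Fin n → ClientSeed m d W S) × ClientSeed m d W S =>
            ∫⁻ z, F' (redraw i j B (σ • z) θ) ∂stdGaussian (Vec d) := fun B =>
        Measurable.lintegral_prod_right' (f := fun p :
          (V × (Fin n → ClientSeed m d W S) × ClientSeed m d W S) × Vec d =>
            F' (redraw i j B (σ • p.2) p.1)) (hFm'.comp (hr.comp (f := fun p :
          (V × (Fin n → ClientSeed m d W S) × ClientSeed m d W S) × Vec d =>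
            ((B, σ • p.2), p.1)) (by fun_prop)))
      exact ((hm true).const_mul _).add ((hm false).const_mul _)
    rw [lintegral_const_mul _ (hKm.pow_const _), pow_succ']
    gcongr
    exact lintegral_rpow_le_rpow_lintegral Θ hp hKm

/-- Without noise and without contributions of the samples, the messages carry no information. -/
lemma value_eq_of_agree (hφ : ∀ t i j z u p w, A.est.φ t i j z u p w = 0)
    (hψ : ∀ t i j z u p w, A.est.ψ t i j z u p w = 0) {i : Fin n} {j : Fin m}
    {D D' : Fin n → Fin m → 𝒟} (hD : DataAgree i j D D')
    (f : (ℕ → Fin n → Vec d) → ℝ≥0∞) (N t : ℕ)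
    {st st' : State n m d U} (hst : StateAgree i j st st') (buf : ℕ → Fin n → Vec d) :
    A.value D f N t st buf = A.value D' f N t st' buf := by
  induction N generalizing t st st' buf with
  | zero => rfl
  | succ N ih =>
    refine lintegral_congr fun ρ => ?_
    have hc : ∀ (D : Fin n → Fin m → 𝒟) (st : State n m d U) (w : W) (B : Bool),
        A.contribution t i (D i) st w j B = 0 := by
      intro D st w B
      simp [contribution, hφ, hψ]
    have hself : redraw i j ((ρ.2 i).2.1 j) (ρ.2 i).2.2.1 (ρ.1, ρ.2, ρ.2 i) = ρ := by
      simp [redraw, redrawClient]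
    have h1 := messages_redraw_eq (A := A) hD hst t ((ρ.2 i).2.1 j) ((ρ.2 i).2.1 j) (ρ.2 i).2.2.1
      (ρ.1, ρ.2, ρ.2 i)
    have h2 := hst.step_redraw (A := A) hD t ((ρ.2 i).2.1 j) ((ρ.2 i).2.1 j) (ρ.2 i).2.2.1
      (ρ.1, ρ.2, ρ.2 i)
    simp only [hc, sub_zero, hself] at h1 h2
    rw [h1]
    exact ih (t + 1) h2 _

lemma dataAgree_update (D : Fin n → Fin m → 𝒟) (i : Fin n) {Di Di' : Fin m → 𝒟} {j : Fin m}
    (h : ∀ k, k ≠ j → Di k = Di' k) :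
    DataAgree i j (Function.update D i Di) (Function.update D i Di') := by
  intro k l hkl
  by_cases hk : k = i
  · subst hk
    simpa using h l fun hl => hkl (by rw [hl])
  · simp [Function.update_of_ne hk]

lemma DataAgree.initState {i : Fin n} {j : Fin m} {D D' : Fin n → Fin m → 𝒟}
    (h : DataAgree i j D D') : StateAgree i j (A.initState D) (A.initState D') :=
  ⟨rfl, fun k l hkl => by simp only [SoteriaFL.initState, h k l hkl]⟩

/-- From a dual Rényi bound of order `p` to approximate differential privacy. -/
lemma _root_.ENNReal.le_exp_mul_add_of_le_rpow {p p' Λ ε δ : ℝ} (hp : p.HolderConjugate p')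
    (hδ : 0 < δ) (h : Λ + Real.log (1 / δ) ≤ (p - 1) * ε) {a b : ℝ≥0∞}
    (hab : a ≤ ENNReal.ofReal (Real.exp (Λ / p)) * b ^ (1 / p')) :
    a ≤ ENNReal.ofReal (Real.exp ε) * b + ENNReal.ofReal δ := by
  have hp0 := hp.pos
  have hp0' := hp.symm.pos
  have h1 : Real.exp (Λ / p) ≤ δ ^ (1 / p) * Real.exp ε ^ (1 / p') := by
    rw [Real.rpow_def_of_pos hδ, ← Real.exp_mul, ← Real.exp_add]
    refine Real.exp_le_exp.2 ?_
    have h3 : p'⁻¹ = 1 - p⁻¹ := by linarith [hp.inv_add_inv_eq_one]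
    rw [one_div p', h3, one_div p]
    rw [one_div, Real.log_inv] at h
    have h2 : Λ / p ≤ ((p - 1) * ε + Real.log δ) / p := by gcongr; linarith
    refine h2.trans (le_of_eq ?_)
    field_simp
    ring
  have hY := ENNReal.young_inequality (ENNReal.ofReal δ ^ (1 / p))
    ((ENNReal.ofReal (Real.exp ε) * b) ^ (1 / p')) hp
  rw [← ENNReal.rpow_mul, ← ENNReal.rpow_mul, one_div_mul_cancel hp0.ne',
    one_div_mul_cancel hp0'.ne', ENNReal.rpow_one, ENNReal.rpow_one] at hY
  have hdiv : ∀ {x : ℝ≥0∞} {r : ℝ}, 1 < r → x / ENNReal.ofReal r ≤ x := by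
    intro x r hr
    refine ENNReal.div_le_of_le_mul (le_mul_of_one_le_right' ?_)
    simpa using hr.le
  calc a ≤ ENNReal.ofReal (δ ^ (1 / p) * Real.exp ε ^ (1 / p')) * b ^ (1 / p') :=
        hab.trans (mul_le_mul_left (ENNReal.ofReal_le_ofReal h1) _)
    _ = ENNReal.ofReal δ ^ (1 / p) * (ENNReal.ofReal (Real.exp ε) * b) ^ (1 / p') := by
        rw [ENNReal.ofReal_mul (by positivity), ← ENNReal.ofReal_rpow_of_pos hδ,
          ← ENNReal.ofReal_rpow_of_pos (Real.exp_pos _), mul_assoc,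
          ENNReal.mul_rpow_of_nonneg _ _ (by positivity)]
    _ ≤ ENNReal.ofReal δ + ENNReal.ofReal (Real.exp ε) * b :=
        hY.trans (add_le_add (hdiv hp.lt) (hdiv hp.symm.lt))
    _ = _ := add_comm _ _

lemma coe_rate (hm : 0 < m) (hbm : A.b ≤ m) : (A.rate : ℝ) = A.b / m := by
  have hm' : (0 : ℝ) < m := by exact_mod_cast hm
  have hbm' : (A.b : ℝ) ≤ m := by exact_mod_cast hbm
  rw [rate, Set.projIcc_of_mem]
  exact ⟨by positivity, (div_le_one hm').2 hbm'⟩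

/-- Local differential privacy. The Rényi order `p` is chosen as `1 + 2 log(1/δ)/ε`, so that the
conversion costs half of `ε` and the divergence accumulated over `T` rounds may use the other
half. -/
theorem satisfiesLDP (hC : ∀ t i, Measurable (Function.uncurry (A.comp t i)))
    {κ c G_A G_B ε δ : ℝ} {T : ℕ} (hκ : 0 < κ) (hc : c = 4000 * (2 * κ + 4) ^ 2)
    (hφ : ∀ t i j z u p w, ‖A.est.φ t i j z u p w‖ ≤ G_A)
    (hψ : ∀ t i j z u p w, ‖A.est.ψ t i j z u p w‖ ≤ G_B) (hm : 0 < m) (hT : 0 < T)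
    (hb : 0 < A.b) (hbm : A.b ≤ m) (hε : 0 < ε) (hδ : 0 < δ) (hδ1 : δ < 1)
    (hvar : A.varP = c * ((G_A ^ 2 / 4 + G_B ^ 2) * T * Real.log (1 / δ) / (m ^ 2 * ε ^ 2)))
    (hεb : ε < c / (4096 * (2 * κ + 4)) * A.b ^ 2 * T / m ^ 2)
    (hεκ : ε ≤ κ * Real.log (1 / δ)) : A.SatisfiesLDP T ε δ := by
  intro D i Di Di' ⟨j, hj⟩ E hE
  rw [mechanism_apply hC D T i Di hE, mechanism_apply hC D T i Di' hE]
  have hD := dataAgree_update D i hj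
  have hst := hD.initState (A := A)
  set f : (ℕ → Fin n → Vec d) → ℝ≥0∞ := fun τ => E.indicator 1 fun t : Fin T => τ t with hf
  have hfm : Measurable f :=
    (measurable_one.indicator hE).comp (g := E.indicator 1)
      (f := fun (τ : ℕ → Fin n → Vec d) (t : Fin T) => τ t) (by fun_prop)
  set l := Real.log (1 / δ) with hl
  have hl0 : 0 < l := Real.log_pos (by rw [one_div]; exact (one_lt_inv₀ hδ).2 hδ1)
  have hm' : (0 : ℝ) < m := by exact_mod_cast hm
  have hb' : (0 : ℝ) < A.b := by exact_mod_cast hb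
  have hT' : (0 : ℝ) < T := by exact_mod_cast hT
  set k := 2 * κ + 4 with hk
  have hk0 : 0 < k := by positivity
  have hc0 : 0 < c := by rw [hc]; positivity
  set G := Real.sqrt (G_A ^ 2 / 4 + G_B ^ 2) with hG
  have hG2 : G ^ 2 = G_A ^ 2 / 4 + G_B ^ 2 := Real.sq_sqrt (by positivity)
  have hGG : 0 ≤ G := Real.sqrt_nonneg _
  have hGA : G_A ≤ 2 * G := by nlinarith [sq_nonneg G_B]
  have hGB : G_B ≤ G := by nlinarith [sq_nonneg G_A]
  rcases hGG.eq_or_lt with h0 | hGpos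
  · -- If `G_A = G_B = 0` then the noise vanishes as well.
    have h1 : ∀ t i j z u p w, A.est.φ t i j z u p w = 0 := fun t i j z u p w =>
      norm_le_zero_iff.1 ((hφ t i j z u p w).trans (by linarith))
    have h2 : ∀ t i j z u p w, A.est.ψ t i j z u p w = 0 := fun t i j z u p w =>
      norm_le_zero_iff.1 ((hψ t i j z u p w).trans (by linarith))
    rw [value_eq_of_agree h1 h2 hD f T 0 hst]
    refine le_add_right (le_mul_of_one_le_left' ?_)
    simpa using Real.one_le_exp hε.le
  -- The standard deviation of the noise is `G / (m s)`.
  set s := ε / Real.sqrt (c * T * l) with hs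
  have hs0 : 0 < s := by positivity
  have hs2 : s ^ 2 = ε ^ 2 / (c * T * l) := by
    rw [hs, div_pow, Real.sq_sqrt (by positivity)]
  have hσ : Real.sqrt A.varP = G / (m * s) := by
    rw [Real.sqrt_eq_iff_mul_self_eq (by rw [hvar]; positivity) (by positivity), ← sq, div_pow,
      mul_pow, hs2, hvar, hG2]
    field_simp
  have hσ0 : 0 < G / (m * s) := by positivity
  set p := 1 + 2 * l / ε with hp
  have hp1 : 1 < p := by
    have : 0 < 2 * l / ε := by positivity
    linarith
  have hconj : p.HolderConjugate p.conjExponent := Real.HolderConjugate.conjExponent hp1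
  have h2p : 2 * p ≤ k * l / ε := by
    rw [hp, hk, le_div_iff₀ hε]
    have : (2 * (1 + 2 * l / ε)) * ε = 2 * ε + 4 * l := by field_simp; ring
    rw [this]
    nlinarith
  have hq := coe_rate (A := A) hm hbm
  set q : ℝ := (A.b : ℝ) / m with hqdef
  have hq0 : 0 < q := by positivity
  have hq1 : q ≤ 1 := by rw [← hq]; exact A.rate.2.2
  have hτ : 2 * p * (2 * s / q) ^ 2 ≤ 1 / 1024 := by
    have hεq : ε < c / (4096 * k) * q ^ 2 * T := by
      refine hεb.trans_eq ?_
      rw [hqdef]; field_simp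
    calc 2 * p * (2 * s / q) ^ 2 ≤ k * l / ε * (2 * s / q) ^ 2 := by gcongr
      _ = 4 * k * ε / (q ^ 2 * c * T) := by
          rw [div_pow, mul_pow, hs2]; field_simp; ring
      _ ≤ 4 * k * (c / (4096 * k) * q ^ 2 * T) / (q ^ 2 * c * T) := by gcongr
      _ = 1 / 1024 := by field_simp; norm_num
  have hval := value_le_of_agree (σ := G / (m * s)) (s := s) (τ := 2 * s / q) (p := p)
    (p' := p.conjExponent) hC hφ hψ hb hσ0 hσ hconj hs0
    (by rw [le_div_iff₀ hq0]; nlinarith) (by rw [hq]; field_simp; rfl) hτ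
    (by
      rw [div_le_iff₀ (by positivity)]
      calc G_B ≤ G := hGB
        _ = s * (m * (G / (m * s))) := by field_simp)
    (by
      rw [div_le_iff₀ (by positivity)]
      calc G_A ≤ 2 * G := hGA
        _ = 2 * s / q * (A.b * (G / (m * s))) := by rw [hqdef]; field_simp)
    hD hfm T 0 hst 0
  have hfp : (fun x => f x ^ p.conjExponent) = f := by
    funext τ
    simp only [hf]
    by_cases h : (fun t : Fin T => τ t) ∈ E
    · simp [h]
    · simp [h, hconj.symm.pos]
  rw [hfp] at hval
  refine ENNReal.le_exp_mul_add_of_le_rpow (Λ := T * (4000 * ((2 * p) ^ 2 * s ^ 2))) hconj hδ ?_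
    (hval.trans (le_of_eq ?_))
  · have h3 : (2 * p) ^ 2 ≤ (k * l / ε) ^ 2 := by gcongr
    have h4 : T * (4000 * ((2 * p) ^ 2 * s ^ 2)) ≤ l := by
      calc T * (4000 * ((2 * p) ^ 2 * s ^ 2)) ≤ T * (4000 * ((k * l / ε) ^ 2 * s ^ 2)) := by gcongr
        _ = l := by rw [hs2, hc]; field_simp
    have h5 : (p - 1) * ε = 2 * l := by rw [hp]; field_simp; ring
    rw [h5]
    linarith
  · congr 1
    rw [ENNReal.ofReal_rpow_of_pos (Real.exp_pos _), ← ENNReal.ofReal_pow (by positivity),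
      ← Real.exp_mul, ← Real.exp_nat_mul]
    congr 2
    ring

end SoteriaFL

/-! ### Smooth functions -/

section Smooth

variable {d : ℕ} {L : ℝ}

lemma IsSmooth.hasGradientAt {g : Vec d → ℝ} (hg : IsSmooth L g) (x : Vec d) :
    HasGradientAt g (gradient g x) x := (hg.1 x).hasGradientAt

lemma IsSmooth.continuous_gradient {g : Vec d → ℝ} (hg : IsSmooth L g) :
    Continuous (gradient g) :=
  (LipschitzWith.of_dist_le_mul (K := L.toNNReal) fun x y => by
    rw [dist_eq_norm, dist_eq_norm]
    exact (hg.2 x y).trans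
      (mul_le_mul_of_nonneg_right (Real.le_coe_toNNReal L) (norm_nonneg _))).continuous

/-- The descent lemma. -/
lemma IsSmooth.le_add_inner_add_sq {g : Vec d → ℝ} (hg : IsSmooth L g) (x v : Vec d) :
    g (x + v) ≤ g x + ⟪gradient g x, v⟫ + L / 2 * ‖v‖ ^ 2 := by
  set h : ℝ → ℝ := fun t => g (x + t • v) - t * ⟪gradient g x, v⟫ - L / 2 * t ^ 2 * ‖v‖ ^ 2
  have hd : ∀ t, HasDerivAt h
      (⟪gradient g (x + t • v), v⟫ - ⟪gradient g x, v⟫ - L * t * ‖v‖ ^ 2) t := by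
    intro t
    have h1 : HasDerivAt (fun t : ℝ => x + t • v) v t := by
      simpa using ((hasDerivAt_id t).smul_const v).const_add x
    have h2 : HasDerivAt (fun t : ℝ => g (x + t • v)) ⟪gradient g (x + t • v), v⟫ t := by
      exact ((hg.hasGradientAt (x + t • v)).hasFDerivAt.comp_hasDerivAt t h1).congr_deriv
        (InnerProductSpace.toDual_apply_apply ..)
    have h3 : HasDerivAt (fun t : ℝ => t * ⟪gradient g x, v⟫) ⟪gradient g x, v⟫ t := by
      simpa using (hasDerivAt_id t).mul_const ⟪gradient g x, v⟫
    have h4 : HasDerivAt (fun t : ℝ => L / 2 * t ^ 2 * ‖v‖ ^ 2) (L * t * ‖v‖ ^ 2) t := by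
      have := ((hasDerivAt_pow 2 t).const_mul (L / 2)).mul_const (‖v‖ ^ 2)
      refine this.congr_deriv ?_
      simp only [Nat.cast_ofNat, Nat.add_one_sub_one, pow_one]
      ring
    exact (h2.sub h3).sub h4
  have hanti : AntitoneOn h (Set.Icc 0 1) := by
    refine antitoneOn_of_deriv_nonpos (convex_Icc 0 1)
      (fun t _ => (hd t).continuousAt.continuousWithinAt)
      (fun t _ => (hd t).differentiableAt.differentiableWithinAt) fun t ht => ?_
    rw [interior_Icc] at ht
    rw [(hd t).deriv, ← inner_sub_left]
    have h5 := real_inner_le_norm (gradient g (x + t • v) - gradient g x) v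
    have h6 := hg.2 (x + t • v) x
    rw [add_sub_cancel_left, norm_smul, Real.norm_of_nonneg ht.1.le] at h6
    have h7 := mul_le_mul_of_nonneg_right h6 (norm_nonneg v)
    nlinarith
  have := hanti (Set.left_mem_Icc.2 zero_le_one) (Set.right_mem_Icc.2 zero_le_one) zero_le_one
  simp only [h, one_smul, zero_smul, add_zero] at this
  linarith

lemma hasGradientAt_average {ι : Type*} [Fintype ι] {g : ι → Vec d → ℝ} (hg : ∀ i, IsSmooth L (g i))
    (a : ℝ) (x : Vec d) :
    HasGradientAt (fun x => a * ∑ i, g i x) (a • ∑ i, gradient (g i) x) x := by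
  have h := (HasFDerivAt.fun_sum (u := Finset.univ)
    fun i _ => ((hg i).hasGradientAt x).hasFDerivAt).const_mul a
  rw [hasGradientAt_iff_hasFDerivAt]
  refine h.congr_fderiv ?_
  rw [map_smul, map_sum]

lemma IsSmooth.average {N : ℕ} (hN : 0 < N) {g : Fin N → Vec d → ℝ}
    (hg : ∀ i, IsSmooth L (g i)) : IsSmooth L fun x => (1 / (N : ℝ)) * ∑ i, g i x := by
  have hN' : (0 : ℝ) < N := by exact_mod_cast hN
  refine ⟨fun x => (hasGradientAt_average hg _ x).differentiableAt, fun x y => ?_⟩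
  rw [(hasGradientAt_average hg _ x).gradient, (hasGradientAt_average hg _ y).gradient,
    ← smul_sub, ← Finset.sum_sub_distrib, norm_smul, Real.norm_of_nonneg (by positivity)]
  calc (1 / (N : ℝ)) * ‖∑ i, (gradient (g i) x - gradient (g i) y)‖
      ≤ (1 / (N : ℝ)) * ∑ _i : Fin N, L * ‖x - y‖ := by
        gcongr
        exact (norm_sum_le _ _).trans (Finset.sum_le_sum fun i _ => (hg i).2 x y)
    _ = L * ‖x - y‖ := by
        rw [Finset.sum_const, Finset.card_univ, Fintype.card_fin, nsmul_eq_mul]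
        field_simp

lemma IsSmooth.localLoss {𝒟 : Type*} {m : ℕ} (hm : 0 < m) {ℓ : 𝒟 → Vec d → ℝ} {Di : Fin m → 𝒟}
    (h : ∀ j, IsSmooth L (ℓ (Di j))) : IsSmooth L (localLoss ℓ Di) := IsSmooth.average hm h

lemma IsSmooth.globalLoss {𝒟 : Type*} {n m : ℕ} (hn : 0 < n) {ℓ : 𝒟 → Vec d → ℝ}
    {D : Fin n → Fin m → 𝒟} (h : ∀ i, IsSmooth L (_root_.localLoss ℓ (D i))) :
    IsSmooth L (globalLoss ℓ D) := IsSmooth.average hn h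

lemma gradient_globalLoss {𝒟 : Type*} {n m : ℕ} {ℓ : 𝒟 → Vec d → ℝ}
    {D : Fin n → Fin m → 𝒟} (h : ∀ i, IsSmooth L (localLoss ℓ (D i))) (x : Vec d) :
    gradient (globalLoss ℓ D) x = (1 / (n : ℝ)) • ∑ i, gradient (localLoss ℓ (D i)) x :=
  (hasGradientAt_average h _ x).gradient

end Smooth

/-! ### Second moments, compression and noise -/

section SecondMoments

variable {d : ℕ} {α : Type*} [MeasurableSpace α] {P : Measure α}

lemma MeasureTheory.MemLp.integrable_norm_sq {X : α → Vec d} (hX : MemLp X 2 P) :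
    Integrable (fun a => ‖X a‖ ^ 2) P := hX.integrable_norm_pow (by norm_num)

lemma memLp_two_of_integrable_norm_sq {X : α → Vec d} (hX : AEStronglyMeasurable X P)
    (h : Integrable (fun a => ‖X a‖ ^ 2) P) : MemLp X 2 P :=
  (memLp_two_iff_integrable_sq_norm hX).2 h

variable [IsProbabilityMeasure P]

/-- Bias-variance decomposition. -/
lemma integral_norm_sub_sq {X : α → Vec d} (hX : MemLp X 2 P) (a : Vec d) :
    ∫ x, ‖X x - a‖ ^ 2 ∂P = ∫ x, ‖X x - ∫ y, X y ∂P‖ ^ 2 ∂P + ‖(∫ y, X y ∂P) - a‖ ^ 2 := by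
  set h := ∫ y, X y ∂P
  have hi : Integrable X P := hX.integrable (by norm_num)
  have hs : MemLp (fun x => X x - h) 2 P := hX.sub (memLp_const h)
  have hin : Integrable (fun x => ⟪X x - h, h - a⟫) P :=
    (hi.sub (integrable_const h)).inner_const _
  have h1 : ∀ x, ‖X x - a‖ ^ 2 = ‖X x - h‖ ^ 2 + 2 * ⟪X x - h, h - a⟫ + ‖h - a‖ ^ 2 := by
    intro x
    rw [← norm_add_sq_real]
    congr 2
    abel
  have hsum : Integrable (fun x => ‖X x - h‖ ^ 2 + 2 * ⟪X x - h, h - a⟫) P :=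
    hs.integrable_norm_sq.add (hin.const_mul 2)
  simp_rw [h1]
  rw [integral_add hsum (integrable_const _),
    integral_add hs.integrable_norm_sq (hin.const_mul 2), integral_const_mul]
  have h2 : ∫ x, ⟪X x - h, h - a⟫ ∂P = 0 := by
    have := integral_inner (𝕜 := ℝ) (hi.sub (integrable_const h)) (h - a)
    simp_rw [real_inner_comm (h - a)] at this ⊢
    simp only [Pi.sub_apply] at this
    rw [this, integral_sub hi (integrable_const h)]
    simp [h]
  rw [h2]
  simp

lemma integral_norm_sq {X : α → Vec d} (hX : MemLp X 2 P) :
    ∫ x, ‖X x‖ ^ 2 ∂P = ∫ x, ‖X x - ∫ y, X y ∂P‖ ^ 2 ∂P + ‖∫ y, X y ∂P‖ ^ 2 := by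
  simpa using integral_norm_sub_sq hX 0

lemma integral_norm_add_sq_of_mean_zero {X : α → Vec d} (hX : MemLp X 2 P)
    (h0 : ∫ x, X x ∂P = 0) (a : Vec d) :
    ∫ x, ‖a + X x‖ ^ 2 ∂P = ‖a‖ ^ 2 + ∫ x, ‖X x‖ ^ 2 ∂P := by
  have h := integral_norm_sub_sq hX (-a)
  rw [h0] at h
  simp only [sub_neg_eq_add, sub_zero, zero_add] at h
  simp_rw [add_comm a]
  linarith

end SecondMoments

section Compression

variable {d : ℕ} {α : Type*} [MeasurableSpace α] {P : Measure α}

lemma IsCompression.integral_norm_sq_le {S : Type*} [MeasurableSpace S] {ρ : Measure S}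
    [IsProbabilityMeasure ρ] {ω : ℝ} {C : S → Vec d → Vec d} (hC : IsCompression ω ρ C)
    (x : Vec d) : ∫ s, ‖C s x‖ ^ 2 ∂ρ ≤ (1 + ω) * ‖x‖ ^ 2 := by
  rw [integral_norm_sq (hC.memLp x), hC.mean x]
  linarith [hC.variance x]

lemma IsCompression.memLp_prod {S : Type*} [MeasurableSpace S] {ρ : Measure S}
    [IsProbabilityMeasure ρ] {ω : ℝ} {C : S → Vec d → Vec d} (hC : IsCompression ω ρ C)
    {Y : α → Vec d} (hYm : Measurable Y) (hY : MemLp Y 2 P) :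
    MemLp (fun p : α × S => C p.2 (Y p.1)) 2 (P.prod ρ) := by
  have hm : Measurable fun p : α × S => C p.2 (Y p.1) :=
    hC.measurable.comp (f := fun p : α × S => (p.2, Y p.1)) (by fun_prop)
  refine memLp_two_of_integrable_norm_sq hm.aestronglyMeasurable ?_
  rw [integrable_prod_iff (hm.norm.pow_const 2).aestronglyMeasurable]
  refine ⟨ae_of_all _ fun a => (hC.memLp (Y a)).integrable_norm_sq, ?_⟩
  refine (hY.integrable_norm_sq.const_mul (1 + ω)).mono'
    ((hm.norm.pow_const 2).norm.stronglyMeasurable.integral_prod_right').aestronglyMeasurable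
    (ae_of_all _ fun a => ?_)
  simp only [norm_pow, norm_norm]
  rw [Real.norm_of_nonneg (integral_nonneg fun s => by positivity)]
  exact hC.integral_norm_sq_le (Y a)

lemma IsCompression.integral_prod {S : Type*} [MeasurableSpace S] {ρ : Measure S}
    [IsProbabilityMeasure ρ] {ω : ℝ} {C : S → Vec d → Vec d} (hC : IsCompression ω ρ C)
    [IsProbabilityMeasure P] {Y : α → Vec d} (hYm : Measurable Y) (hY : MemLp Y 2 P) :
    ∫ p, C p.2 (Y p.1) ∂P.prod ρ = ∫ a, Y a ∂P := by
  rw [MeasureTheory.integral_prod _ ((hC.memLp_prod hYm hY).integrable (by norm_num))]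
  simp only [hC.mean]

/-- Compression of a random vector with mean `h`: the variance grows by the factor `1 + ω`, and the
squared mean contributes `ω ‖h‖²`. -/
lemma IsCompression.integral_norm_sub_sq_prod_le {S : Type*} [MeasurableSpace S] {ρ : Measure S}
    [IsProbabilityMeasure ρ] {ω : ℝ} {C : S → Vec d → Vec d} (hC : IsCompression ω ρ C)
    [IsProbabilityMeasure P] {Y : α → Vec d} (hYm : Measurable Y) (hY : MemLp Y 2 P) {h : Vec d} (hh : ∫ a, Y a ∂P = h) :
    ∫ p, ‖C p.2 (Y p.1) - h‖ ^ 2 ∂P.prod ρ ≤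
      ω * ‖h‖ ^ 2 + (1 + ω) * ∫ a, ‖Y a - h‖ ^ 2 ∂P := by
  have h1 : MemLp (fun p : α × S => C p.2 (Y p.1) - h) 2 (P.prod ρ) :=
    (hC.memLp_prod hYm hY).sub (memLp_const h)
  have h2 : MemLp (fun a => Y a - h) 2 P := hY.sub (memLp_const h)
  rw [MeasureTheory.integral_prod _ h1.integrable_norm_sq]
  have h3 : ∀ a, ∫ s, ‖C s (Y a) - h‖ ^ 2 ∂ρ ≤ ω * ‖Y a‖ ^ 2 + ‖Y a - h‖ ^ 2 := by
    intro a
    rw [integral_norm_sub_sq (hC.memLp (Y a)), hC.mean]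
    linarith [hC.variance (Y a)]
  have h4 : Integrable (fun a => ω * ‖Y a‖ ^ 2 + ‖Y a - h‖ ^ 2) P :=
    (hY.integrable_norm_sq.const_mul ω).add h2.integrable_norm_sq
  refine (integral_mono (h1.integrable_norm_sq.integral_prod_left) h4 h3).trans (le_of_eq ?_)
  rw [integral_add (hY.integrable_norm_sq.const_mul ω) h2.integrable_norm_sq, integral_const_mul,
    integral_norm_sq hY, hh]
  ring

end Compression

section GaussianMoments

variable {d : ℕ}

lemma memLp_id_stdGaussian : MemLp (fun z : Vec d => z) 2 (stdGaussian (Vec d)) :=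
  IsGaussian.memLp_two_id

lemma integral_norm_sq_stdGaussian : ∫ z, ‖z‖ ^ 2 ∂stdGaussian (Vec d) = d := by
  have h1 : ∀ i, ∫ z : Vec d, (z i) ^ 2 ∂stdGaussian (Vec d) = 1 := by
    intro i
    have h2 := variance_dual_stdGaussian (E := Vec d) (innerSL ℝ (EuclideanSpace.single i (1 : ℝ)))
    rw [variance_of_integral_eq_zero (by fun_prop) (integral_strongDual_stdGaussian _)] at h2
    simpa [EuclideanSpace.inner_single_left] using h2
  have h3 : ∀ i, Integrable (fun z : Vec d => (z i) ^ 2) (stdGaussian (Vec d)) := fun i =>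
    not_imp_comm.1 integral_undef (by rw [h1 i]; norm_num)
  simp_rw [EuclideanSpace.norm_sq_eq, Real.norm_eq_abs, sq_abs]
  rw [integral_finsetSum _ fun i _ => h3 i]
  simp [h1]

end GaussianMoments

namespace SoteriaFL

variable {n m d : ℕ} {𝒟 : Type u₁} {U : Type u₂} {V : Type u₃} {W : Type u₄} {S : Type u₅}
  [MeasurableSpace U] [MeasurableSpace V] [MeasurableSpace W] [MeasurableSpace S]
  (A : SoteriaFL n m d 𝒟 U V W S)

lemma memLp_id_noiseLaw : MemLp (fun ξ : Vec d => ξ) 2 A.noiseLaw := by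
  rw [noiseLaw, memLp_map_measure_iff (by fun_prop) (by fun_prop)]
  exact memLp_id_stdGaussian.const_smul (Real.sqrt A.varP)

lemma integral_id_noiseLaw : ∫ ξ, ξ ∂A.noiseLaw = 0 := by
  rw [noiseLaw, integral_map (by fun_prop) (by fun_prop), integral_smul, integral_id_stdGaussian,
    smul_zero]

lemma integral_norm_sq_noiseLaw (h : 0 ≤ A.varP) : ∫ ξ, ‖ξ‖ ^ 2 ∂A.noiseLaw = d * A.varP := by
  rw [noiseLaw, integral_map (by fun_prop) (by fun_prop)]
  simp_rw [norm_smul, mul_pow]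
  rw [integral_const_mul, integral_norm_sq_stdGaussian, Real.norm_of_nonneg (Real.sqrt_nonneg _),
    Real.sq_sqrt h, mul_comm]

end SoteriaFL

/-! ### One client in one round -/

lemma MeasureTheory.MeasurePreserving.integral_comp_of_aestronglyMeasurable {α β G : Type*}
    [MeasurableSpace α] [MeasurableSpace β] [NormedAddCommGroup G] [NormedSpace ℝ G]
    {μ : Measure α} {ν : Measure β} {f : α → β} (hf : MeasurePreserving f μ ν) {g : β → G}
    (hg : AEStronglyMeasurable g ν) : ∫ a, g (f a) ∂μ = ∫ b, g b ∂ν := by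
  rw [← hf.map_eq, integral_map hf.measurable.aemeasurable (by rwa [hf.map_eq])]

/-- The second moment of a sum of independent centered random vectors is the sum of the second
moments. -/
lemma integral_norm_sum_sq_of_indep {d : ℕ} {ι Ω : Type*} [Fintype ι] [MeasurableSpace Ω]
    {P : Measure Ω} {X : ι → Ω → Vec d} (hX : ∀ i, MemLp (X i) 2 P) (hind : iIndepFun X P)
    (h0 : ∀ i, ∫ a, X i a ∂P = 0) :
    ∫ a, ‖∑ i, X i a‖ ^ 2 ∂P = ∑ i, ∫ a, ‖X i a‖ ^ 2 ∂P := by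
  classical
  have := hind.isProbabilityMeasure
  have hint : ∀ i j, Integrable (fun a => ⟪X i a, X j a⟫) P := fun i j =>
    memLp_one_iff_integrable.1 ((hX i).of_bilin (r := 1) (fun x y => ⟪x, y⟫) 1 (hX j)
      ((hX i).aestronglyMeasurable.inner (hX j).aestronglyMeasurable)
      (ae_of_all _ fun a => by simpa using nnnorm_inner_le_nnnorm (X i a) (X j a)))
  have h1 : ∀ a, ‖∑ i, X i a‖ ^ 2 = ∑ i, ∑ j, ⟪X i a, X j a⟫ := fun a => by
    rw [← real_inner_self_eq_norm_sq, sum_inner]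
    simp_rw [inner_sum]
  simp_rw [h1]
  rw [integral_finsetSum _ fun i _ => integrable_finsetSum _ fun j _ => hint i j]
  refine Finset.sum_congr rfl fun i _ => ?_
  rw [integral_finsetSum _ fun j _ => hint i j, Finset.sum_eq_single i]
  · simp_rw [real_inner_self_eq_norm_sq]
  · intro j _ hj
    have h2 := (hind.indepFun hj.symm).integral_bilin ((hX i).integrable (by norm_num))
      ((hX j).integrable (by norm_num)) (innerSL ℝ)
    simp only [h0, map_zero] at h2
    exact h2
  · simp

namespace SoteriaFL

variable {n m d : ℕ} {𝒟 : Type u₁} {U : Type u₂} {V : Type u₃} {W : Type u₄} {S : Type u₅}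
  [MeasurableSpace U] [MeasurableSpace V] [MeasurableSpace W] [MeasurableSpace S]
  {A : SoteriaFL n m d 𝒟 U V W S}

section Client

variable {t : ℕ} {i : Fin n} {Di : Fin m → 𝒟} {st : State n m d U} {ω G_A G_B : ℝ}

lemma norm_estimate_le (hφ : ∀ t i j z u p w, ‖A.est.φ t i j z u p w‖ ≤ G_A)
    (hψ : ∀ t i j z u p w, ‖A.est.ψ t i j z u p w‖ ≤ G_B) (hA : 0 ≤ G_A)
    (c : ClientSeed m d W S) :
    ‖A.estimate t i Di st c‖ ≤ 1 / (A.b : ℝ) * (m * G_A) + 1 / (m : ℝ) * (m * G_B) := by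
  rw [estimate_eq_sum_ite]
  refine (norm_add_le _ _).trans (add_le_add ?_ ?_)
  · rw [norm_smul, Real.norm_of_nonneg (by positivity)]
    gcongr
    refine (norm_sum_le_of_le (n := fun _ => G_A) _ fun j _ => ?_).trans (by simp)
    split_ifs
    · exact hφ ..
    · simpa using hA
  · rw [norm_smul, Real.norm_of_nonneg (by positivity)]
    gcongr
    exact (norm_sum_le_of_le (n := fun _ => G_B) _ fun j _ => hψ ..).trans (by simp)

variable (A t i Di st) in
lemma measurable_estimate_right : Measurable (A.estimate t i Di st) :=
  (A.measurable_estimate t i Di).comp (f := fun c : ClientSeed m d W S => (st, c)) (by fun_prop)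

lemma measurable_message_right (hC : ∀ t i, Measurable (Function.uncurry (A.comp t i))) :
    Measurable (A.message t i Di st) :=
  (measurable_message hC t i Di).comp (f := fun c : ClientSeed m d W S => (st, c)) (by fun_prop)

lemma memLp_estimate (hφ : ∀ t i j z u p w, ‖A.est.φ t i j z u p w‖ ≤ G_A)
    (hψ : ∀ t i j z u p w, ‖A.est.ψ t i j z u p w‖ ≤ G_B) (hA : 0 ≤ G_A)
    (P : Measure (ClientSeed m d W S)) [IsProbabilityMeasure P] :
    MemLp (A.estimate t i Di st) 2 P :=
  MemLp.of_bound (A.measurable_estimate_right t i Di st).aestronglyMeasurable _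
    (ae_of_all _ (norm_estimate_le hφ hψ hA))

/-- The seed of a client splits into the part that drives its input to the compression operator
and the randomness of the compression. -/
lemma measurePreserving_splitSeed (t : ℕ) (i : Fin n) :
    MeasurePreserving (fun c : ClientSeed m d W S => (((c.1, c.2.1), c.2.2.1), c.2.2.2))
      (A.clientLaw t i) ((((A.est.localLaw t i : Measure W).prod A.batchLaw).prod
        A.noiseLaw).prod (A.compLaw t i : Measure S)) :=
  ((measurePreserving_prodAssoc ((A.est.localLaw t i : Measure W).prod A.batchLaw) A.noiseLaw
      (A.compLaw t i : Measure S)).symm).comp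
    ((measurePreserving_prodAssoc (A.est.localLaw t i : Measure W) A.batchLaw
      (A.noiseLaw.prod (A.compLaw t i : Measure S))).symm)

/-- First and second moments of a message: it is unbiased for `𝔼 g̃_i - s_i`, and the compression
multiplies the variance of the perturbed estimator by at most `1 + ω` and adds `ω` times the
squared norm of the mean. -/
lemma message_moments (hC : IsCompression ω (A.compLaw t i : Measure S) (A.comp t i))
    (hφ : ∀ t i j z u p w, ‖A.est.φ t i j z u p w‖ ≤ G_A)
    (hψ : ∀ t i j z u p w, ‖A.est.ψ t i j z u p w‖ ≤ G_B) (hA : 0 ≤ G_A) (hv : 0 ≤ A.varP)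
    {g : Vec d} (hg : ∫ c, A.estimate t i Di st c ∂A.clientLaw t i = g) :
    MemLp (A.message t i Di st) 2 (A.clientLaw t i) ∧
    ∫ c, A.message t i Di st c ∂A.clientLaw t i = g - st.1.2.1 i ∧
    ∫ c, ‖A.message t i Di st c - (g - st.1.2.1 i)‖ ^ 2 ∂A.clientLaw t i ≤
      ω * ‖g - st.1.2.1 i‖ ^ 2 +
        (1 + ω) * (∫ c, ‖A.estimate t i Di st c - g‖ ^ 2 ∂A.clientLaw t i + d * A.varP) := by
  obtain ⟨s₀⟩ : Nonempty S := nonempty_of_isProbabilityMeasure (A.compLaw t i : Measure S)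
  set P₀ := (A.est.localLaw t i : Measure W).prod A.batchLaw
  have hsplit := A.measurePreserving_splitSeed t i
  have hsplit₁ : MeasurePreserving (fun c : ClientSeed m d W S => (c.1, c.2.1))
      (A.clientLaw t i) P₀ := measurePreserving_fst.comp (measurePreserving_fst.comp hsplit)
  -- The estimator ignores the Gaussian and the compression components of the seed.
  set e : W × (Fin m → Bool) → Vec d := fun q => A.estimate t i Di st (q.1, q.2, 0, s₀)
  have he : ∀ c : ClientSeed m d W S, A.estimate t i Di st c = e (c.1, c.2.1) := fun c => rfl
  have hem : Measurable e := (A.measurable_estimate_right t i Di st).comp (by fun_prop)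
  have heL : MemLp e 2 P₀ := MemLp.of_bound hem.aestronglyMeasurable _
    (ae_of_all _ fun q => norm_estimate_le hφ hψ hA _)
  have heg : ∫ q, e q ∂P₀ = g := by
    rw [← hg, ← hsplit₁.integral_comp_of_aestronglyMeasurable hem.aestronglyMeasurable]
    rfl
  set Y : (W × (Fin m → Bool)) × Vec d → Vec d := fun p => e p.1 + p.2 - st.1.2.1 i
  have hYm : Measurable Y := by fun_prop
  have hfst : MeasurePreserving Prod.fst (P₀.prod A.noiseLaw) P₀ := measurePreserving_fst
  have hsnd : MeasurePreserving Prod.snd (P₀.prod A.noiseLaw) A.noiseLaw := measurePreserving_snd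
  have he1 : MemLp (fun p : (W × (Fin m → Bool)) × Vec d => e p.1) 2 (P₀.prod A.noiseLaw) :=
    heL.comp_measurePreserving hfst
  have hξ1 : MemLp (fun p : (W × (Fin m → Bool)) × Vec d => p.2) 2 (P₀.prod A.noiseLaw) :=
    A.memLp_id_noiseLaw.comp_measurePreserving hsnd
  have hY : MemLp Y 2 (P₀.prod A.noiseLaw) := (he1.add hξ1).sub (memLp_const _)
  have hYint : ∫ p, Y p ∂P₀.prod A.noiseLaw = g - st.1.2.1 i := by
    have h1 : ∫ p, e p.1 ∂P₀.prod A.noiseLaw = g := by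
      rw [hfst.integral_comp_of_aestronglyMeasurable hem.aestronglyMeasurable, heg]
    have h2 : ∫ p : (W × (Fin m → Bool)) × Vec d, p.2 ∂P₀.prod A.noiseLaw = 0 := by
      rw [hsnd.integral_comp_of_aestronglyMeasurable (g := fun ξ : Vec d => ξ) (by fun_prop),
        A.integral_id_noiseLaw]
    have hi1 : Integrable (fun p : (W × (Fin m → Bool)) × Vec d => e p.1) (P₀.prod A.noiseLaw) :=
      he1.integrable (by norm_num)
    have hi2 : Integrable (fun p : (W × (Fin m → Bool)) × Vec d => p.2) (P₀.prod A.noiseLaw) :=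
      hξ1.integrable (by norm_num)
    have hi3 : Integrable (fun p : (W × (Fin m → Bool)) × Vec d => e p.1 + p.2)
      (P₀.prod A.noiseLaw) := hi1.add hi2
    simp only [Y]
    rw [integral_sub hi3 (integrable_const _), integral_add hi1 hi2, h1, h2]
    simp
  have hYvar : ∫ p, ‖Y p - (g - st.1.2.1 i)‖ ^ 2 ∂P₀.prod A.noiseLaw =
      ∫ c, ‖A.estimate t i Di st c - g‖ ^ 2 ∂A.clientLaw t i + d * A.varP := by
    have h1 : ∀ p, Y p - (g - st.1.2.1 i) = (e p.1 - g) + p.2 := fun p => by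
      simp only [Y]; abel
    have hL : MemLp (fun p : (W × (Fin m → Bool)) × Vec d => (e p.1 - g) + p.2) 2
      (P₀.prod A.noiseLaw) := (he1.sub (memLp_const g)).add hξ1
    have hLe : MemLp (fun q => e q - g) 2 P₀ := heL.sub (memLp_const g)
    simp_rw [h1]
    rw [integral_prod _ hL.integrable_norm_sq]
    simp_rw [integral_norm_add_sq_of_mean_zero A.memLp_id_noiseLaw A.integral_id_noiseLaw,
      A.integral_norm_sq_noiseLaw hv]
    rw [integral_add hLe.integrable_norm_sq (integrable_const _),
      ← hsplit₁.integral_comp_of_aestronglyMeasurable (g := fun q => ‖e q - g‖ ^ 2)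
        hLe.integrable_norm_sq.aestronglyMeasurable]
    simp [he]
  have hL := hC.memLp_prod hYm hY
  refine ⟨hL.comp_measurePreserving hsplit, ?_, ?_⟩
  · have h1 := hsplit.integral_comp_of_aestronglyMeasurable hL.aestronglyMeasurable
    rw [hC.integral_prod hYm hY, hYint] at h1
    exact h1
  · have h1 := hsplit.integral_comp_of_aestronglyMeasurable
      (g := fun p => ‖A.comp t i p.2 (Y p.1) - (g - st.1.2.1 i)‖ ^ 2)
      ((hL.sub (memLp_const _)).aestronglyMeasurable.norm.pow 2)
    have h2 := hC.integral_norm_sub_sq_prod_le hYm hY hYint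
    rw [hYvar, ← h1] at h2
    exact h2

/-- A crude bound on the second moment of a message, used for integrability only. -/
lemma integral_norm_message_sq_le (hω : 0 ≤ ω)
    (hC : IsCompression ω (A.compLaw t i : Measure S) (A.comp t i))
    (hφ : ∀ t i j z u p w, ‖A.est.φ t i j z u p w‖ ≤ G_A)
    (hψ : ∀ t i j z u p w, ‖A.est.ψ t i j z u p w‖ ≤ G_B) (hA : 0 ≤ G_A) (hv : 0 ≤ A.varP)
    {G : ℝ} (hG : G = 1 / (A.b : ℝ) * (m * G_A) + 1 / (m : ℝ) * (m * G_B)) :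
    ∫ c, ‖A.message t i Di st c‖ ^ 2 ∂A.clientLaw t i ≤
      (1 + ω) * (2 * G ^ 2 + 2 * ‖st.1.2.1 i‖ ^ 2 + (4 * G ^ 2 + d * A.varP)) := by
  set g := ∫ c, A.estimate t i Di st c ∂A.clientLaw t i with hg
  have hb : ∀ c, ‖A.estimate t i Di st c‖ ≤ G := hG ▸ norm_estimate_le hφ hψ hA
  have hgG : ‖g‖ ≤ G := by
    simpa using norm_integral_le_of_norm_le_const (μ := A.clientLaw t i) (ae_of_all _ hb)
  obtain ⟨h1, h2, h3⟩ := message_moments hC hφ hψ hA hv (hg.symm)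
  rw [integral_norm_sq h1, h2]
  have h4 : ∫ c, ‖A.estimate t i Di st c - g‖ ^ 2 ∂A.clientLaw t i ≤ 4 * G ^ 2 := by
    have h5 : ∀ c, ‖A.estimate t i Di st c - g‖ ^ 2 ≤ 4 * G ^ 2 := fun c => by
      have h6 := norm_sub_le (A.estimate t i Di st c) g
      have h7 := hb c
      nlinarith [norm_nonneg (A.estimate t i Di st c - g)]
    have h8 : MemLp (fun c => A.estimate t i Di st c - g) 2 (A.clientLaw t i) :=
      (memLp_estimate hφ hψ hA _).sub (memLp_const g)
    simpa using integral_mono h8.integrable_norm_sq (integrable_const _) h5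
  have h5 : ‖g - st.1.2.1 i‖ ^ 2 ≤ 2 * G ^ 2 + 2 * ‖st.1.2.1 i‖ ^ 2 := by
    have h6 := norm_sub_le g (st.1.2.1 i)
    nlinarith [norm_nonneg (g - st.1.2.1 i), norm_nonneg (st.1.2.1 i), norm_nonneg g,
      sq_nonneg (G - ‖st.1.2.1 i‖)]
  have h6 := mul_le_mul_of_nonneg_left h4 (by linarith : (0:ℝ) ≤ 1 + ω)
  have h7 := mul_le_mul_of_nonneg_left h5 (by linarith : (0:ℝ) ≤ 1 + ω)
  linarith

end Client

end SoteriaFL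

/-! ### One round from a fixed state -/

section Auxiliary

variable {d : ℕ} {α : Type*} [MeasurableSpace α] {P : Measure α} {L : ℝ}

/-- A smooth function that is bounded below grows at most quadratically, so it is integrable
along square-integrable random vectors. -/
lemma IsSmooth.integrable_comp [IsProbabilityMeasure P] {g : Vec d → ℝ} (hg : IsSmooth L g)
    {B : ℝ} (hB : ∀ x, B ≤ g x) {X : α → Vec d} (hX : MemLp X 2 P) :
    Integrable (fun a => g (X a)) P := by
  have h1 : Integrable (fun a => |B| + |g 0| + ‖gradient g 0‖ * ‖X a‖ + |L| / 2 * ‖X a‖ ^ 2) P :=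
    ((integrable_const _).add ((hX.integrable (by norm_num)).norm.const_mul _)).add
      (hX.integrable_norm_sq.const_mul _)
  refine h1.mono' (hg.1.continuous.comp_aestronglyMeasurable hX.aestronglyMeasurable)
    (ae_of_all _ fun a => ?_)
  have h2 := hg.le_add_inner_add_sq 0 (X a)
  rw [zero_add] at h2
  have h3 := real_inner_le_norm (gradient g 0) (X a)
  have h4 : L / 2 * ‖X a‖ ^ 2 ≤ |L| / 2 * ‖X a‖ ^ 2 := by gcongr; exact le_abs_self L
  have h5 : 0 ≤ ‖gradient g 0‖ * ‖X a‖ := by positivity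
  have h6 : 0 ≤ |L| / 2 * ‖X a‖ ^ 2 := by positivity
  rw [Real.norm_eq_abs, abs_le]
  constructor
  · linarith [hB (X a), neg_abs_le B, abs_nonneg (g 0)]
  · linarith [le_abs_self (g 0), abs_nonneg B]

lemma IsSmooth.memLp_gradient_comp [IsProbabilityMeasure P] {g : Vec d → ℝ} (hg : IsSmooth L g)
    {X : α → Vec d} (hX : MemLp X 2 P) : MemLp (fun a => gradient g (X a)) 2 P := by
  have h1 : MemLp (fun a => gradient g (X a) - gradient g 0) 2 P := by
    refine hX.of_le_mul (c := L) ((hg.continuous_gradient.comp_aestronglyMeasurable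
      hX.aestronglyMeasurable).sub aestronglyMeasurable_const) (ae_of_all _ fun a => ?_)
    simpa using hg.2 (X a) 0
  have h2 := h1.add (memLp_const (gradient g 0))
  exact h2.congr_norm (hg.continuous_gradient.comp_aestronglyMeasurable hX.aestronglyMeasurable)
    (ae_of_all _ fun a => by simp)

lemma MeasureTheory.MemLp.of_sub_const [IsProbabilityMeasure P] {X : α → Vec d} {x : Vec d}
    (h : MemLp (fun a => X a - x) 2 P) : MemLp X 2 P :=
  (memLp_congr_ae (ae_of_all _ fun a => by simp)).1 (h.add (memLp_const x))

lemma norm_add_sq_le_mul_add_mul {y : ℝ} (hy : 1 < y) (a b : Vec d) :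
    ‖a + b‖ ^ 2 ≤ y * ‖a‖ ^ 2 + y / (y - 1) * ‖b‖ ^ 2 := by
  have h1 : ‖a + b‖ ^ 2 ≤ (‖a‖ + ‖b‖) ^ 2 := by gcongr; exact norm_add_le a b
  refine h1.trans ?_
  have hy' : 0 < y - 1 := sub_pos.2 hy
  have h2 : y * ‖a‖ ^ 2 + y / (y - 1) * ‖b‖ ^ 2 - (‖a‖ + ‖b‖) ^ 2 =
      ((y - 1) * ‖a‖ - ‖b‖) ^ 2 / (y - 1) := by
    field_simp
    ring
  have h3 : 0 ≤ ((y - 1) * ‖a‖ - ‖b‖) ^ 2 / (y - 1) := by positivity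
  linarith

/-- The shift stepsize `γ` makes the references contract by the factor `1 - 1/(2(1+ω))` after an
application of Young's inequality with weight `2(1+ω)`. -/
lemma shift_stepsize {ω γ : ℝ} (hω : 0 ≤ ω)
    (hγ : γ = Real.sqrt ((1 + 2 * ω) / (2 * (1 + ω) ^ 3))) :
    2 * (1 + ω) / (2 * (1 + ω) - 1) * ((1 - γ) ^ 2 + γ ^ 2 * ω) ≤ 1 - 1 / (2 * (1 + ω)) ∧
      2 * (1 + ω) / (2 * (1 + ω) - 1) * (γ ^ 2 * (1 + ω)) = 1 / (1 + ω) := by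
  obtain ⟨x, rfl⟩ : ∃ x, ω = x - 1 := ⟨ω + 1, by ring⟩
  have hx : 1 ≤ x := by linarith
  have hx0 : 0 < x := by linarith
  have h2x : 0 < 2 * x - 1 := by linarith
  have hγ0 : 0 ≤ γ := hγ ▸ Real.sqrt_nonneg _
  have hγ2 : γ ^ 2 = (2 * x - 1) / (2 * x ^ 3) := by
    rw [hγ, Real.sq_sqrt (by rw [add_sub_cancel]; apply div_nonneg <;> [linarith; positivity])]
    congr 1 <;> ring
  rw [show 1 + (x - 1) = x by ring]
  set r := γ * x with hr
  have hr2 : r ^ 2 = 1 - 1 / (2 * x) := by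
    rw [hr, mul_pow, hγ2]; field_simp
  have hr0 : 0 ≤ r := by positivity
  have hinv : 1 / (2 * x) ≤ 1 / 2 := by
    apply one_div_le_one_div_of_le <;> linarith
  have hinv0 : 0 < 1 / (2 * x) := by positivity
  have hr1 : r ≤ 1 := by nlinarith
  have hr3 : 1 / 3 ≤ r := by nlinarith
  have hγr : γ = r * (2 * (1 - r ^ 2)) := by
    rw [hr2, hr]; field_simp; ring
  have hfac : 2 * x / (2 * x - 1) * r ^ 2 = 1 := by rw [hr2]; field_simp
  have hfac0 : 0 ≤ 2 * x / (2 * x - 1) := by positivity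
  refine ⟨?_, ?_⟩
  · have h1 : (1 - γ) ^ 2 + γ ^ 2 * (x - 1) ≤ r ^ 2 * r ^ 2 := by
      have h2 : (1 - γ) ^ 2 + γ ^ 2 * (x - 1) = 1 - 2 * γ + γ * r := by rw [hr]; ring
      have h3 : 0 ≤ (1 - r ^ 2) * ((3 * r - 1) * (1 - r)) := by
        apply mul_nonneg
        · nlinarith
        · apply mul_nonneg <;> linarith
      rw [h2, hγr]
      nlinarith
    calc 2 * x / (2 * x - 1) * ((1 - γ) ^ 2 + γ ^ 2 * (x - 1))
        ≤ 2 * x / (2 * x - 1) * (r ^ 2 * r ^ 2) := mul_le_mul_of_nonneg_left h1 hfac0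
      _ = 1 - 1 / (2 * x) := by rw [← mul_assoc, hfac, one_mul, hr2]
  · rw [hγ2]; field_simp

/-- One update `s + γ v` of a reference, with `v` unbiased for `∇g(x) - s`, contracts the distance
to the gradient, up to the variance of `v` and the motion from `x` to `X`. -/
lemma integral_norm_gradient_sub_shift_sq_le [IsProbabilityMeasure P] {ω γ E : ℝ} (hω : 0 ≤ ω)
    (hγ : γ = Real.sqrt ((1 + 2 * ω) / (2 * (1 + ω) ^ 3))) {g : Vec d → ℝ} (hg : IsSmooth L g)
    {x s : Vec d} {X v : α → Vec d} (hX : MemLp (fun a => X a - x) 2 P) (hv : MemLp v 2 P)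
    (hmean : ∫ a, v a ∂P = gradient g x - s)
    (hvar : ∫ a, ‖v a - (gradient g x - s)‖ ^ 2 ∂P ≤
      ω * ‖gradient g x - s‖ ^ 2 + (1 + ω) * E) :
    ∫ a, ‖gradient g (X a) - (s + γ • v a)‖ ^ 2 ∂P ≤
      (1 - 1 / (2 * (1 + ω))) * ‖gradient g x - s‖ ^ 2 + 1 / (1 + ω) * E +
        2 * (1 + ω) * L ^ 2 * ∫ a, ‖X a - x‖ ^ 2 ∂P := by
  obtain ⟨hγ1, hγ2⟩ := shift_stepsize hω hγ
  set y := 2 * (1 + ω)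
  have hy : 1 < y := by simp only [y]; linarith
  set c := gradient g x - s with hc
  set R : α → Vec d := fun a => (1 - γ) • c + (-γ) • (v a - c)
  have hvc : MemLp (fun a => v a - c) 2 P := hv.sub (memLp_const c)
  have hRm : MemLp (fun a => (-γ) • (v a - c)) 2 P := hvc.const_smul (-γ)
  have hR : MemLp R 2 P := (memLp_const ((1 - γ) • c)).add hRm
  have hRint : ∫ a, ‖R a‖ ^ 2 ∂P ≤
      ((1 - γ) ^ 2 + γ ^ 2 * ω) * ‖c‖ ^ 2 + γ ^ 2 * (1 + ω) * E := by
    have h0 : ∫ a, (-γ) • (v a - c) ∂P = 0 := by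
      rw [integral_smul, integral_sub (hv.integrable (by norm_num))
        (integrable_const _), hmean]
      simp
    have h1 := integral_norm_add_sq_of_mean_zero hRm h0 ((1 - γ) • c)
    simp_rw [norm_smul, mul_pow, Real.norm_eq_abs, sq_abs, neg_sq] at h1
    rw [integral_const_mul] at h1
    have h2 := mul_le_mul_of_nonneg_left hvar (sq_nonneg γ)
    simp only [R]
    rw [h1]
    linarith
  have hpt : ∀ a, ‖gradient g (X a) - (s + γ • v a)‖ ^ 2 ≤
      y * L ^ 2 * ‖X a - x‖ ^ 2 + y / (y - 1) * ‖R a‖ ^ 2 := by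
    intro a
    have h1 : gradient g (X a) - (s + γ • v a) = (gradient g (X a) - gradient g x) + R a := by
      simp only [R, hc]
      module
    rw [h1]
    refine (norm_add_sq_le_mul_add_mul hy _ _).trans ?_
    have h3 : ‖gradient g (X a) - gradient g x‖ ^ 2 ≤ (L * ‖X a - x‖) ^ 2 := by
      gcongr
      exact hg.2 _ _
    rw [mul_pow] at h3
    have h4 := mul_le_mul_of_nonneg_left h3 (by linarith : 0 ≤ y)
    linarith
  have hi1 : Integrable (fun a => y * L ^ 2 * ‖X a - x‖ ^ 2) P :=
    hX.integrable_norm_sq.const_mul _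
  have hi2 : Integrable (fun a => y / (y - 1) * ‖R a‖ ^ 2) P := hR.integrable_norm_sq.const_mul _
  have hi3 : Integrable (fun a => y * L ^ 2 * ‖X a - x‖ ^ 2 + y / (y - 1) * ‖R a‖ ^ 2) P :=
    hi1.add hi2
  have hM : MemLp (fun a => gradient g (X a) - (s + γ • v a)) 2 P :=
    (hg.memLp_gradient_comp hX.of_sub_const).sub ((memLp_const s).add (hv.const_smul γ))
  refine (integral_mono hM.integrable_norm_sq hi3 hpt).trans ?_
  rw [integral_add hi1 hi2, integral_const_mul, integral_const_mul]
  have hy1 : 0 ≤ y / (y - 1) := div_nonneg (by linarith) (by linarith)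
  have h5 := mul_le_mul_of_nonneg_left hRint hy1
  have h6 := mul_le_mul_of_nonneg_right hγ1 (sq_nonneg ‖c‖)
  have h7 : y / (y - 1) * (((1 - γ) ^ 2 + γ ^ 2 * ω) * ‖c‖ ^ 2 + γ ^ 2 * (1 + ω) * E) =
      y / (y - 1) * ((1 - γ) ^ 2 + γ ^ 2 * ω) * ‖c‖ ^ 2 +
      y / (y - 1) * (γ ^ 2 * (1 + ω)) * E := by ring
  rw [h7, hγ2] at h5
  linarith

end Auxiliary

namespace SoteriaFL

section

variable {n m d : ℕ} {𝒟 : Type u₁} {U : Type u₂} {ℓ : 𝒟 → Vec d → ℝ} {D : Fin n → Fin m → 𝒟}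

/-- `(1/n) ∑_i ‖∇f_i(x) - s_i‖²`, the mean squared error of the references. -/
noncomputable def shiftError (ℓ : 𝒟 → Vec d → ℝ) (D : Fin n → Fin m → 𝒟) (st : State n m d U) :
    ℝ :=
  1 / (n : ℝ) * ∑ i, ‖gradient (localLoss ℓ (D i)) st.1.1 - st.1.2.1 i‖ ^ 2

lemma shiftError_nonneg (st : State n m d U) : 0 ≤ shiftError ℓ D st := by
  unfold shiftError; positivity

end

variable {n m d : ℕ} {𝒟 : Type u₁} {U : Type u₂} {V : Type u₃} {W : Type u₄} {S : Type u₅}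
  [MeasurableSpace U] [MeasurableSpace V] [MeasurableSpace W] [MeasurableSpace S]
  {A : SoteriaFL n m d 𝒟 U V W S}

/-- The assumptions on the compression operators, the noise and the pieces of the estimator that
make all second moments of the algorithm finite. -/
structure HasFiniteMoments (A : SoteriaFL n m d 𝒟 U V W S) (ω G_A G_B : ℝ) : Prop where
  ω_nonneg : 0 ≤ ω
  isCompression : ∀ t i, IsCompression ω (A.compLaw t i : Measure S) (A.comp t i)
  bound_φ : ∀ t i j z u p w, ‖A.est.φ t i j z u p w‖ ≤ G_A
  bound_ψ : ∀ t i j z u p w, ‖A.est.ψ t i j z u p w‖ ≤ G_B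
  G_A_nonneg : 0 ≤ G_A
  varP_nonneg : 0 ≤ A.varP

variable (A) in
/-- The mean squared error, over the clients, of the gradient estimators computed in the
state `st`. -/
noncomputable def estimateError (ℓ : 𝒟 → Vec d → ℝ) (D : Fin n → Fin m → 𝒟) (t : ℕ)
    (st : State n m d U) (ρ : RoundSeed n m d V W S) : ℝ :=
  1 / (n : ℝ) * ∑ i, ‖A.estimate t i (D i) st (ρ.2 i) -
    gradient (localLoss ℓ (D i)) st.1.1‖ ^ 2

variable {t : ℕ} {ω G_A G_B L : ℝ} {ℓ : 𝒟 → Vec d → ℝ} {D : Fin n → Fin m → 𝒟}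
  {st : State n m d U}

variable (A) in
lemma measurePreserving_clientSeed (t : ℕ) (i : Fin n) :
    MeasurePreserving (fun ρ : RoundSeed n m d V W S => ρ.2 i) (A.roundLaw t) (A.clientLaw t i) :=
  (measurePreserving_eval (A.clientLaw t) i).comp measurePreserving_snd

variable (A t D st) in
lemma integral_estimate_clientLaw (i : Fin n) :
    ∫ c, A.estimate t i (D i) st c ∂A.clientLaw t i =
      ∫ ρ, A.estimate t i (D i) st (ρ.2 i) ∂A.roundLaw t :=
  ((A.measurePreserving_clientSeed t i).integral_comp_of_aestronglyMeasurable
    (A.measurable_estimate_right t i (D i) st).aestronglyMeasurable).symm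

lemma HasFiniteMoments.memLp_estimate_round (h : A.HasFiniteMoments ω G_A G_B) (i : Fin n) :
    MemLp (fun ρ => A.estimate t i (D i) st (ρ.2 i)) 2 (A.roundLaw t) :=
  (memLp_estimate h.bound_φ h.bound_ψ h.G_A_nonneg _).comp_measurePreserving
    (A.measurePreserving_clientSeed t i)

lemma HasFiniteMoments.memLp_message_round (h : A.HasFiniteMoments ω G_A G_B) (i : Fin n) :
    MemLp (fun ρ => A.message t i (D i) st (ρ.2 i)) 2 (A.roundLaw t) :=
  (message_moments (h.isCompression t i) h.bound_φ h.bound_ψ h.G_A_nonneg h.varP_nonneg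
    rfl).1.comp_measurePreserving (A.measurePreserving_clientSeed t i)

lemma HasFiniteMoments.integral_message_round (h : A.HasFiniteMoments ω G_A G_B) (i : Fin n) :
    ∫ ρ, A.message t i (D i) st (ρ.2 i) ∂A.roundLaw t =
      (∫ ρ, A.estimate t i (D i) st (ρ.2 i) ∂A.roundLaw t) - st.1.2.1 i := by
  have h1 := message_moments (st := st) (Di := D i) (h.isCompression t i) h.bound_φ h.bound_ψ
    h.G_A_nonneg h.varP_nonneg rfl
  rw [(A.measurePreserving_clientSeed t i).integral_comp_of_aestronglyMeasurable
    h1.1.aestronglyMeasurable, h1.2.1, integral_estimate_clientLaw]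

/-- Variance of one message, when the gradient estimator is unbiased in the state `st`. -/
lemma HasFiniteMoments.integral_norm_message_sub_sq_le (h : A.HasFiniteMoments ω G_A G_B)
    (i : Fin n) {g : Vec d} (hg : ∫ ρ, A.estimate t i (D i) st (ρ.2 i) ∂A.roundLaw t = g) :
    ∫ ρ, ‖A.message t i (D i) st (ρ.2 i) - (g - st.1.2.1 i)‖ ^ 2 ∂A.roundLaw t ≤
      ω * ‖g - st.1.2.1 i‖ ^ 2 + (1 + ω) *
        (∫ ρ, ‖A.estimate t i (D i) st (ρ.2 i) - g‖ ^ 2 ∂A.roundLaw t + d * A.varP) := by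
  have h1 := message_moments (st := st) (Di := D i) (h.isCompression t i) h.bound_φ h.bound_ψ
    h.G_A_nonneg h.varP_nonneg ((A.integral_estimate_clientLaw t D st i).trans hg)
  have h2 := (A.measurePreserving_clientSeed t i).integral_comp_of_aestronglyMeasurable
    (g := fun c => ‖A.message t i (D i) st c - (g - st.1.2.1 i)‖ ^ 2)
    ((h1.1.aestronglyMeasurable.sub aestronglyMeasurable_const).norm.pow 2)
  have h3 := (A.measurePreserving_clientSeed t i).integral_comp_of_aestronglyMeasurable
    (g := fun c => ‖A.estimate t i (D i) st c - g‖ ^ 2)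
    (((A.measurable_estimate_right t i (D i) st).sub measurable_const).norm.pow_const
      2).aestronglyMeasurable
  rw [h2, h3]
  exact h1.2.2

/-- The compression errors of different clients are independent, so their average has variance
smaller by the factor `1/n`. -/
lemma HasFiniteMoments.integral_norm_sum_message_sq (h : A.HasFiniteMoments ω G_A G_B)
    {c : Fin n → Vec d} (hc : ∀ i, ∫ ρ, A.message t i (D i) st (ρ.2 i) ∂A.roundLaw t = c i) :
    ∫ ρ, ‖∑ i, (A.message t i (D i) st (ρ.2 i) - c i)‖ ^ 2 ∂A.roundLaw t =
      ∑ i, ∫ ρ, ‖A.message t i (D i) st (ρ.2 i) - c i‖ ^ 2 ∂A.roundLaw t := by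
  have hL : ∀ i, MemLp (fun c' => A.message t i (D i) st c' - c i) 2 (A.clientLaw t i) := fun i =>
    (message_moments (h.isCompression t i) h.bound_φ h.bound_ψ h.G_A_nonneg h.varP_nonneg
      rfl).1.sub (memLp_const _)
  have heval : ∀ i, MeasurePreserving (fun c' : Fin n → ClientSeed m d W S => c' i)
      (Measure.pi (A.clientLaw t)) (A.clientLaw t i) := fun i => measurePreserving_eval _ i
  have hLpi := fun i => (hL i).comp_measurePreserving (heval i)
  have hsnd : MeasurePreserving Prod.snd (A.roundLaw t) (Measure.pi (A.clientLaw t)) :=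
    measurePreserving_snd
  have h1 := integral_norm_sum_sq_of_indep hLpi
    (iIndepFun_pi (X := fun i c' => A.message t i (D i) st c' - c i)
      fun i => (hL i).aestronglyMeasurable.aemeasurable) fun i => by
    have h2 := (heval i).integral_comp_of_aestronglyMeasurable (hL i).aestronglyMeasurable
    have h3 := (A.measurePreserving_clientSeed t i).integral_comp_of_aestronglyMeasurable
      (hL i).aestronglyMeasurable
    refine h2.trans (h3.symm.trans ?_)
    rw [integral_sub ((h.memLp_message_round i).integrable (by norm_num)) (integrable_const _),
      hc i]
    simp
  have h2 := hsnd.integral_comp_of_aestronglyMeasurable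
    (g := fun c' => ‖∑ i, (A.message t i (D i) st (c' i) - c i)‖ ^ 2)
    ((memLp_finsetSum _ fun i _ => hLpi i).aestronglyMeasurable.norm.pow 2)
  refine h2.trans (h1.trans (Finset.sum_congr rfl fun i _ => ?_))
  exact (hsnd.integral_comp_of_aestronglyMeasurable
    (g := fun c' => ‖A.message t i (D i) st (c' i) - c i‖ ^ 2)
    ((hLpi i).aestronglyMeasurable.norm.pow 2)).symm

lemma HasFiniteMoments.integral_estimateError (h : A.HasFiniteMoments ω G_A G_B) :
    ∫ ρ, A.estimateError ℓ D t st ρ ∂A.roundLaw t = 1 / (n : ℝ) * ∑ i,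
      ∫ ρ, ‖A.estimate t i (D i) st (ρ.2 i) - gradient (localLoss ℓ (D i)) st.1.1‖ ^ 2
        ∂A.roundLaw t := by
  have h1 : ∀ i, Integrable (fun ρ => ‖A.estimate t i (D i) st (ρ.2 i) -
      gradient (localLoss ℓ (D i)) st.1.1‖ ^ 2) (A.roundLaw t) := fun i =>
    ((h.memLp_estimate_round i).sub (memLp_const _)).integrable_norm_sq
  simp only [estimateError]
  rw [integral_const_mul, integral_finsetSum _ fun i _ => h1 i]

/-- First two moments of one step: the mean direction is `-∇f(x)`. -/
lemma HasFiniteMoments.step_sub_moments (h : A.HasFiniteMoments ω G_A G_B) (hn : 0 < n)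
    (hs : st.1.2.2 = (1 / (n : ℝ)) • ∑ i, st.1.2.1 i)
    (hℓ : ∀ i, IsSmooth L (localLoss ℓ (D i)))
    (hg : ∀ i, ∫ ρ, A.estimate t i (D i) st (ρ.2 i) ∂A.roundLaw t =
      gradient (localLoss ℓ (D i)) st.1.1) :
    MemLp (fun ρ => (A.step D t st ρ).1.1 - st.1.1) 2 (A.roundLaw t) ∧
    ∫ ρ, ((A.step D t st ρ).1.1 - st.1.1) ∂A.roundLaw t =
      (-A.η) • gradient (globalLoss ℓ D) st.1.1 ∧
    ∫ ρ, ‖(A.step D t st ρ).1.1 - st.1.1‖ ^ 2 ∂A.roundLaw t ≤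
      A.η ^ 2 * ‖gradient (globalLoss ℓ D) st.1.1‖ ^ 2 + A.η ^ 2 / n * (ω * shiftError ℓ D st +
        (1 + ω) * (∫ ρ, A.estimateError ℓ D t st ρ ∂A.roundLaw t + d * A.varP)) := by
  set c : Fin n → Vec d := fun i => gradient (localLoss ℓ (D i)) st.1.1 - st.1.2.1 i
  have hc : ∀ i, ∫ ρ, A.message t i (D i) st (ρ.2 i) ∂A.roundLaw t = c i := fun i => by
    rw [h.integral_message_round, hg i]
  set Z : RoundSeed n m d V W S → Vec d := fun ρ =>
    (1 / (n : ℝ)) • ∑ i, (A.message t i (D i) st (ρ.2 i) - c i)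
  have hZi : ∀ i, MemLp (fun ρ => A.message t i (D i) st (ρ.2 i) - c i) 2 (A.roundLaw t) :=
    fun i => (h.memLp_message_round i).sub (memLp_const _)
  have hZ : MemLp Z 2 (A.roundLaw t) :=
    (memLp_finsetSum Finset.univ fun i _ => hZi i).const_smul (1 / (n : ℝ))
  have hZ0 : ∫ ρ, Z ρ ∂A.roundLaw t = 0 := by
    simp only [Z]
    rw [integral_smul, integral_finsetSum _ fun i _ => (hZi i).integrable (by norm_num),
      Finset.sum_eq_zero, smul_zero]
    intro i _
    rw [integral_sub ((h.memLp_message_round i).integrable (by norm_num)) (integrable_const _),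
      hc i]
    simp
  have hstep : ∀ ρ, (A.step D t st ρ).1.1 - st.1.1 =
      (-A.η) • (gradient (globalLoss ℓ D) st.1.1 + Z ρ) := fun ρ => by
    simp only [step, Z, c, gradient_globalLoss hℓ, hs, Finset.sum_sub_distrib]
    module
  have hgZ : MemLp (fun ρ => gradient (globalLoss ℓ D) st.1.1 + Z ρ) 2 (A.roundLaw t) :=
    (memLp_const (gradient (globalLoss ℓ D) st.1.1)).add hZ
  simp_rw [hstep]
  refine ⟨hgZ.const_smul (-A.η), ?_, ?_⟩
  · rw [integral_smul, integral_add (integrable_const _)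
      (hZ.integrable (by norm_num)), hZ0]
    simp
  · simp_rw [norm_smul, mul_pow, Real.norm_eq_abs, sq_abs, neg_sq]
    rw [integral_const_mul, integral_norm_add_sq_of_mean_zero hZ hZ0, mul_add]
    have hn' : (0 : ℝ) < n := by exact_mod_cast hn
    have h1 : ∫ ρ, ‖Z ρ‖ ^ 2 ∂A.roundLaw t = (1 / (n : ℝ)) ^ 2 *
        ∑ i, ∫ ρ, ‖A.message t i (D i) st (ρ.2 i) - c i‖ ^ 2 ∂A.roundLaw t := by
      simp only [Z]
      simp_rw [norm_smul, mul_pow, Real.norm_eq_abs, sq_abs]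
      rw [integral_const_mul, h.integral_norm_sum_message_sq hc]
    have h2 : ∑ i, ∫ ρ, ‖A.message t i (D i) st (ρ.2 i) - c i‖ ^ 2 ∂A.roundLaw t ≤
        n * (ω * shiftError ℓ D st +
          (1 + ω) * (∫ ρ, A.estimateError ℓ D t st ρ ∂A.roundLaw t + d * A.varP)) := by
      refine (Finset.sum_le_sum fun i _ => h.integral_norm_message_sub_sq_le i (hg i)).trans
        (le_of_eq ?_)
      rw [h.integral_estimateError, shiftError, Finset.sum_add_distrib, ← Finset.mul_sum,
        ← Finset.mul_sum, Finset.sum_add_distrib]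
      simp only [Finset.sum_const, Finset.card_univ, Fintype.card_fin, nsmul_eq_mul]
      field_simp
    rw [h1]
    have h3 := mul_le_mul_of_nonneg_left h2 (show 0 ≤ A.η ^ 2 * (1 / (n : ℝ)) ^ 2 by positivity)
    have h4 : A.η ^ 2 * (1 / (n : ℝ)) ^ 2 * (n * (ω * shiftError ℓ D st +
          (1 + ω) * (∫ ρ, A.estimateError ℓ D t st ρ ∂A.roundLaw t + d * A.varP))) =
        A.η ^ 2 / n * (ω * shiftError ℓ D st +
          (1 + ω) * (∫ ρ, A.estimateError ℓ D t st ρ ∂A.roundLaw t + d * A.varP)) := by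
      field_simp
    linarith

/-- Descent of the loss in one round. -/
lemma HasFiniteMoments.integral_globalLoss_step_le (h : A.HasFiniteMoments ω G_A G_B) (hn : 0 < n)
    (hs : st.1.2.2 = (1 / (n : ℝ)) • ∑ i, st.1.2.1 i)
    (hℓ : ∀ i, IsSmooth L (localLoss ℓ (D i))) (hbdd : BddBelow (Set.range (globalLoss ℓ D)))
    (hg : ∀ i, ∫ ρ, A.estimate t i (D i) st (ρ.2 i) ∂A.roundLaw t =
      gradient (localLoss ℓ (D i)) st.1.1) :
    ∫ ρ, globalLoss ℓ D (A.step D t st ρ).1.1 ∂A.roundLaw t ≤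
      globalLoss ℓ D st.1.1 - A.η * ‖gradient (globalLoss ℓ D) st.1.1‖ ^ 2 +
        L / 2 * ∫ ρ, ‖(A.step D t st ρ).1.1 - st.1.1‖ ^ 2 ∂A.roundLaw t := by
  obtain ⟨hL, hmean, -⟩ := h.step_sub_moments hn hs hℓ hg
  have hf : IsSmooth L (globalLoss ℓ D) := IsSmooth.globalLoss hn hℓ
  obtain ⟨B, hB⟩ := hbdd
  have hX : MemLp (fun ρ => (A.step D t st ρ).1.1) 2 (A.roundLaw t) := hL.of_sub_const
  have hi : Integrable (fun ρ => ⟪gradient (globalLoss ℓ D) st.1.1,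
      (A.step D t st ρ).1.1 - st.1.1⟫) (A.roundLaw t) := (hL.integrable (by norm_num)).const_inner _
  have hi2 : Integrable (fun ρ => globalLoss ℓ D st.1.1 + ⟪gradient (globalLoss ℓ D) st.1.1,
      (A.step D t st ρ).1.1 - st.1.1⟫) (A.roundLaw t) := (integrable_const _).add hi
  have hi3 : Integrable (fun ρ => globalLoss ℓ D st.1.1 + ⟪gradient (globalLoss ℓ D) st.1.1,
      (A.step D t st ρ).1.1 - st.1.1⟫ + L / 2 * ‖(A.step D t st ρ).1.1 - st.1.1‖ ^ 2)
      (A.roundLaw t) := hi2.add (hL.integrable_norm_sq.const_mul _)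
  refine (integral_mono (hf.integrable_comp (fun x => hB ⟨x, rfl⟩) hX) hi3 fun ρ => ?_).trans
    (le_of_eq ?_)
  · simpa using hf.le_add_inner_add_sq st.1.1 ((A.step D t st ρ).1.1 - st.1.1)
  · rw [integral_add hi2 (hL.integrable_norm_sq.const_mul _), integral_add (integrable_const _) hi,
      integral_inner (hL.integrable (by norm_num)), hmean, integral_const_mul,
      real_inner_smul_right, real_inner_self_eq_norm_sq]
    simp
    ring

/-- Contraction of the references towards the local gradients in one round. -/
lemma HasFiniteMoments.integral_shiftError_step_le (h : A.HasFiniteMoments ω G_A G_B) (hn : 0 < n)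
    (hs : st.1.2.2 = (1 / (n : ℝ)) • ∑ i, st.1.2.1 i)
    (hℓ : ∀ i, IsSmooth L (localLoss ℓ (D i)))
    (hγ : A.γ = Real.sqrt ((1 + 2 * ω) / (2 * (1 + ω) ^ 3)))
    (hg : ∀ i, ∫ ρ, A.estimate t i (D i) st (ρ.2 i) ∂A.roundLaw t =
      gradient (localLoss ℓ (D i)) st.1.1) :
    ∫ ρ, shiftError ℓ D (A.step D t st ρ) ∂A.roundLaw t ≤
      (1 - 1 / (2 * (1 + ω))) * shiftError ℓ D st +
        1 / (1 + ω) * (∫ ρ, A.estimateError ℓ D t st ρ ∂A.roundLaw t + d * A.varP) +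
        2 * (1 + ω) * L ^ 2 * ∫ ρ, ‖(A.step D t st ρ).1.1 - st.1.1‖ ^ 2 ∂A.roundLaw t := by
  obtain ⟨hL, -, -⟩ := h.step_sub_moments hn hs hℓ hg
  have hn' : (0 : ℝ) < n := by exact_mod_cast hn
  set Q := ∫ ρ, ‖(A.step D t st ρ).1.1 - st.1.1‖ ^ 2 ∂A.roundLaw t
  set y := 2 * (1 + ω)
  set c : Fin n → Vec d := fun i => gradient (localLoss ℓ (D i)) st.1.1 - st.1.2.1 i
  set E : Fin n → ℝ := fun i => ∫ ρ, ‖A.estimate t i (D i) st (ρ.2 i) -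
    gradient (localLoss ℓ (D i)) st.1.1‖ ^ 2 ∂A.roundLaw t
  have hX : MemLp (fun ρ => (A.step D t st ρ).1.1) 2 (A.roundLaw t) := hL.of_sub_const
  have hM : ∀ i, MemLp (fun ρ => gradient (localLoss ℓ (D i)) (A.step D t st ρ).1.1 -
      (A.step D t st ρ).1.2.1 i) 2 (A.roundLaw t) := fun i =>
    ((hℓ i).memLp_gradient_comp hX).sub
      ((memLp_const (st.1.2.1 i)).add ((h.memLp_message_round i).const_smul A.γ))
  have hi : ∀ i, ∫ ρ, ‖gradient (localLoss ℓ (D i)) (A.step D t st ρ).1.1 -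
      (A.step D t st ρ).1.2.1 i‖ ^ 2 ∂A.roundLaw t ≤
      (1 - 1 / y) * ‖c i‖ ^ 2 + 1 / (1 + ω) * (E i + d * A.varP) + y * L ^ 2 * Q := by
    intro i
    have h1 := integral_norm_gradient_sub_shift_sq_le h.ω_nonneg hγ (hℓ i) (s := st.1.2.1 i) hL
      (h.memLp_message_round i) (by rw [h.integral_message_round, hg i])
      (h.integral_norm_message_sub_sq_le i (hg i))
    exact h1
  have h8 := Finset.sum_le_sum fun i (_ : i ∈ Finset.univ) => hi i
  simp only [shiftError]
  rw [integral_const_mul, integral_finsetSum _ fun i _ => (hM i).integrable_norm_sq,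
    h.integral_estimateError]
  refine (mul_le_mul_of_nonneg_left h8 (by positivity : 0 ≤ 1 / (n : ℝ))).trans (le_of_eq ?_)
  simp only [Finset.sum_add_distrib, ← Finset.mul_sum, Finset.sum_const, Finset.card_univ,
    Fintype.card_fin, nsmul_eq_mul]
  simp only [E, c]
  field_simp

end SoteriaFL

namespace SoteriaFL

variable {n m d : ℕ} {𝒟 : Type u₁} {U : Type u₂} {V : Type u₃} {W : Type u₄} {S : Type u₅}
  [MeasurableSpace U] [MeasurableSpace V] [MeasurableSpace W] [MeasurableSpace S]
  {A : SoteriaFL n m d 𝒟 U V W S}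

/-! ### Integration over the whole run -/

variable (A) in
lemma integrable_law_iff {E G : Type*} [MeasurableSpace E] [NormedAddCommGroup G] {t : ℕ}
    {X : (ℕ → RoundSeed n m d V W S) → E} (hX : Measurable[history n m d V W S t] X)
    {F : E × RoundSeed n m d V W S → G} (hF : StronglyMeasurable F) :
    Integrable (fun r => F (X r, r t)) A.law ↔
      (∀ᵐ r ∂A.law, Integrable (fun ρ => F (X r, ρ)) (A.roundLaw t)) ∧
        Integrable (fun r => ∫ ρ, ‖F (X r, ρ)‖ ∂A.roundLaw t) A.law := by
  have hXm : Measurable X := hX.mono (history_le t) le_rfl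
  have h1 : Integrable (fun r => F (X r, r t)) A.law ↔
      Integrable F ((A.law.map X).prod (A.roundLaw t)) := by
    rw [← map_prodMk_eval_law hX, integrable_map_measure hF.aestronglyMeasurable (by fun_prop)]
    rfl
  have h2 : MeasurableSet {x | Integrable (fun ρ => F (x, ρ)) (A.roundLaw t)} :=
    measurableSet_integrable hF
  rw [h1, integrable_prod_iff hF.aestronglyMeasurable, ae_map_iff hXm.aemeasurable h2,
    integrable_map_measure hF.norm.integral_prod_right'.aestronglyMeasurable hXm.aemeasurable]
  rfl

/-- Fubini's theorem for a function of the history before round `t` and the randomness of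
round `t`. -/
lemma integral_law_eq {E G : Type*} [MeasurableSpace E] [NormedAddCommGroup G] [NormedSpace ℝ G]
    {t : ℕ} {X : (ℕ → RoundSeed n m d V W S) → E} (hX : Measurable[history n m d V W S t] X)
    {F : E × RoundSeed n m d V W S → G} (hF : StronglyMeasurable F)
    (hint : Integrable (fun r => F (X r, r t)) A.law) :
    Integrable (fun r => ∫ ρ, F (X r, ρ) ∂A.roundLaw t) A.law ∧
      ∫ r, F (X r, r t) ∂A.law = ∫ r, ∫ ρ, F (X r, ρ) ∂A.roundLaw t ∂A.law := by
  have hXm : Measurable X := hX.mono (history_le t) le_rfl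
  have hmap := map_prodMk_eval_law (A := A) hX
  have hi : Integrable F ((A.law.map X).prod (A.roundLaw t)) := by
    rw [← hmap, integrable_map_measure hF.aestronglyMeasurable (by fun_prop)]
    exact hint
  have hs : StronglyMeasurable fun x => ∫ ρ, F (x, ρ) ∂A.roundLaw t := hF.integral_prod_right'
  refine ⟨(integrable_map_measure hs.aestronglyMeasurable hXm.aemeasurable).1
    hi.integral_prod_left, ?_⟩
  rw [← integral_map (φ := fun r => (X r, r t)) (f := F) (by fun_prop) hF.aestronglyMeasurable,
    hmap, integral_prod _ hi, integral_map hXm.aemeasurable hs.aestronglyMeasurable]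

section Run

variable {ω G_A G_B L : ℝ} {ℓ : 𝒟 → Vec d → ℝ} {D : Fin n → Fin m → 𝒟}

/-- The server reference is the average of the client references. -/
lemma state_reference_eq (t : ℕ) (r : ℕ → RoundSeed n m d V W S) :
    (A.state D t r).1.2.2 = (1 / (n : ℝ)) • ∑ i, (A.state D t r).1.2.1 i := by
  induction t with
  | zero => simp [state, initState]
  | succ t ih =>
    simp only [state, step, ih, Finset.sum_add_distrib, ← Finset.smul_sum]
    module

lemma HasFiniteMoments.measurable_comp (h : A.HasFiniteMoments ω G_A G_B) (t : ℕ) (i : Fin n) :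
    Measurable (Function.uncurry (A.comp t i)) := (h.isCompression t i).measurable

lemma HasFiniteMoments.measurable_state (h : A.HasFiniteMoments ω G_A G_B) (t : ℕ) :
    Measurable (A.state D t) :=
  (SoteriaFL.measurable_state h.measurable_comp D t).mono (history_le t) le_rfl

lemma HasFiniteMoments.memLp_message (h : A.HasFiniteMoments ω G_A G_B) (t : ℕ) (i : Fin n)
    (hs : MemLp (fun r => (A.state D t r).1.2.1 i) 2 A.law) :
    MemLp (fun r => A.message t i (D i) (A.state D t r) ((r t).2 i)) 2 A.law := by
  have hst := SoteriaFL.measurable_state h.measurable_comp D t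
  have hm : Measurable fun p : State n m d U × RoundSeed n m d V W S =>
      A.message t i (D i) p.1 (p.2.2 i) := (SoteriaFL.measurable_message h.measurable_comp t i
        (D i)).comp (f := fun p : State n m d U × RoundSeed n m d V W S => (p.1, p.2.2 i))
          (by fun_prop)
  have hmr : Measurable fun r => A.message t i (D i) (A.state D t r) ((r t).2 i) :=
    hm.comp (f := fun r => (A.state D t r, r t))
      ((h.measurable_state t).prodMk (measurable_pi_apply t))
  refine memLp_two_of_integrable_norm_sq hmr.aestronglyMeasurable ?_
  refine (A.integrable_law_iff hst (F := fun p => ‖A.message t i (D i) p.1 (p.2.2 i)‖ ^ 2)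
    (hm.norm.pow_const 2).stronglyMeasurable).2
    ⟨ae_of_all _ fun r => (h.memLp_message_round i).integrable_norm_sq, ?_⟩
  have hb : Integrable (fun r => (1 + ω) *
      (2 * (1 / (A.b : ℝ) * (m * G_A) + 1 / (m : ℝ) * (m * G_B)) ^ 2 +
        2 * ‖(A.state D t r).1.2.1 i‖ ^ 2 +
        (4 * (1 / (A.b : ℝ) * (m * G_A) + 1 / (m : ℝ) * (m * G_B)) ^ 2 + d * A.varP))) A.law :=
    (((integrable_const _).add (hs.integrable_norm_sq.const_mul 2)).add
      (integrable_const _)).const_mul _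
  refine hb.mono' ?_ (ae_of_all _ fun r => ?_)
  · exact (((hm.norm.pow_const 2).norm.stronglyMeasurable.integral_prod_right').measurable.comp
      (h.measurable_state t)).aestronglyMeasurable
  · rw [Real.norm_of_nonneg (integral_nonneg fun ρ => norm_nonneg _)]
    simp only [norm_pow, norm_norm]
    rw [(A.measurePreserving_clientSeed t i).integral_comp_of_aestronglyMeasurable
      (g := fun c => ‖A.message t i (D i) (A.state D t r) c‖ ^ 2)
      ((measurable_message_right h.measurable_comp).norm.pow_const 2).aestronglyMeasurable]
    exact integral_norm_message_sq_le h.ω_nonneg (h.isCompression t i) h.bound_φ h.bound_ψ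
      h.G_A_nonneg h.varP_nonneg rfl

/-- All components of the public state are square integrable. -/
lemma HasFiniteMoments.memLp_state (h : A.HasFiniteMoments ω G_A G_B) (t : ℕ) :
    MemLp (A.iterate D t) 2 A.law ∧
      (∀ i, MemLp (fun r => (A.state D t r).1.2.1 i) 2 A.law) ∧
      MemLp (fun r => (A.state D t r).1.2.2) 2 A.law := by
  induction t with
  | zero => exact ⟨memLp_const A.x₀, fun i => memLp_const 0, memLp_const 0⟩
  | succ t ih =>
    obtain ⟨h1, h2, h3⟩ := ih
    have hv := fun i => h.memLp_message t i (h2 i)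
    have hbar : MemLp (fun r => (1 / (n : ℝ)) •
        ∑ i, A.message t i (D i) (A.state D t r) ((r t).2 i)) 2 A.law :=
      (memLp_finsetSum Finset.univ fun i _ => hv i).const_smul (1 / (n : ℝ))
    exact ⟨h1.sub ((h3.add hbar).const_smul A.η), fun i => (h2 i).add ((hv i).const_smul A.γ),
      h3.add (hbar.const_smul A.γ)⟩

lemma HasFiniteMoments.memLp_iterate_sub (h : A.HasFiniteMoments ω G_A G_B) (t : ℕ) :
    MemLp (fun r => A.iterate D (t + 1) r - A.iterate D t r) 2 A.law :=
  (h.memLp_state (t + 1)).1.sub (h.memLp_state t).1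

lemma HasFiniteMoments.measurable_gradEst (h : A.HasFiniteMoments ω G_A G_B) (t : ℕ) (i : Fin n) :
    Measurable (A.gradEst D t i) :=
  (A.measurable_estimate t i (D i)).comp
    (f := fun r : ℕ → RoundSeed n m d V W S => (A.state D t r, (r t).2 i)) (by
      have := h.measurable_state (D := D) t
      fun_prop)

lemma HasFiniteMoments.memLp_gradEst (h : A.HasFiniteMoments ω G_A G_B) (t : ℕ) (i : Fin n) :
    MemLp (A.gradEst D t i) 2 A.law :=
  MemLp.of_bound (h.measurable_gradEst t i).aestronglyMeasurable _
    (ae_of_all _ fun _ => norm_estimate_le h.bound_φ h.bound_ψ h.G_A_nonneg _)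

lemma HasFiniteMoments.integrable_estimateError_state (h : A.HasFiniteMoments ω G_A G_B)
    (hℓ : ∀ i, IsSmooth L (localLoss ℓ (D i))) (t : ℕ) :
    Integrable (fun r => A.estimateError ℓ D t (A.state D t r) (r t)) A.law :=
  (integrable_finsetSum _ fun i _ => ((h.memLp_gradEst t i).sub
    ((hℓ i).memLp_gradient_comp (h.memLp_state t).1)).integrable_norm_sq).const_mul _

lemma HasFiniteMoments.integrable_shiftError (h : A.HasFiniteMoments ω G_A G_B)
    (hℓ : ∀ i, IsSmooth L (localLoss ℓ (D i))) (t : ℕ) :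
    Integrable (fun r => shiftError ℓ D (A.state D t r)) A.law :=
  (integrable_finsetSum _ fun i _ => (((hℓ i).memLp_gradient_comp (h.memLp_state t).1).sub
    ((h.memLp_state t).2.1 i)).integrable_norm_sq).const_mul _

/-- The conditional expectation given the history is the integral over the current round. -/
lemma HasFiniteMoments.condExp_gradEst (h : A.HasFiniteMoments ω G_A G_B) (t : ℕ) (i : Fin n) :
    (fun r => ∫ ρ, A.estimate t i (D i) (A.state D t r) (ρ.2 i) ∂A.roundLaw t) =ᵐ[A.law]
      A.law[A.gradEst D t i | history n m d V W S t] := by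
  have hst := SoteriaFL.measurable_state h.measurable_comp D t
  have hF : StronglyMeasurable fun p : State n m d U × RoundSeed n m d V W S =>
      A.estimate t i (D i) p.1 (p.2.2 i) := ((A.measurable_estimate t i (D i)).comp
        (f := fun p : State n m d U × RoundSeed n m d V W S => (p.1, p.2.2 i))
          (by fun_prop)).stronglyMeasurable
  have hint : Integrable (A.gradEst D t i) A.law := (h.memLp_gradEst t i).integrable (by norm_num)
  obtain ⟨hi, -⟩ := integral_law_eq (A := A) hst hF hint
  refine ae_eq_condExp_of_forall_setIntegral_eq (history_le t) hint
    (fun s _ _ => hi.integrableOn) (fun s hs _ => ?_) ?_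
  · have hs' : MeasurableSet s := history_le t s hs
    -- Fubini for the pair of the state and the indicator of `s`.
    have hX : Measurable[history n m d V W S t]
        fun r => (A.state D t r, s.indicator (fun _ => (1 : ℝ)) r) :=
      hst.prodMk (measurable_const.indicator hs)
    have hF2 : StronglyMeasurable fun p : (State n m d U × ℝ) × RoundSeed n m d V W S =>
        p.1.2 • A.estimate t i (D i) p.1.1 (p.2.2 i) := by
      refine (measurable_snd.comp measurable_fst).stronglyMeasurable.smul
        (hF.comp_measurable (g := fun p : (State n m d U × ℝ) × RoundSeed n m d V W S =>
          (p.1.1, p.2)) (by fun_prop))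
    have hind : ∀ (g : (ℕ → RoundSeed n m d V W S) → Vec d),
        (fun r => s.indicator (fun _ => (1 : ℝ)) r • g r) = s.indicator g := fun g => by
      ext1 r
      by_cases hr : r ∈ s <;> simp [hr]
    have hint2 : Integrable (fun r => s.indicator (fun _ => (1 : ℝ)) r • A.gradEst D t i r)
        A.law := by
      rw [hind]
      exact hint.indicator hs'
    have h2 := (integral_law_eq (A := A) hX hF2 hint2).2
    simp only [integral_smul] at h2
    rw [← integral_indicator hs', ← integral_indicator hs', ← hind, ← hind]
    exact h2.symm
  · exact (hF.integral_prod_right'.comp_measurable hst).aestronglyMeasurable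

end Run

end SoteriaFL

/-! ### The recursions in expectation -/

namespace SoteriaFL

variable {n m d : ℕ} {𝒟 : Type u₁} {U : Type u₂} {V : Type u₃} {W : Type u₄} {S : Type u₅}
  [MeasurableSpace U] [MeasurableSpace V] [MeasurableSpace W] [MeasurableSpace S]
  {A : SoteriaFL n m d 𝒟 U V W S}

section Expectations

variable {ω G_A G_B C₁ C₂ C₃ C₄ θ L : ℝ} {ℓ : 𝒟 → Vec d → ℝ} {D : Fin n → Fin m → 𝒟} {t T : ℕ}
  {Δ : ℕ → (ℕ → RoundSeed n m d V W S) → ℝ}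

/-- The gradient estimators of round `t` are unbiased given the state before round `t`. -/
def UnbiasedAt (A : SoteriaFL n m d 𝒟 U V W S) (ℓ : 𝒟 → Vec d → ℝ) (D : Fin n → Fin m → 𝒟)
    (t : ℕ) : Prop :=
  ∀ᵐ r ∂A.law, ∀ i, ∫ ρ, A.estimate t i (D i) (A.state D t r) (ρ.2 i) ∂A.roundLaw t =
    gradient (localLoss ℓ (D i)) (A.iterate D t r)

lemma HasFiniteMoments.unbiasedAt (h : A.HasFiniteMoments ω G_A G_B)
    (hunb : ∀ i, A.law[A.gradEst D t i | history n m d V W S t]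
      =ᵐ[A.law] fun r => gradient (localLoss ℓ (D i)) (A.iterate D t r)) :
    A.UnbiasedAt ℓ D t :=
  ae_all_iff.2 fun i => (h.condExp_gradEst t i).trans (hunb i)

lemma HasFiniteMoments.measurable_step_prod (h : A.HasFiniteMoments ω G_A G_B) (t : ℕ) :
    Measurable fun p : State n m d U × RoundSeed n m d V W S => A.step D t p.1 p.2 :=
  measurable_step h.measurable_comp t D

lemma measurable_shiftError (hℓ : ∀ i, IsSmooth L (localLoss ℓ (D i))) :
    Measurable fun st : State n m d U => shiftError ℓ D st := by
  have h1 : ∀ i, Measurable (gradient (localLoss ℓ (D i))) := fun i =>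
    (hℓ i).continuous_gradient.measurable
  unfold shiftError
  refine (Finset.measurable_fun_sum _ fun i _ => ?_).const_mul _
  have h2 := h1 i
  fun_prop

lemma measurable_estimateError (hℓ : ∀ i, IsSmooth L (localLoss ℓ (D i))) (t : ℕ) :
    Measurable fun p : State n m d U × RoundSeed n m d V W S =>
      A.estimateError ℓ D t p.1 p.2 := by
  unfold estimateError
  refine (Finset.measurable_fun_sum _ fun i _ => ?_).const_mul _
  have h1 : Measurable (gradient (localLoss ℓ (D i))) := (hℓ i).continuous_gradient.measurable
  have h2 : Measurable fun p : State n m d U × RoundSeed n m d V W S =>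
      A.estimate t i (D i) p.1 (p.2.2 i) := (A.measurable_estimate t i (D i)).comp
        (f := fun p : State n m d U × RoundSeed n m d V W S => (p.1, p.2.2 i)) (by fun_prop)
  fun_prop

lemma HasFiniteMoments.fubini_norm_iterate_sub_sq (h : A.HasFiniteMoments ω G_A G_B) (t : ℕ) :
    Integrable (fun r => ∫ ρ, ‖(A.step D t (A.state D t r) ρ).1.1 - (A.state D t r).1.1‖ ^ 2
      ∂A.roundLaw t) A.law ∧
    ∫ r, ‖A.iterate D (t + 1) r - A.iterate D t r‖ ^ 2 ∂A.law =
      ∫ r, ∫ ρ, ‖(A.step D t (A.state D t r) ρ).1.1 - (A.state D t r).1.1‖ ^ 2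
        ∂A.roundLaw t ∂A.law := by
  have hstep := h.measurable_step_prod (D := D) t
  have hm : Measurable fun p : State n m d U × RoundSeed n m d V W S =>
      ‖(A.step D t p.1 p.2).1.1 - p.1.1.1‖ ^ 2 := by fun_prop
  exact integral_law_eq (SoteriaFL.measurable_state h.measurable_comp D t) hm.stronglyMeasurable
    (h.memLp_iterate_sub t).integrable_norm_sq

lemma HasFiniteMoments.fubini_estimateError (h : A.HasFiniteMoments ω G_A G_B)
    (hℓ : ∀ i, IsSmooth L (localLoss ℓ (D i))) (t : ℕ) :
    Integrable (fun r => ∫ ρ, A.estimateError ℓ D t (A.state D t r) ρ ∂A.roundLaw t) A.law ∧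
    ∫ r, A.estimateError ℓ D t (A.state D t r) (r t) ∂A.law =
      ∫ r, ∫ ρ, A.estimateError ℓ D t (A.state D t r) ρ ∂A.roundLaw t ∂A.law :=
  integral_law_eq (SoteriaFL.measurable_state h.measurable_comp D t)
    (measurable_estimateError hℓ t).stronglyMeasurable (h.integrable_estimateError_state hℓ t)

lemma HasFiniteMoments.integrable_norm_gradient_sq (h : A.HasFiniteMoments ω G_A G_B) (hn : 0 < n)
    (hℓ : ∀ i, IsSmooth L (localLoss ℓ (D i))) (t : ℕ) :
    Integrable (fun r => ‖gradient (globalLoss ℓ D) (A.iterate D t r)‖ ^ 2) A.law :=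
  ((IsSmooth.globalLoss hn hℓ).memLp_gradient_comp (h.memLp_state t).1).integrable_norm_sq

lemma HasFiniteMoments.integrable_globalLoss (h : A.HasFiniteMoments ω G_A G_B) (hn : 0 < n)
    (hℓ : ∀ i, IsSmooth L (localLoss ℓ (D i))) (hbdd : BddBelow (Set.range (globalLoss ℓ D)))
    (t : ℕ) : Integrable (fun r => globalLoss ℓ D (A.iterate D t r)) A.law := by
  obtain ⟨B, hB⟩ := hbdd
  exact (IsSmooth.globalLoss hn hℓ).integrable_comp (fun x => hB ⟨x, rfl⟩) (h.memLp_state t).1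

lemma HasFiniteMoments.integral_norm_iterate_sub_sq_le (h : A.HasFiniteMoments ω G_A G_B)
    (hn : 0 < n) (hℓ : ∀ i, IsSmooth L (localLoss ℓ (D i))) (hunb : A.UnbiasedAt ℓ D t) :
    ∫ r, ‖A.iterate D (t + 1) r - A.iterate D t r‖ ^ 2 ∂A.law ≤
      A.η ^ 2 * ∫ r, ‖gradient (globalLoss ℓ D) (A.iterate D t r)‖ ^ 2 ∂A.law +
        A.η ^ 2 / n * (ω * ∫ r, shiftError ℓ D (A.state D t r) ∂A.law +
          (1 + ω) * (∫ r, A.estimateError ℓ D t (A.state D t r) (r t) ∂A.law + d * A.varP)) := by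
  obtain ⟨hQi, hQ⟩ := h.fubini_norm_iterate_sub_sq (D := D) t
  obtain ⟨hEi, hE⟩ := h.fubini_estimateError hℓ t
  have hN : Integrable (fun r => A.η ^ 2 *
      ‖gradient (globalLoss ℓ D) (A.iterate D t r)‖ ^ 2) A.law :=
    (h.integrable_norm_gradient_sq hn hℓ t).const_mul _
  have hH : Integrable (fun r => ω * shiftError ℓ D (A.state D t r)) A.law :=
    (h.integrable_shiftError hℓ t).const_mul _
  have hEc : Integrable (fun r => ∫ ρ, A.estimateError ℓ D t (A.state D t r) ρ ∂A.roundLaw t +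
      d * A.varP) A.law := hEi.add (integrable_const _)
  have hHE : Integrable (fun r => ω * shiftError ℓ D (A.state D t r) + (1 + ω) *
      (∫ ρ, A.estimateError ℓ D t (A.state D t r) ρ ∂A.roundLaw t + d * A.varP)) A.law :=
    hH.add (hEc.const_mul _)
  rw [hQ, hE]
  refine (integral_mono_ae hQi (hN.add (hHE.const_mul (A.η ^ 2 / n))) ?_).trans (le_of_eq ?_)
  · filter_upwards [hunb] with r hr
    exact (h.step_sub_moments hn (state_reference_eq t r) hℓ hr).2.2
  · simp only [Pi.add_apply]
    rw [integral_add hN (hHE.const_mul _), integral_const_mul, integral_const_mul,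
      integral_add hH (hEc.const_mul _), integral_const_mul, integral_const_mul,
      integral_add hEi (integrable_const _)]
    simp

lemma HasFiniteMoments.integral_globalLoss_le (h : A.HasFiniteMoments ω G_A G_B)
    (hn : 0 < n) (hℓ : ∀ i, IsSmooth L (localLoss ℓ (D i)))
    (hbdd : BddBelow (Set.range (globalLoss ℓ D))) (hunb : A.UnbiasedAt ℓ D t) :
    ∫ r, globalLoss ℓ D (A.iterate D (t + 1) r) ∂A.law ≤
      ∫ r, globalLoss ℓ D (A.iterate D t r) ∂A.law -
        A.η * ∫ r, ‖gradient (globalLoss ℓ D) (A.iterate D t r)‖ ^ 2 ∂A.law +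
        L / 2 * ∫ r, ‖A.iterate D (t + 1) r - A.iterate D t r‖ ^ 2 ∂A.law := by
  obtain ⟨hQi, hQ⟩ := h.fubini_norm_iterate_sub_sq (D := D) t
  have hstep := h.measurable_step_prod (D := D) t
  have hfm : Measurable (globalLoss ℓ D) :=
    (IsSmooth.globalLoss hn hℓ).1.continuous.measurable
  have hm : Measurable fun p : State n m d U × RoundSeed n m d V W S =>
      globalLoss ℓ D (A.step D t p.1 p.2).1.1 := by fun_prop
  obtain ⟨hFi, hF⟩ := integral_law_eq (SoteriaFL.measurable_state h.measurable_comp D t)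
    hm.stronglyMeasurable (h.integrable_globalLoss hn hℓ hbdd (t + 1))
  have hF₀ := h.integrable_globalLoss hn hℓ hbdd t
  have hN : Integrable (fun r => A.η *
      ‖gradient (globalLoss ℓ D) (A.iterate D t r)‖ ^ 2) A.law :=
    (h.integrable_norm_gradient_sq hn hℓ t).const_mul _
  have hFN : Integrable (fun r => globalLoss ℓ D (A.iterate D t r) - A.η *
      ‖gradient (globalLoss ℓ D) (A.iterate D t r)‖ ^ 2) A.law := hF₀.sub hN
  rw [hQ]
  refine hF.le.trans ((integral_mono_ae hFi (hFN.add (hQi.const_mul (L / 2))) ?_).trans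
    (le_of_eq ?_))
  · filter_upwards [hunb] with r hr
    exact h.integral_globalLoss_step_le hn (state_reference_eq t r) hℓ hbdd hr
  · simp only [Pi.add_apply]
    rw [integral_add hFN (hQi.const_mul _), integral_sub hF₀ hN, integral_const_mul,
      integral_const_mul]

lemma HasFiniteMoments.integral_shiftError_le (h : A.HasFiniteMoments ω G_A G_B)
    (hn : 0 < n) (hℓ : ∀ i, IsSmooth L (localLoss ℓ (D i)))
    (hγ : A.γ = Real.sqrt ((1 + 2 * ω) / (2 * (1 + ω) ^ 3))) (hunb : A.UnbiasedAt ℓ D t) :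
    ∫ r, shiftError ℓ D (A.state D (t + 1) r) ∂A.law ≤
      (1 - 1 / (2 * (1 + ω))) * ∫ r, shiftError ℓ D (A.state D t r) ∂A.law +
        1 / (1 + ω) * (∫ r, A.estimateError ℓ D t (A.state D t r) (r t) ∂A.law + d * A.varP) +
        2 * (1 + ω) * L ^ 2 * ∫ r, ‖A.iterate D (t + 1) r - A.iterate D t r‖ ^ 2 ∂A.law := by
  obtain ⟨hQi, hQ⟩ := h.fubini_norm_iterate_sub_sq (D := D) t
  obtain ⟨hEi, hE⟩ := h.fubini_estimateError hℓ t
  have hm : Measurable fun p : State n m d U × RoundSeed n m d V W S =>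
      shiftError ℓ D (A.step D t p.1 p.2) :=
    (measurable_shiftError hℓ).comp (h.measurable_step_prod t)
  obtain ⟨hSi, hS⟩ := integral_law_eq (SoteriaFL.measurable_state h.measurable_comp D t)
    hm.stronglyMeasurable (h.integrable_shiftError hℓ (t + 1))
  have hH : Integrable (fun r => (1 - 1 / (2 * (1 + ω))) * shiftError ℓ D (A.state D t r))
      A.law := (h.integrable_shiftError hℓ t).const_mul _
  have hEc : Integrable (fun r => ∫ ρ, A.estimateError ℓ D t (A.state D t r) ρ ∂A.roundLaw t +
      d * A.varP) A.law := hEi.add (integrable_const _)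
  have hHE : Integrable (fun r => (1 - 1 / (2 * (1 + ω))) * shiftError ℓ D (A.state D t r) +
      1 / (1 + ω) * (∫ ρ, A.estimateError ℓ D t (A.state D t r) ρ ∂A.roundLaw t +
        d * A.varP)) A.law := hH.add (hEc.const_mul _)
  rw [hQ, hE]
  refine hS.le.trans ((integral_mono_ae hSi (hHE.add (hQi.const_mul (2 * (1 + ω) * L ^ 2)))
    ?_).trans (le_of_eq ?_))
  · filter_upwards [hunb] with r hr
    exact h.integral_shiftError_step_le hn (state_reference_eq t r) hℓ hγ hr
  · simp only [Pi.add_apply]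
    rw [integral_add hHE (hQi.const_mul _), integral_add hH (hEc.const_mul _), integral_const_mul,
      integral_const_mul, integral_const_mul, integral_add hEi (integrable_const _)]
    simp

lemma GenericAssumption.integral_estimateError_le
    (hA : A.GenericAssumption ℓ D T G_A G_B C₁ C₂ C₃ C₄ θ Δ) (ht : t < T) :
    ∫ r, A.estimateError ℓ D t (A.state D t r) (r t) ∂A.law ≤ C₁ * ∫ r, Δ t r ∂A.law + C₂ := by
  have hi : Integrable (fun r => C₁ * Δ t r) A.law := (hA.Δ_integrable t ht.le).const_mul _
  have h1 := integral_mono_ae integrable_condExp (hi.add (integrable_const C₂)) (hA.variance t ht)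
  rw [integral_condExp (history_le t)] at h1
  refine h1.trans (le_of_eq ?_)
  simp only [Pi.add_apply]
  rw [integral_add hi (integrable_const _), integral_const_mul]
  simp

lemma HasFiniteMoments.integral_Δ_le (h : A.HasFiniteMoments ω G_A G_B) (hn : 0 < n)
    (hA : A.GenericAssumption ℓ D T G_A G_B C₁ C₂ C₃ C₄ θ Δ)
    (hℓ : ∀ i, IsSmooth L (localLoss ℓ (D i))) (ht : t < T) :
    ∫ r, Δ (t + 1) r ∂A.law ≤ (1 - θ) * ∫ r, Δ t r ∂A.law +
      C₃ * ∫ r, ‖gradient (globalLoss ℓ D) (A.iterate D t r)‖ ^ 2 ∂A.law +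
      C₄ * ∫ r, ‖A.iterate D (t + 1) r - A.iterate D t r‖ ^ 2 ∂A.law := by
  have hf : IsSmooth L (globalLoss ℓ D) := IsSmooth.globalLoss hn hℓ
  have hi1 : Integrable (fun r => (1 - θ) * Δ t r) A.law := (hA.Δ_integrable t ht.le).const_mul _
  have hi2 : Integrable (fun r => C₃ * ‖gradient (globalLoss ℓ D) (A.iterate D t r)‖ ^ 2) A.law :=
    (hf.memLp_gradient_comp (h.memLp_state t).1).integrable_norm_sq.const_mul _
  have hi3 : Integrable (fun r => C₄ *
      (A.law[fun r' => ‖A.iterate D (t + 1) r' - A.iterate D t r'‖ ^ 2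
        | history n m d V W S t]) r) A.law := integrable_condExp.const_mul _
  have hi12 : Integrable (fun r => (1 - θ) * Δ t r +
      C₃ * ‖gradient (globalLoss ℓ D) (A.iterate D t r)‖ ^ 2) A.law := hi1.add hi2
  have h1 := integral_mono_ae integrable_condExp (hi12.add hi3) (hA.contraction t ht)
  rw [integral_condExp (history_le t)] at h1
  refine h1.trans (le_of_eq ?_)
  simp only [Pi.add_apply]
  rw [integral_add hi12 hi3, integral_add hi1 hi2, integral_const_mul, integral_const_mul,
    integral_const_mul, integral_condExp (history_le t)]

end Expectations

end SoteriaFL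

/-! ### The potential argument and the choice of the number of rounds -/

section RealInequalities

/-- One step of the potential argument. The weight `α` makes the estimator error cancel against
the decrease of `Δ`, the first stepsize condition keeps half of the descent, and the second one
makes the compression error cancel against the contraction of the references. -/
lemma potential_step_le {F F' H H' N Q X X' E v x L β n η θ α C₁ C₂ C₃ C₄ : ℝ}
    (hx : 1 ≤ x) (hL : 0 < L) (hβ : 0 < β) (hn : 0 < n) (hη : 0 < η) (hθ : 0 < θ)
    (hC₁ : 0 ≤ C₁) (hC₃ : 0 ≤ C₃) (hC₄ : 0 ≤ C₄)
    (hN : 0 ≤ N) (hH : 0 ≤ H) (hE : 0 ≤ E) (hv : 0 ≤ v)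
    (hα : α = 3 * β * C₁ / (2 * x * θ * L ^ 2))
    (hη₁ : η ≤ 1 / ((1 + 2 * α * C₄ + 4 * β * x + 2 * α * C₃ / η ^ 2) * L))
    (hη₂ : η ≤ Real.sqrt (β * n) / (Real.sqrt (1 + 2 * α * C₄ + 4 * β * x) * x * L))
    (hF : F' ≤ F - η * N + L / 2 * Q)
    (hQ : Q ≤ η ^ 2 * N + η ^ 2 / n * ((x - 1) * H + x * (E + v)))
    (hH' : H' ≤ (1 - 1 / (2 * x)) * H + 1 / x * (E + v) + 2 * x * L ^ 2 * Q)
    (hX : X' ≤ (1 - θ) * X + C₃ * N + C₄ * Q) (hEX : E ≤ C₁ * X + C₂) :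
    F' + α * L * X' + β / L * H' ≤
      F + α * L * X + β / L * H - η / 2 * N + 3 * β / (2 * x * L) * (C₂ + v) := by
  have hx0 : 0 < x := by linarith
  have hα0 : 0 ≤ α := by rw [hα]; positivity
  set B := 1 + 2 * α * C₄ + 4 * β * x with hB
  have hB0 : 0 < B := by positivity
  have h1 : (B + 2 * α * C₃ / η ^ 2) * L * η ≤ 1 := by
    rwa [le_div_iff₀ (by positivity), mul_comm] at hη₁
  have h2 : η ^ 2 * (B * x ^ 2 * L ^ 2) ≤ β * n := by
    rw [le_div_iff₀ (by positivity)] at hη₂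
    have h3 := pow_le_pow_left₀ (by positivity) hη₂ 2
    rw [Real.sq_sqrt (by positivity), mul_pow, mul_pow, mul_pow, Real.sq_sqrt hB0.le] at h3
    exact h3
  have h3 : B * L / 2 * (η ^ 2 / n) ≤ β / (2 * x ^ 2 * L) := by
    rw [mul_div_assoc', div_mul_eq_mul_div, div_div, div_le_div_iff₀ (by positivity) (by positivity)]
    nlinarith
  have h4 : B * L / 2 * Q ≤ B * L / 2 * η ^ 2 * N +
      β / (2 * x ^ 2 * L) * ((x - 1) * H + x * (E + v)) := by
    have h5 := mul_le_mul_of_nonneg_left hQ (by positivity : 0 ≤ B * L / 2)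
    have h6 : 0 ≤ (x - 1) * H + x * (E + v) :=
      add_nonneg (mul_nonneg (by linarith) hH) (by positivity)
    have h7 := mul_le_mul_of_nonneg_right h3 h6
    linarith
  have h5 : (α * L * C₃ + B * L / 2 * η ^ 2) * N ≤ η / 2 * N := by
    refine mul_le_mul_of_nonneg_right ?_ hN
    have h6 := mul_le_mul_of_nonneg_left h1 (by positivity : 0 ≤ η / 2)
    have h7 : η / 2 * ((B + 2 * α * C₃ / η ^ 2) * L * η) = α * L * C₃ + B * L / 2 * η ^ 2 := by
      field_simp
      ring
    linarith
  have h6 : α * L * θ * X = 3 * β / (2 * x * L) * (C₁ * X) := by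
    rw [hα]
    field_simp
  have h7 := mul_le_mul_of_nonneg_left hEX (by positivity : 0 ≤ 3 * β / (2 * x * L))
  have h8 := mul_le_mul_of_nonneg_left hX (by positivity : 0 ≤ α * L)
  have h9 := mul_le_mul_of_nonneg_left hH' (by positivity : 0 ≤ β / L)
  have h10 : β / L * ((1 - 1 / (2 * x)) * H + 1 / x * (E + v) + 2 * x * L ^ 2 * Q) =
      β / L * H - β / (2 * x * L) * H + β / (x * L) * (E + v) + 2 * β * x * L * Q := by
    field_simp
  have h11 : β / (2 * x ^ 2 * L) * ((x - 1) * H + x * (E + v)) =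
      β / (2 * x * L) * H - β / (2 * x ^ 2 * L) * H + β / (2 * x * L) * (E + v) := by
    field_simp
  have h12 : β / (x * L) * (E + v) + β / (2 * x * L) * (E + v) =
      3 * β / (2 * x * L) * (E + v) := by
    field_simp
    ring
  have h13 : 0 ≤ β / (2 * x ^ 2 * L) * H := by positivity
  have h14 : B * L / 2 * Q = L / 2 * Q + α * L * C₄ * Q + 2 * β * x * L * Q := by
    rw [hB]; ring
  linarith

/-- Summing the one-step inequality over the run. -/
lemma average_le_of_potential_step {Φ N : ℕ → ℝ} {η w Φ₀ B : ℝ} {T : ℕ} (hη : 0 < η) (hT : 0 < T)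
    (hstep : ∀ t < T, Φ (t + 1) ≤ Φ t - η / 2 * N t + w) (h0 : Φ 0 - B = Φ₀) (hB : B ≤ Φ T) :
    1 / (T : ℝ) * ∑ t ∈ Finset.range T, N t ≤ 2 * Φ₀ / (η * T) + 2 / η * w := by
  have h1 : ∀ k ≤ T, Φ k + η / 2 * ∑ t ∈ Finset.range k, N t ≤ Φ 0 + k * w := by
    intro k
    induction k with
    | zero => simp
    | succ k ih =>
      intro hk
      rw [Finset.sum_range_succ]
      push_cast
      linarith [ih (by omega), hstep k (by omega)]
  have h2 := h1 T le_rfl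
  have hT' : (0 : ℝ) < T := by exact_mod_cast hT
  have h3 : 2 / (η * T) * (η / 2 * ∑ t ∈ Finset.range T, N t) ≤ 2 / (η * T) * (Φ₀ + T * w) :=
    mul_le_mul_of_nonneg_left (by linarith) (by positivity)
  have h4 : 2 / (η * T) * (η / 2 * ∑ t ∈ Finset.range T, N t) =
      1 / (T : ℝ) * ∑ t ∈ Finset.range T, N t := by field_simp
  have h5 : 2 / (η * T) * (Φ₀ + T * w) = 2 * Φ₀ / (η * T) + 2 / η * w := by field_simp
  linarith

/-- The bound after `T` rounds when `T` balances the two terms. Here `y = L(1+ω)`,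
`g = (G_A²/4+G_B²) log(1/δ)` and `k = mε`. -/
lemma balanced_rounds_le {y β c d g k P C₂ η T M : ℝ} (hy : 0 < y) (hβ : 0 < β) (hc : 0 < c)
    (hd : 0 ≤ d) (hg : 0 ≤ g) (hk : 0 < k) (hP : 0 ≤ P) (hC₂ : 0 ≤ C₂) (hη : 0 < η) (hT : 0 < T)
    (hM : M = max (k * Real.sqrt (2 * y * P) / Real.sqrt (3 * β * c * (d * g)))
      (C₂ * k ^ 2 / (c * (d * g)))) (hMT : M ≤ T) (hTM : T ≤ 2 * M) :
    2 * P / (η * T) + 3 * β / (y * η) * (C₂ + c * (d * g) * T / k ^ 2) ≤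
      (3 * Real.sqrt (6 * c) + 9) * max
        (Real.sqrt P * (Real.sqrt (β * (d * g)) / (η * k * Real.sqrt y))) (β * C₂ / (y * η)) := by
  obtain hdg | hdg := (mul_nonneg hd hg).eq_or_lt'
  · -- Without noise, `M = 0` and no `T > 0` is admissible.
    rw [hdg] at hM
    simp only [mul_zero, Real.sqrt_zero, div_zero, max_self] at hM
    linarith
  generalize d * g = q at hM hdg ⊢
  set s := Real.sqrt (2 * y * P) with hs
  set w := Real.sqrt (3 * β * c * q) with hw
  have hw0 : 0 < w := Real.sqrt_pos.2 (by positivity)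
  have hs0 : 0 ≤ s := Real.sqrt_nonneg _
  have hs2 : s ^ 2 = 2 * y * P := Real.sq_sqrt (by positivity)
  have hw2 : w ^ 2 = 3 * β * c * q := Real.sq_sqrt (by positivity)
  have h1 : k * s ≤ w * T := by
    have h2 : k * s / w ≤ T := (le_max_left _ _).trans (hM ▸ hMT)
    rw [div_le_iff₀ hw0] at h2
    linarith
  have h2 : 2 * P / (η * T) ≤ s * w / (k * y * η) := by
    rw [div_le_div_iff₀ (by positivity) (by positivity)]
    have h3 := mul_le_mul_of_nonneg_left h1 (by positivity : 0 ≤ s * η)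
    have h4 : 2 * P * (k * y * η) = s * η * (k * s) := by linear_combination -(k * η) * hs2
    linarith
  have h3 : c * q * T / k ^ 2 ≤ 2 * (s * w / (3 * β * k)) + 2 * C₂ := by
    have h4 : T ≤ 2 * (k * s / w + C₂ * k ^ 2 / (c * q)) := by
      refine hTM.trans ?_
      rw [hM]
      have h5 : 0 ≤ k * s / w := by positivity
      have h6 : 0 ≤ C₂ * k ^ 2 / (c * q) := by positivity
      linarith [max_le_add_of_nonneg h5 h6]
    have h5 := mul_le_mul_of_nonneg_left h4 (by positivity : 0 ≤ c * q / k ^ 2)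
    have h6 : c * q / k ^ 2 * (2 * (k * s / w + C₂ * k ^ 2 / (c * q))) =
        2 * (c * q * s / (w * k)) + 2 * C₂ := by
      field_simp
    have h7 : c * q * s / (w * k) = s * w / (3 * β * k) := by
      rw [div_eq_div_iff (by positivity) (by positivity)]
      have h8 : s * w * (w * k) = s * w ^ 2 * k := by ring
      rw [h8, hw2]
      ring
    have h8 : c * q / k ^ 2 * T = c * q * T / k ^ 2 := by ring
    linarith
  have h4 : s * w / (k * y * η) = Real.sqrt (6 * c) *
      (Real.sqrt P * (Real.sqrt (β * q) / (η * k * Real.sqrt y))) := by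
    have h5 : s * w = Real.sqrt (6 * c) * Real.sqrt y * Real.sqrt P * Real.sqrt (β * q) := by
      rw [hs, hw, ← Real.sqrt_mul (by positivity), ← Real.sqrt_mul (by positivity),
        ← Real.sqrt_mul (by positivity), ← Real.sqrt_mul (by positivity)]
      congr 1
      ring
    have h6 : Real.sqrt y ≠ 0 := (Real.sqrt_pos.2 hy).ne'
    rw [h5, mul_div_assoc', mul_div_assoc', div_eq_div_iff (by positivity) (by positivity)]
    have h7 : Real.sqrt y * Real.sqrt y = y := Real.mul_self_sqrt hy.le
    linear_combination
      (Real.sqrt (6 * c) * Real.sqrt P * Real.sqrt (β * q) * η * k) * h7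
  set R := Real.sqrt P * (Real.sqrt (β * q) / (η * k * Real.sqrt y))
  have h5 : 3 * β / (y * η) * (C₂ + c * q * T / k ^ 2) ≤
      2 * (s * w / (k * y * η)) + 9 * (β * C₂ / (y * η)) := by
    have h6 := mul_le_mul_of_nonneg_left h3 (by positivity : 0 ≤ 3 * β / (y * η))
    have h7 : 3 * β / (y * η) * (2 * (s * w / (3 * β * k)) + 2 * C₂) =
        2 * (s * w / (k * y * η)) + 6 * (β * C₂ / (y * η)) := by
      field_simp
      ring
    have h8 : 3 * β / (y * η) * C₂ = 3 * (β * C₂ / (y * η)) := by ring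
    linarith
  have h6 : 3 * Real.sqrt (6 * c) * R ≤
      3 * Real.sqrt (6 * c) * max R (β * C₂ / (y * η)) :=
    mul_le_mul_of_nonneg_left (le_max_left _ _) (by positivity)
  have h7 := le_max_right R (β * C₂ / (y * η))
  rw [h4] at h2 h5
  linarith

end RealInequalities

namespace SoteriaFL

variable {n m d : ℕ} {𝒟 : Type u₁} {U : Type u₂} {V : Type u₃} {W : Type u₄} {S : Type u₅}
  [MeasurableSpace U] [MeasurableSpace V] [MeasurableSpace W] [MeasurableSpace S]
  {A : SoteriaFL n m d 𝒟 U V W S}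

variable {ω G_A G_B C₁ C₂ C₃ C₄ θ L α β : ℝ} {ℓ : 𝒟 → Vec d → ℝ} {D : Fin n → Fin m → 𝒟} {T : ℕ}
  {Δ : ℕ → (ℕ → RoundSeed n m d V W S) → ℝ}

lemma estimateError_nonneg (t : ℕ) (st : State n m d U) (ρ : RoundSeed n m d V W S) :
    0 ≤ A.estimateError ℓ D t st ρ := by
  unfold estimateError; positivity

lemma GenericAssumption.potential_nonneg (hA : A.GenericAssumption ℓ D T G_A G_B C₁ C₂ C₃ C₄ θ Δ)
    (hL : 0 < L) (hα : 0 ≤ α) (hβ : 0 < β) (hbdd : BddBelow (Set.range (globalLoss ℓ D))) :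
    0 ≤ A.potential ℓ D L α β Δ := by
  have h1 : ⨅ x, globalLoss ℓ D x ≤ globalLoss ℓ D A.x₀ := ciInf_le hbdd _
  have h2 : 0 ≤ ∫ r, Δ 0 r ∂A.law := integral_nonneg fun r => hA.Δ_nonneg 0 (Nat.zero_le _) r
  have h3 : 0 ≤ α * L * ∫ r, Δ 0 r ∂A.law := by positivity
  have h4 : 0 ≤ β / (L * n) *
      ∑ i, ‖gradient (localLoss ℓ (D i)) A.x₀ - (A.initState D).1.2.1 i‖ ^ 2 := by positivity
  unfold potential
  linarith

/-- Convergence of the average squared gradient norm, by telescoping the potential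
`𝔼 f(x^t) + αL 𝔼 Δ^t + (β/L) 𝔼 (shift error)`. -/
theorem GenericAssumption.avgSqGrad_le (hA : A.GenericAssumption ℓ D T G_A G_B C₁ C₂ C₃ C₄ θ Δ)
    (h : A.HasFiniteMoments ω G_A G_B) (hn : 0 < n) (hT : 0 < T) (hL : 0 < L)
    (hℓ : ∀ i, IsSmooth L (localLoss ℓ (D i))) (hbdd : BddBelow (Set.range (globalLoss ℓ D)))
    (hβ : 0 < β) (hα : α = 3 * β * C₁ / (2 * (1 + ω) * θ * L ^ 2)) (hη : 0 < A.η)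
    (hη₁ : A.η ≤ 1 / ((1 + 2 * α * C₄ + 4 * β * (1 + ω) + 2 * α * C₃ / A.η ^ 2) * L))
    (hη₂ : A.η ≤ Real.sqrt (β * n) /
      (Real.sqrt (1 + 2 * α * C₄ + 4 * β * (1 + ω)) * (1 + ω) * L))
    (hγ : A.γ = Real.sqrt ((1 + 2 * ω) / (2 * (1 + ω) ^ 3))) :
    A.avgSqGrad ℓ D T ≤ 2 * A.potential ℓ D L α β Δ / (A.η * T) +
      3 * β / ((1 + ω) * L * A.η) * (C₂ + d * A.varP) := by
  have hω := h.ω_nonneg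
  have hn' : (0 : ℝ) < n := by exact_mod_cast hn
  have hα0 : 0 ≤ α := by
    have := hA.C₁_nonneg
    have := hA.θ_pos
    rw [hα]
    positivity
  have hv := h.varP_nonneg
  have key := average_le_of_potential_step (T := T) (η := A.η)
    (Φ := fun t => ∫ r, globalLoss ℓ D (A.iterate D t r) ∂A.law + α * L * ∫ r, Δ t r ∂A.law +
      β / L * ∫ r, shiftError ℓ D (A.state D t r) ∂A.law)
    (N := fun t => ∫ r, ‖gradient (globalLoss ℓ D) (A.iterate D t r)‖ ^ 2 ∂A.law)
    (w := 3 * β / (2 * (1 + ω) * L) * (C₂ + d * A.varP)) (Φ₀ := A.potential ℓ D L α β Δ)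
    (B := ⨅ x, globalLoss ℓ D x) hη hT ?_ ?_ ?_
  · refine key.trans (le_of_eq ?_)
    field_simp
  · intro t ht
    have hunb := h.unbiasedAt (hA.unbiased t ht)
    refine potential_step_le (n := n) (θ := θ) (by linarith) hL hβ hn' hη hA.θ_pos hA.C₁_nonneg
      hA.C₃_nonneg hA.C₄_nonneg (integral_nonneg fun r => by positivity)
      (integral_nonneg fun r => shiftError_nonneg _)
      (integral_nonneg fun r => estimateError_nonneg t _ _)
      (by positivity) hα hη₁ hη₂ (h.integral_globalLoss_le hn hℓ hbdd hunb) ?_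
      (h.integral_shiftError_le hn hℓ hγ hunb) (h.integral_Δ_le hn hA hℓ ht)
      (hA.integral_estimateError_le ht)
    rw [add_sub_cancel_left]
    exact h.integral_norm_iterate_sub_sq_le hn hℓ hunb
  · simp only [iterate, state, initState, shiftError, integral_const, probReal_univ, one_smul,
      potential]
    field_simp
    ring
  · have h1 : ⨅ x, globalLoss ℓ D x ≤ ∫ r, globalLoss ℓ D (A.iterate D T r) ∂A.law := by
      have h2 := integral_mono (μ := A.law) (integrable_const _)
        (h.integrable_globalLoss hn hℓ hbdd T) fun r => ciInf_le hbdd (A.iterate D T r)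
      simpa using h2
    have h2 : 0 ≤ ∫ r, Δ T r ∂A.law := integral_nonneg fun r => hA.Δ_nonneg T le_rfl r
    have h3 : 0 ≤ ∫ r, shiftError ℓ D (A.state D T r) ∂A.law :=
      integral_nonneg fun r => shiftError_nonneg _
    have h4 : 0 ≤ α * L * ∫ r, Δ T r ∂A.law := by positivity
    have h5 : 0 ≤ β / L * ∫ r, shiftError ℓ D (A.state D T r) ∂A.law := by positivity
    linarith

end SoteriaFL

theorem theorem2 (κ : ℝ) (hκ : 0 < κ) :
    ∃ c > (0 : ℝ), ∃ c' > (0 : ℝ), ∃ K > (0 : ℝ),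
      ∀ (n m d T : ℕ) (𝒟 : Type u₁) (U : Type u₂) (V : Type u₃) (W : Type u₄) (S : Type u₅)
        [MeasurableSpace U] [MeasurableSpace V] [MeasurableSpace W] [MeasurableSpace S]
        (A : SoteriaFL n m d 𝒟 U V W S) (ℓ : 𝒟 → Vec d → ℝ) (D : Fin n → Fin m → 𝒟)
        (L ω G_A G_B C₁ C₂ C₃ C₄ θ α β ε δ Φ₀ M : ℝ)
        (Δ : ℕ → (ℕ → RoundSeed n m d V W S) → ℝ),
        0 < n → 0 < m → 0 < T → 0 < A.b → A.b ≤ m →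
        0 < L → (∀ i j, IsSmooth L (ℓ (D i j))) →
        BddBelow (Set.range (globalLoss ℓ D)) →
        A.GenericAssumption ℓ D T G_A G_B C₁ C₂ C₃ C₄ θ Δ →
        0 ≤ ω → (∀ t i, IsCompression ω (A.compLaw t i : Measure S) (A.comp t i)) →
        0 < β → α = 3 * β * C₁ / (2 * (1 + ω) * θ * L ^ 2) →
        0 < A.η →
        A.η ≤ min
          (1 / ((1 + 2 * α * C₄ + 4 * β * (1 + ω) + 2 * α * C₃ / A.η ^ 2) * L))
          (Real.sqrt (β * n) /
            (Real.sqrt (1 + 2 * α * C₄ + 4 * β * (1 + ω)) * (1 + ω) * L)) →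
        A.γ = Real.sqrt ((1 + 2 * ω) / (2 * (1 + ω) ^ 3)) →
        0 < ε → 0 < δ → δ < 1 →
        A.varP = c * ((G_A ^ 2 / 4 + G_B ^ 2) * T * Real.log (1 / δ) / (m ^ 2 * ε ^ 2)) →
        Φ₀ = A.potential ℓ D L α β Δ →
        M = max
          (m * ε * Real.sqrt (2 * (1 + ω) * L * Φ₀) /
            Real.sqrt (3 * β * c * d * (G_A ^ 2 / 4 + G_B ^ 2) * Real.log (1 / δ)))
          (C₂ * m ^ 2 * ε ^ 2 / (c * d * (G_A ^ 2 / 4 + G_B ^ 2) * Real.log (1 / δ))) →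
        (ε < c' * A.b ^ 2 * T / m ^ 2 → ε ≤ κ * Real.log (1 / δ) → A.SatisfiesLDP T ε δ) ∧
        (∀ t < T, Integrable
          (fun r => ‖gradient (globalLoss ℓ D) (A.iterate D t r)‖ ^ 2) A.law) ∧
        A.avgSqGrad ℓ D T ≤ 2 * Φ₀ / (A.η * T)
          + 3 * β / ((1 + ω) * L * A.η) *
            (C₂ + c * (G_A ^ 2 / 4 + G_B ^ 2) * d * T * Real.log (1 / δ) / (m ^ 2 * ε ^ 2)) ∧
        (M ≤ T → T ≤ 2 * M →
          A.avgSqGrad ℓ D T ≤ K * max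
            (Real.sqrt Φ₀ *
              (Real.sqrt (β * d * (G_A ^ 2 / 4 + G_B ^ 2) * Real.log (1 / δ)) /
                (A.η * m * ε * Real.sqrt ((1 + ω) * L))))
            (β * C₂ / ((1 + ω) * L * A.η))) := by
  -- `satisfiesLDP` dictates `c` and `c'`, and `balanced_rounds_le` then dictates `K`.
  refine ⟨4000 * (2 * κ + 4) ^ 2, by positivity, 4000 * (2 * κ + 4) ^ 2 / (4096 * (2 * κ + 4)),
    by positivity, 3 * Real.sqrt (6 * (4000 * (2 * κ + 4) ^ 2)) + 9, by positivity, ?_⟩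
  intro n m d T 𝒟 U V W S _ _ _ _ A ℓ D L ω G_A G_B C₁ C₂ C₃ C₄ θ α β ε δ Φ₀ M Δ hn hm hT hb hbm
    hL hsmooth hbdd hA hω hC hβ hα hη hηmin hγ hε hδ hδ1 hvar hΦ₀ hM
  obtain ⟨c, hc⟩ : ∃ c : ℝ, c = 4000 * (2 * κ + 4) ^ 2 := ⟨_, rfl⟩
  have hc0 : 0 < c := by rw [hc]; positivity
  rw [← hc] at hvar hM ⊢
  have hn' : (0 : ℝ) < n := by exact_mod_cast hn
  have hm' : (0 : ℝ) < m := by exact_mod_cast hm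
  have hT' : (0 : ℝ) < T := by exact_mod_cast hT
  have hlog : 0 < Real.log (1 / δ) := Real.log_pos (by rw [one_div]; exact one_lt_inv₀ hδ |>.2 hδ1)
  have hv0 : 0 ≤ A.varP := by rw [hvar]; positivity
  have hmom : A.HasFiniteMoments ω G_A G_B :=
    ⟨hω, hC, hA.bound_φ, hA.bound_ψ, hA.G_A_nonneg, hv0⟩
  have hℓ : ∀ i, IsSmooth L (localLoss ℓ (D i)) := fun i => IsSmooth.localLoss hm (hsmooth i)
  have hα0 : 0 ≤ α := by
    have := hA.C₁_nonneg
    have := hA.θ_pos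
    rw [hα]
    positivity
  obtain ⟨hη₁, hη₂⟩ := le_min_iff.1 hηmin
  have hconv : A.avgSqGrad ℓ D T ≤ 2 * Φ₀ / (A.η * T) + 3 * β / ((1 + ω) * L * A.η) *
      (C₂ + c * (G_A ^ 2 / 4 + G_B ^ 2) * d * T * Real.log (1 / δ) / (m ^ 2 * ε ^ 2)) := by
    refine (hA.avgSqGrad_le hmom hn hT hL hℓ hbdd hβ hα hη hη₁ hη₂ hγ).trans (le_of_eq ?_)
    rw [hΦ₀, hvar]
    ring
  refine ⟨fun hεb hεκ => SoteriaFL.satisfiesLDP (fun t i => (hC t i).measurable) hκ hc hA.bound_φ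
    hA.bound_ψ hm hT hb hbm hε hδ hδ1 hvar hεb hεκ,
    fun t _ => hmom.integrable_norm_gradient_sq hn hℓ t, hconv, fun hMT hTM => ?_⟩
  have hΦ0 : 0 ≤ Φ₀ := hΦ₀ ▸ hA.potential_nonneg hL hα0 hβ hbdd
  have hbal := balanced_rounds_le (y := (1 + ω) * L) (β := β) (c := c) (d := d)
    (g := (G_A ^ 2 / 4 + G_B ^ 2) * Real.log (1 / δ)) (k := m * ε) (P := Φ₀) (C₂ := C₂) (η := A.η)
    (T := T) (M := M) (by positivity) hβ hc0 (by positivity) (by positivity) (by positivity) hΦ0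
    hA.C₂_nonneg hη hT' (by rw [hM]; congr 1 <;> ring_nf) hMT hTM
  refine (hconv.trans (le_of_eq ?_)).trans (hbal.trans (le_of_eq ?_))
  · ring
  · ring_nf
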